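/- Let $n\ge 1$, $k\ge 0$, $m\ge 1$ be integers. For a rooted labeled tree $T$ on $[n]=\{1,\dots,n\}$ and a node $x$, let $T_x=T(x)$ be the subtree rooted at $x$ and $\beta(x)=\beta(T_x)=\min T_x$; write $z\prec x$ if $z\in T_x$ (so $x\prec x$); $\deg(x)$ is the number of children of $x$. The edge from $y$ to its father $x$ is proper if $x<\beta(y)$, and improper otherwise. Let $\mathcal R^{(0)}_{n,k}$ be the set of rooted labeled trees on $[n]$ with exactly $k$ improper edges and with no proper edge on the path from $n$ to the root; a list of conditions in brackets denotes the subset of trees that satisfy them. Let $$\alpha=\max\{\beta(b): b\text{ a child of }n\},\qquad \beta^*=\min\{\beta(a): a\text{ a child of }1\}$$ (when $\deg(n)>0$, respectively $\deg(1)>0$), and, when $\deg(n)>0$, let $\lambda$ be the first node $u\ne n$ on the path from $n$ down to $\beta(n)$ such that every node of $T_n-T_u$ is greater than $u$. The minimum of an empty set of nodes is regarded as $+\infty$. Moving a subtree means cutting it off from its father and joining it to another node as a subtree. The maps described below are bijections: (a) $\mathcal R^{(0)}_{n,k}[\deg(1)=m,\,1\not\prec n,\,\alpha<\beta^*]\longleftrightarrow\mathcal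 R^{(0)}_{n,k+m}[\deg(1)=0,\,\deg(n)\ge m+1,\,1\not\prec n]$: move all subtrees of $1$ to $n$. (b) $\mathcal R^{(0)}_{n,k}[\deg(1)=m,\,\alpha>\beta^*]\longleftrightarrow\mathcal R^{(0)}_{n,k+m}[\deg(1)=0,\,\deg(n)=m,\,1\not\prec n]$: exchange the node $n$ and the subtree $T_\alpha$ (so $T_\alpha$ takes the place of $n$, the other subtrees of $n$ are joined to $\alpha$, and $n$ becomes a leaf in the former place of $T_\alpha$); then move all subtrees of $1$ to $n$. (c) $\mathcal R^{(0)}_{n,k}[\deg(1)=m,\,1\prec n,\,\deg(n)\ge 2,\,\alpha<\beta^*]\longleftrightarrow\mathcal R^{(0)}_{n,k+m}[\deg(1)=0,\,\deg(n)\ge m+1,\,1\prec n,\,\lambda>1]$: let $b_1,\dots,b_j$ be the children of $n$ with $1=\beta(b_1)<\beta(b_2)<\dots<\beta(b_j)$, and let $c$ be the first node on the path from $b_2$ down to $\beta(b_2)$ with $c<\beta(T(b_2)-T(c))$, $c<\beta^*$ and, if $j\ge3$, $c<\beta(b_3)$; move $T_{b_1}$ to $c$ and all subtrees of $1$ to $n$.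 (d) $\mathcal R^{(0)}_{n,k}[\deg(1)=m,\,1\prec n,\,\deg(n)=1]\longleftrightarrow\mathcal R^{(0)}_{n,k+m}[\deg(1)=0,\,\deg(n)=m,\,1\prec n,\,\lambda>1]$: let $b$ be the child of $n$ and let $a_1,\dots,a_m$ be the children of $1$ with $\beta(a_1)<\dots<\beta(a_m)$; move $T_{a_2},\dots,T_{a_m}$ to $n$, and in the resulting tree replace the subtree $S$ rooted at $b$ by the tree $S'$ defined as follows. Put $v=a_1$, $w=\beta(v)$, and let $b=v_1,\dots,v_t=1$ be the path from $b$ to $1$. Let $j_1<\dots<j_s=t$ be the indices $j$ with $v_j<\beta(S(v_1)-S(v_j))$ and $v_j<w$. Cut the edge $(1,v)$ and the edges $(v_{j_i},v_{j_i+1})$ for $1\le i<s$; this splits $S$ into $S_v$ and $s$ trees $R_1,\dots,R_s$, with roots $v_1,v_{j_1+1},\dots,v_{j_{s-1}+1}$. Then $S'$ is obtained from $S_v$ by joining every $R_i$ as a subtree of the node $w$. Moreover, the four sets on the left are pairwise disjoint with union $\mathcal R^{(0)}_{n,k}[\deg(1)=m]$, and the four sets on the right are pairwise disjoint with union $\mathcal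 R^{(0)}_{n,k+m}[\deg(1)=0,\,\deg(n)\ge m,\,\lambda>1]$; so (a)–(d) together refine a bijection between these two sets. -/

import Mathlib

/-- A father map on a set `V` of labels encodes a rooted labeled tree with node set `V`:
`p x` is the father of `x` when `x` is not the root, and the root is sent to itself.
It is a rooted tree when some fixed point is reached from every node by going up
(this fixed point is then unique, and the tree and the map determine each other). -/
def IsRootedTree {V : Type*} (p : V → V) : Prop :=
  ∃ r : V, p r = r ∧ ∀ x : V, ∃ j : ℕ, p^[j] x = r

/-- `z ≺ x`: the node `z` is a descendant of the node `x` (every node descends from itself). -/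
def IsDesc {V : Type*} (p : V → V) (z x : V) : Prop := ∃ j : ℕ, p^[j] z = x

/-- `u` lies on the path from `x` down to its descendant `y` (end points included). -/
def OnPath {V : Type*} (p : V → V) (x y u : V) : Prop := IsDesc p u x ∧ IsDesc p y u

/-- `u` is the first node satisfying `P` on the path that goes from `x` down to `y`. -/
def IsFirstOnPath {V : Type*} (p : V → V) (x y : V) (P : V → Prop) (u : V) : Prop :=
  OnPath p x y u ∧ P u ∧ ∀ u' : V, OnPath p x y u' → P u' → IsDesc p u' u

open Classical in
/-- Cut off the subtree rooted at each node of `S` and join it to the node `y`. -/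
noncomputable def moveSubtrees {V : Type*} (p : V → V) (S : Finset V) (y : V) : V → V :=
  fun z => if z ∈ S then y else p z

open Classical in
/-- Exchange the labels of the nodes `x` and `y`. -/
noncomputable def exchangeLabels {V : Type*} (p : V → V) (x y : V) : V → V :=
  fun z => Equiv.swap x y (p (Equiv.swap x y z))

section Tree

variable {V : Type*} [Fintype V]

open Classical in
/-- The set of nodes of the subtree `T_x`. -/
noncomputable def subtree (p : V → V) (x : V) : Finset V :=
  Finset.univ.filter (fun z => IsDesc p z x)

theorem subtree_nonempty (p : V → V) (x : V) : (subtree p x).Nonempty :=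
  ⟨x, by simp only [subtree, Finset.mem_filter, Finset.mem_univ, true_and]; exact ⟨0, rfl⟩⟩

variable [LinearOrder V] [BoundedOrder V]

open Classical in
/-- The set of children of the node `x`. -/
noncomputable def children (p : V → V) (x : V) : Finset V :=
  Finset.univ.filter (fun y => p y = x ∧ y ≠ x)

/-- The degree of `x`: its number of children. -/
noncomputable def deg (p : V → V) (x : V) : ℕ := (children p x).card

/-- `β(x)`: the smallest node of the subtree `T_x`. -/
noncomputable def beta (p : V → V) (x : V) : V := (subtree p x).min' (subtree_nonempty p x)

/-- The edge from `y` (not the root) to its father is proper: the father is smaller than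
every node of `T_y`. -/
def IsProperEdge (p : V → V) (y : V) : Prop := p y ≠ y ∧ p y < beta p y

/-- The edge from `y` (not the root) to its father is improper. -/
def IsImproperEdge (p : V → V) (y : V) : Prop := p y ≠ y ∧ ¬ p y < beta p y

open Classical in
/-- The number of improper edges. -/
noncomputable def improperCount (p : V → V) : ℕ :=
  (Finset.univ.filter (fun y => IsImproperEdge p y)).card

open Classical in
/-- The number of proper edges on the path from the largest node `⊤` to the root. -/
noncomputable def properOnTopPath (p : V → V) : ℕ :=
  (Finset.univ.filter (fun y => IsDesc p ⊤ y ∧ IsProperEdge p y)).card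

/-- `α`: the largest `β(b)` over the children `b` of the largest node `⊤`
(meaningful when `⊤` has a child). -/
noncomputable def alpha (p : V → V) : V := (children p ⊤).sup (beta p)

/-- `β*`: the smallest `β(a)` over the children `a` of the smallest node `⊥`
(meaningful when `⊥` has a child). -/
noncomputable def betaStar (p : V → V) : V := (children p ⊥).inf (beta p)

/-- `u < β(T_x - T_u)`: every node of `T_x` outside `T_u` is greater than `u`. -/
def BelowRest (p : V → V) (x u : V) : Prop := ∀ z ∈ subtree p x, z ∉ subtree p u → u < z

/-- `λ`: the lower critical node, i.e. the first node `u ≠ ⊤` on the path from `⊤` to `β(⊤)`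
with `u < β(T_⊤ - T_u)` (meaningful when `⊤` has a child). -/
noncomputable def lowerCritical (p : V → V) : V :=
  Classical.epsilon (IsFirstOnPath p ⊤ (beta p ⊤) (fun u => u ≠ ⊤ ∧ BelowRest p ⊤ u))

/-- The node of the nonempty set `C` whose subtree has the smallest minimum. -/
noncomputable def argminBeta (p : V → V) (C : Finset V) : V :=
  Classical.epsilon (fun b => b ∈ C ∧ ∀ b' ∈ C, beta p b ≤ beta p b')

/-- Move all subtrees of `⊥` to `⊤`. -/
noncomputable def mapA (p : V → V) : V → V := moveSubtrees p (children p ⊥) ⊤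

/-- Exchange the node `⊤` and the subtree `T_α`: the subtree `T_α` takes the place of the node
`⊤`, with the other subtrees of `⊤` now hanging from `α`, and `⊤` becomes a leaf at the place
where `T_α` was. (After an exchange of labels, the former subtrees of `α` hang from `⊤`; they
follow `α`.) -/
noncomputable def exchangeTop (p : V → V) : V → V :=
  moveSubtrees (exchangeLabels p ⊤ (alpha p))
    (children (exchangeLabels p ⊤ (alpha p)) ⊤) (alpha p)

/-- Exchange the node `⊤` and the subtree `T_α`, then move all subtrees of `⊥` to `⊤`. -/
noncomputable def mapB (p : V → V) : V → V :=
  moveSubtrees (exchangeTop p) (children (exchangeTop p) ⊥) ⊤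

open Classical in
/-- The children `b` of `⊤` with `⊥ ≺ b`; there is exactly one when `⊥ ≺ ⊤ ≠ ⊥`. -/
noncomputable def childrenAboveBot (p : V → V) : Finset V :=
  (children p ⊤).filter (fun b => IsDesc p ⊥ b)

open Classical in
/-- The children `b` of `⊤` with `⊥ ⊀ b`. -/
noncomputable def childrenOffBot (p : V → V) : Finset V :=
  (children p ⊤).filter (fun b => ¬ IsDesc p ⊥ b)

/-- Let `b₁, b₂, …, b_j` be the children of `⊤` in increasing order of `β`, with `⊥ ≺ b₁`.
This is `b₂`. -/
noncomputable def secondChild (p : V → V) : V := argminBeta p (childrenOffBot p)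

/-- The first node `c` on the path from `b₂` to `β(b₂)` such that `c < β(T(b₂) - T(c))`,
`c < β*`, and `c < β(b₃)` if `j ≥ 3` (equivalently `c < β(b_i)` for all `i ≥ 3`). -/
noncomputable def joinNode (p : V → V) : V :=
  Classical.epsilon (IsFirstOnPath p (secondChild p) (beta p (secondChild p)) (fun c =>
    BelowRest p (secondChild p) c ∧ c < betaStar p ∧
      ∀ b ∈ childrenOffBot p, b ≠ secondChild p → c < beta p b))

/-- Move the subtree `T_{b₁}` to the node `joinNode`, and all subtrees of `⊥` to `⊤`. -/
noncomputable def mapC (p : V → V) : V → V :=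
  moveSubtrees (moveSubtrees p (childrenAboveBot p) (joinNode p)) (children p ⊥) ⊤

/-- The nodes at which the path from `b` down to `⊥` is cut: those nodes `u` on it with
`u < β(T_b - T_u)` and `u < w`. (The nodes with the first property decrease along the path,
so from the first cut node on, the second property is automatic.) -/
def IsCutNode (p : V → V) (b w u : V) : Prop := OnPath p b ⊥ u ∧ BelowRest p b u ∧ u < w

open Classical in
/-- Let `⊥` lie in `T_b` and have a unique child `v`, and let `w = β(v)`. Replace the subtree
`S = T_b` by the tree `S'` obtained as follows. Let `b = v_1, …, v_t = ⊥` be the path from `b`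
to `⊥` and `v_{j_1}, …, v_{j_s} = ⊥` its cut nodes in this order. Cutting the edge from `⊥` to
`v`, and the edge below each of `v_{j_1}, …, v_{j_{s-1}}` on the path, splits `S` into `T_v` and
pieces `R_1, …, R_s` rooted at `v_1, v_{j_1 + 1}, …, v_{j_{s-1} + 1}`. The tree `S'` is `T_v`
with every `R_i` joined as a subtree of the node `w`. Its root `v` takes the place of `b`. -/
noncomputable def regraft (p : V → V) (b v w : V) : V → V :=
  fun z =>
    if z = v then (if p b = b then v else p b)
    else if OnPath p b ⊥ z ∧ (z = b ∨ IsCutNode p b w (p z)) then w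
    else p z

/-- The child `a₁` of `⊥` with the smallest `β`. -/
noncomputable def firstChildOfBot (p : V → V) : V := argminBeta p (children p ⊥)

/-- Move all subtrees of `⊥` except `T_{a₁}` to the node `⊤`. -/
noncomputable def keepFirst (p : V → V) : V → V :=
  moveSubtrees p ((children p ⊥).erase (firstChildOfBot p)) ⊤

/-- The unique child of `⊤`, when `⊤` has degree one. -/
noncomputable def onlyChildOfTop (p : V → V) : V :=
  Classical.epsilon (fun b => b ∈ children p ⊤)

/-- Move all subtrees of `⊥` except `T_{a₁}` to the node `⊤`; in the resulting tree replace the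
subtree `S` rooted at the (formerly unique) child of `⊤` by `S'`. -/
noncomputable def mapD (p : V → V) : V → V :=
  regraft (keepFirst p) (onlyChildOfTop p) (firstChildOfBot p) (betaStar (keepFirst p))

end Tree

/-- `R^{(i)}_{n,k}`: rooted labeled trees on `n` nodes with `k` improper edges and `i` proper
edges on the path from the largest node to the root. The label `j ∈ {1, …, n}` is the element
`j - 1` of `Fin n`; so `⊥` is the node `1` and `⊤` is the node `n`. -/
def RTrees (n k i : ℕ) [NeZero n] : Set (Fin n → Fin n) :=
  {p | IsRootedTree p ∧ improperCount p = k ∧ properOnTopPath p = i}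

/-- `R^{(0)}_{n,k}[deg(1) = m, 1 ⊀ n, α < β*]` -/
def sourceA (n k m : ℕ) [NeZero n] : Set (Fin n → Fin n) :=
  {p | p ∈ RTrees n k 0 ∧ deg p ⊥ = m ∧ ¬ IsDesc p ⊥ ⊤ ∧ alpha p < betaStar p}

/-- `R^{(0)}_{n,k+m}[deg(1) = 0, deg(n) ≥ m + 1, 1 ⊀ n]` -/
def targetA (n k m : ℕ) [NeZero n] : Set (Fin n → Fin n) :=
  {p | p ∈ RTrees n (k + m) 0 ∧ deg p ⊥ = 0 ∧ m + 1 ≤ deg p ⊤ ∧ ¬ IsDesc p ⊥ ⊤}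

/-- `R^{(0)}_{n,k}[deg(1) = m, α > β*]` -/
def sourceB (n k m : ℕ) [NeZero n] : Set (Fin n → Fin n) :=
  {p | p ∈ RTrees n k 0 ∧ deg p ⊥ = m ∧ betaStar p < alpha p}

/-- `R^{(0)}_{n,k+m}[deg(1) = 0, deg(n) = m, 1 ⊀ n]` -/
def targetB (n k m : ℕ) [NeZero n] : Set (Fin n → Fin n) :=
  {p | p ∈ RTrees n (k + m) 0 ∧ deg p ⊥ = 0 ∧ deg p ⊤ = m ∧ ¬ IsDesc p ⊥ ⊤}

/-- `R^{(0)}_{n,k}[deg(1) = m, 1 ≺ n, deg(n) ≥ 2, α < β*]` -/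
def sourceC (n k m : ℕ) [NeZero n] : Set (Fin n → Fin n) :=
  {p | p ∈ RTrees n k 0 ∧ deg p ⊥ = m ∧ IsDesc p ⊥ ⊤ ∧ 2 ≤ deg p ⊤ ∧ alpha p < betaStar p}

/-- `R^{(0)}_{n,k+m}[deg(1) = 0, deg(n) ≥ m + 1, 1 ≺ n, λ > 1]` -/
def targetC (n k m : ℕ) [NeZero n] : Set (Fin n → Fin n) :=
  {p | p ∈ RTrees n (k + m) 0 ∧ deg p ⊥ = 0 ∧ m + 1 ≤ deg p ⊤ ∧ IsDesc p ⊥ ⊤ ∧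
    ⊥ < lowerCritical p}

/-- `R^{(0)}_{n,k}[deg(1) = m, 1 ≺ n, deg(n) = 1]` -/
def sourceD (n k m : ℕ) [NeZero n] : Set (Fin n → Fin n) :=
  {p | p ∈ RTrees n k 0 ∧ deg p ⊥ = m ∧ IsDesc p ⊥ ⊤ ∧ deg p ⊤ = 1}

/-- `R^{(0)}_{n,k+m}[deg(1) = 0, deg(n) = m, 1 ≺ n, λ > 1]` -/
def targetD (n k m : ℕ) [NeZero n] : Set (Fin n → Fin n) :=
  {p | p ∈ RTrees n (k + m) 0 ∧ deg p ⊥ = 0 ∧ deg p ⊤ = m ∧ IsDesc p ⊥ ⊤ ∧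
    ⊥ < lowerCritical p}

/-!
Moving the subtrees of `1` to `n` turns their `m` proper edges into improper ones. If `α < β*`, this
changes no `β`, hence no other edge type, and the moved subtrees are recognised as the `m` subtrees
of `n` with the largest minima; this is (a).

For (c), `T_{b₁}` is moved from `n` to the highest node `c` that is smaller than everything else in
`T_n - T_{b₁} - T_c`; again no edge changes its type. In the new tree `c` is the first critical node
`λ`, and moving the child of `λ` above `1` back to `n` inverts this merge.

The map (d) is a chain of such merges in disguise: moving the subtrees of `1` to `n` and then `T_b`
to `w = β*` gives a tree in which `w` is critical, and cutting the path from `w` to `1` at the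
critical nodes undoes all merges below `w`. Afterwards `w` is the lowest critical node, and
performing all possible merges at `w` leads back.

In (b), exchanging `n` with `T_α` makes the edge that leads up to `α` the topmost proper edge on
the path from `n` to the root. When the subtrees of `1` arrive at `n`, the proper edges of this path
become improper, because the node `β* < α` now lies below them. Conversely, once the subtrees of
`n` are moved back to `1`, the node `n` is a leaf, so that its edge is proper, and the topmost
proper edge above `n` ends at `α`.
-/

section Descent

variable {V : Type*} {p : V → V} {x y z : V}

namespace IsDesc

lemma refl (p : V → V) (x : V) : IsDesc p x x := ⟨0, rfl⟩

lemma trans (hzy : IsDesc p z y) (hyx : IsDesc p y x) : IsDesc p z x := by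
  obtain ⟨i, rfl⟩ := hzy
  obtain ⟨j, rfl⟩ := hyx
  exact ⟨j + i, Function.iterate_add_apply p j i z⟩

end IsDesc

lemma isDesc_father (p : V → V) (z : V) : IsDesc p z (p z) := ⟨1, rfl⟩

lemma isDesc_iff_eq_or_father : IsDesc p z x ↔ z = x ∨ IsDesc p (p z) x := by
  constructor
  · rintro ⟨_ | j, hj⟩
    · exact Or.inl hj
    · exact Or.inr ⟨j, hj⟩
  · rintro (rfl | h)
    · exact IsDesc.refl p z
    · exact (isDesc_father p z).trans h

lemma isDesc_father_iff (hzx : z ≠ x) : IsDesc p (p z) x ↔ IsDesc p z x := by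
  rw [isDesc_iff_eq_or_father (z := z), or_iff_right hzx]

namespace IsDesc

lemma father (h : IsDesc p z x) (hzx : z ≠ x) : IsDesc p (p z) x :=
  (isDesc_father_iff hzx).2 h

lemma total (hx : IsDesc p z x) (hy : IsDesc p z y) : IsDesc p x y ∨ IsDesc p y x := by
  obtain ⟨i, rfl⟩ := hx
  obtain ⟨j, rfl⟩ := hy
  rcases le_total i j with hij | hij
  · refine Or.inl ⟨j - i, ?_⟩
    rw [← Function.iterate_add_apply, Nat.sub_add_cancel hij]
  · refine Or.inr ⟨i - j, ?_⟩
    rw [← Function.iterate_add_apply, Nat.sub_add_cancel hij]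

lemma eq_of_fixed (h : IsDesc p x y) (hx : p x = x) : x = y := by
  obtain ⟨j, hj⟩ := h
  rwa [Function.iterate_fixed hx] at hj

end IsDesc

namespace IsRootedTree

lemma induction (hp : IsRootedTree p) {P : V → Prop}
    (root : ∀ r, p r = r → P r) (step : ∀ z, p z ≠ z → P (p z) → P z) (z : V) : P z := by
  obtain ⟨r, hr, hd⟩ := hp
  obtain ⟨j, hj⟩ := hd z
  induction j generalizing z with
  | zero => exact root z (by rw [show z = r from hj, hr])
  | succ j ih =>
    by_cases hz : p z = z
    · exact root z hz
    · exact step z hz (ih (p z) hj)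

lemma isDesc_of_fixed (hp : IsRootedTree p) (hx : p x = x) (z : V) : IsDesc p z x := by
  obtain ⟨r, -, hd⟩ := hp
  rw [IsDesc.eq_of_fixed (hd x) hx]
  exact hd z

end IsRootedTree

lemma IsDesc.antisymm (hp : IsRootedTree p) (hxy : IsDesc p x y) (hyx : IsDesc p y x) :
    x = y := by
  induction x using hp.induction generalizing y with
  | root r hr => exact hxy.eq_of_fixed hr
  | step x hx ih =>
    by_contra hne
    exact hx (ih ((hxy.father hne).trans hyx) (isDesc_father p x))

lemma IsRootedTree.not_isDesc_father (hp : IsRootedTree p) (hx : p x ≠ x) :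
    ¬ IsDesc p (p x) x :=
  fun h => hx (h.antisymm hp (isDesc_father p x))

lemma IsRootedTree.eq_of_father_eq (hp : IsRootedTree p) (hx : IsDesc p z x)
    (hy : IsDesc p z y) (hxy : p x = p y) (hpx : p x ≠ x) (hpy : p y ≠ y) : x = y := by
  by_contra hne
  rcases hx.total hy with h | h
  · exact hp.not_isDesc_father hpy (hxy ▸ h.father hne)
  · exact hp.not_isDesc_father hpx (hxy ▸ h.father (Ne.symm hne))

end Descent

section Move

variable {V : Type*} {p : V → V} {S : Finset V} {a x y z : V}

lemma moveSubtrees_of_mem (hz : z ∈ S) : moveSubtrees p S y z = y := by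
  simp [moveSubtrees, hz]

lemma moveSubtrees_of_notMem (hz : z ∉ S) : moveSubtrees p S y z = p z := by
  simp [moveSubtrees, hz]

lemma moveSubtrees_moveSubtrees (hS : ∀ s ∈ S, p s = a) :
    moveSubtrees (moveSubtrees p S y) S a = p := by
  funext z
  by_cases hz : z ∈ S
  · rw [moveSubtrees_of_mem hz, hS z hz]
  · rw [moveSubtrees_of_notMem hz, moveSubtrees_of_notMem hz]

/-- The node `z` lies in one of the subtrees rooted at the nodes of `S`, the subtrees that
`moveSubtrees p S y` carries to `y`. -/
def IsBelow (p : V → V) (S : Finset V) (z : V) : Prop := ∃ s ∈ S, IsDesc p z s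

namespace IsBelow

lemma mono (h : IsBelow p S x) (hz : IsDesc p z x) : IsBelow p S z := by
  obtain ⟨s, hs, h⟩ := h
  exact ⟨s, hs, hz.trans h⟩

lemma of_mem (h : x ∈ S) : IsBelow p S x := ⟨x, h, IsDesc.refl p x⟩

end IsBelow

lemma isBelow_singleton : IsBelow p {x} z ↔ IsDesc p z x := by simp [IsBelow]

lemma isBelow_father_iff (hz : z ∉ S) : IsBelow p S (p z) ↔ IsBelow p S z :=
  exists_congr fun _ => and_congr_right fun hs =>
    isDesc_father_iff (ne_of_mem_of_not_mem hs hz).symm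

lemma isDesc_moveSubtrees_of_not_isBelow (hp : IsRootedTree p) (hz : ¬ IsBelow p S z) :
    IsDesc (moveSubtrees p S y) z x ↔ IsDesc p z x := by
  induction z using hp.induction with
  | root r hr =>
    have hzS : r ∉ S := fun h => hz (.of_mem h)
    have hr' : moveSubtrees p S y r = r := by rw [moveSubtrees_of_notMem hzS, hr]
    exact ⟨fun h => h.eq_of_fixed hr' ▸ IsDesc.refl _ _,
      fun h => h.eq_of_fixed hr ▸ IsDesc.refl _ _⟩
  | step z _ ih =>
    have hzS : z ∉ S := fun h => hz (.of_mem h)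
    rw [isDesc_iff_eq_or_father, moveSubtrees_of_notMem hzS, ih ((isBelow_father_iff hzS).not.2 hz),
      ← isDesc_iff_eq_or_father]

lemma isDesc_moveSubtrees (hp : IsRootedTree p) (hy : ¬ IsBelow p S y) :
    IsDesc (moveSubtrees p S y) z x ↔
      (IsDesc p z x ∧ ∀ s ∈ S, IsDesc p z s → IsDesc p s x → s = x) ∨
        (IsBelow p S z ∧ IsDesc p y x) := by
  induction z using hp.induction with
  | root r hr =>
    have hb : ¬ IsBelow p S r := fun h => hy (h.mono (hp.isDesc_of_fixed hr y))
    rw [isDesc_moveSubtrees_of_not_isBelow hp hb, or_iff_left fun h => hb h.1,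
      and_iff_left fun s hs h => absurd ⟨s, hs, h⟩ hb]
  | step z _ ih =>
    by_cases hzx : z = x
    · subst hzx
      exact iff_of_true (IsDesc.refl _ z)
        (Or.inl ⟨IsDesc.refl p z, fun s _ hzs hsz => hsz.antisymm hp hzs⟩)
    rw [← isDesc_father_iff hzx]
    by_cases hzS : z ∈ S
    · rw [moveSubtrees_of_mem hzS, isDesc_moveSubtrees_of_not_isBelow hp hy, or_iff_right,
        and_iff_right (.of_mem hzS)]
      exact fun h => hzx (h.2 z hzS (IsDesc.refl p z) h.1)
    · rw [moveSubtrees_of_notMem hzS, ih, isBelow_father_iff hzS, isDesc_father_iff hzx]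
      have hcut : ∀ s ∈ S, IsDesc p (p z) s ↔ IsDesc p z s :=
        fun s hs => isDesc_father_iff (ne_of_mem_of_not_mem hs hzS).symm
      simp +contextual only [hcut]

lemma IsRootedTree.moveSubtrees (hp : IsRootedTree p) (hy : ¬ IsBelow p S y) :
    IsRootedTree (moveSubtrees p S y) := by
  obtain ⟨r, hr, hd⟩ := id hp
  have hb : ¬ IsBelow p S r := fun h => hy (h.mono (hd y))
  refine ⟨r, by rw [moveSubtrees_of_notMem fun h => hb (.of_mem h), hr], fun x => ?_⟩
  rw [← IsDesc, isDesc_moveSubtrees hp hy]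
  by_cases hx : IsBelow p S x
  · exact Or.inr ⟨hx, hd y⟩
  · exact Or.inl ⟨hd x, fun s hs h => absurd ⟨s, hs, h⟩ hx⟩

lemma isDesc_moveSubtrees_of_isBelow (hp : IsRootedTree p) (hS : ∀ s ∈ S, p s = a ∧ s ≠ a)
    (hy : ¬ IsBelow p S y) (hx : IsBelow p S x) :
    IsDesc (moveSubtrees p S y) z x ↔ IsDesc p z x := by
  rw [isDesc_moveSubtrees hp hy, or_iff_left fun h => hy (hx.mono h.2), and_iff_left_iff_imp]
  intro _ s hs _ hsx
  obtain ⟨t, ht, hxt⟩ := hx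
  have hne : ∀ s ∈ S, p s ≠ s := fun s hs => (hS s hs).1 ▸ (hS s hs).2.symm
  have hst : s = t := hp.eq_of_father_eq (IsDesc.refl p s) (hsx.trans hxt)
    (by rw [(hS s hs).1, (hS t ht).1]) (hne s hs) (hne t ht)
  exact hsx.antisymm hp (hst ▸ hxt)

lemma isDesc_moveSubtrees_singleton {r : V} (hp : IsRootedTree p) (hy : ¬ IsDesc p y r) :
    IsDesc (moveSubtrees p {r} y) z x ↔
      (IsDesc p z x ∧ (IsDesc p z r → IsDesc p r x → r = x)) ∨
        (IsDesc p z r ∧ IsDesc p y x) := by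
  rw [isDesc_moveSubtrees hp (isBelow_singleton.not.2 hy), isBelow_singleton]
  simp only [Finset.mem_singleton, forall_eq]

end Move

section Children

variable {V : Type*} [Fintype V] {p : V → V} {a b c x y z : V}

lemma mem_subtree : z ∈ subtree p x ↔ IsDesc p z x := by simp [subtree]

variable [LinearOrder V]

lemma mem_children : y ∈ children p x ↔ p y = x ∧ y ≠ x := by simp [children]

lemma father_ne_of_mem_children (h : y ∈ children p x) : p y ≠ y := by
  rw [mem_children] at h
  rw [h.1]
  exact h.2.symm

lemma isDesc_of_mem_children (h : y ∈ children p x) : IsDesc p y x :=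
  (mem_children.1 h).1 ▸ isDesc_father p y

lemma IsRootedTree.not_isDesc_of_mem_children (hp : IsRootedTree p) (h : y ∈ children p x) :
    ¬ IsDesc p x y :=
  fun hxy => (mem_children.1 h).2 ((isDesc_of_mem_children h).antisymm hp hxy)

lemma IsRootedTree.eq_of_mem_children (hp : IsRootedTree p) (ha : a ∈ children p x)
    (hb : b ∈ children p x) (hza : IsDesc p z a) (hzb : IsDesc p z b) : a = b :=
  hp.eq_of_father_eq hza hzb (by rw [(mem_children.1 ha).1, (mem_children.1 hb).1])
    (father_ne_of_mem_children ha) (father_ne_of_mem_children hb)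

lemma IsRootedTree.not_isBelow_children (hp : IsRootedTree p) : ¬ IsBelow p (children p x) x :=
  fun ⟨_, hs, h⟩ => hp.not_isDesc_of_mem_children hs h

lemma IsDesc.exists_mem_children (h : IsDesc p z x) (hzx : z ≠ x) :
    ∃ c ∈ children p x, IsDesc p z c := by
  obtain ⟨j, hj⟩ := h
  induction j generalizing z with
  | zero => exact absurd hj hzx
  | succ j ih =>
    by_cases hz : p z = x
    · exact ⟨z, mem_children.2 ⟨hz, hzx⟩, IsDesc.refl p z⟩
    · obtain ⟨c, hc, hd⟩ := ih hz hj
      exact ⟨c, hc, (isDesc_father p z).trans hd⟩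

lemma IsDesc.isDesc_child_or_isDesc_father (hc : c ∈ children p x) (hzc : IsDesc p z c)
    (hzy : IsDesc p z y) : IsDesc p y c ∨ IsDesc p x y := by
  rcases hzy.total hzc with h | h
  · exact Or.inl h
  by_cases hcy : c = y
  · exact Or.inl (hcy ▸ IsDesc.refl p c)
  · exact Or.inr ((mem_children.1 hc).1 ▸ h.father hcy)

end Children

lemma exists_isDesc_top_of_chain {V : Type*} [Finite V] {p : V → V} {P : V → Prop}
    (hchain : ∀ u u', P u → P u' → IsDesc p u u' ∨ IsDesc p u' u) (hP : ∃ u, P u) :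
    ∃ u, P u ∧ ∀ u', P u' → IsDesc p u' u := by
  cases nonempty_fintype V
  obtain ⟨u, hu, hmax⟩ :=
    Set.exists_max_image {u | P u} (fun u => (subtree p u).card) (Set.toFinite _) hP
  refine ⟨u, hu, fun u' hu' => (hchain u u' hu hu').elim (fun h => ?_) id⟩
  have hsub : subtree p u ⊆ subtree p u' := fun z hz =>
    mem_subtree.2 ((mem_subtree.1 hz).trans h)
  exact mem_subtree.1
    (Finset.eq_of_subset_of_card_le hsub (hmax u' hu') ▸ mem_subtree.2 (IsDesc.refl p u'))

section Beta

variable {V : Type*} [Fintype V] [LinearOrder V] {p q : V → V} {S : Finset V} {a x y z : V}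

lemma beta_le (h : IsDesc p z x) : beta p x ≤ z := Finset.min'_le _ _ (mem_subtree.2 h)

lemma isDesc_beta (p : V → V) (x : V) : IsDesc p (beta p x) x :=
  mem_subtree.1 (Finset.min'_mem _ _)

lemma beta_le_beta (h : IsDesc p y x) : beta p x ≤ beta p y :=
  beta_le ((isDesc_beta p y).trans h)

lemma le_beta_iff : y ≤ beta p x ↔ ∀ z, IsDesc p z x → y ≤ z :=
  ⟨fun h _ hz => h.trans (beta_le hz), fun h => h _ (isDesc_beta p x)⟩

lemma beta_congr (h : ∀ z, IsDesc p z x ↔ IsDesc q z x) : beta p x = beta q x :=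
  le_antisymm (beta_le ((h _).2 (isDesc_beta q x))) (beta_le ((h _).1 (isDesc_beta p x)))

lemma IsRootedTree.injOn_beta_children (hp : IsRootedTree p) (x : V) :
    Set.InjOn (beta p) (children p x) := fun a ha b hb h =>
  hp.eq_of_mem_children ha hb (isDesc_beta p a) (h ▸ isDesc_beta p b)

lemma beta_moveSubtrees (hp : IsRootedTree p) (hS : S ⊆ children p a) (hy : ¬ IsBelow p S y)
    (haS : ∀ s ∈ S, beta p a < beta p s) (hyS : ∀ s ∈ S, beta p y < beta p s) (x : V) :
    beta (moveSubtrees p S y) x = beta p x := by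
  by_cases hx : IsBelow p S x
  · exact beta_congr fun z =>
      isDesc_moveSubtrees_of_isBelow hp (fun s hs => mem_children.1 (hS hs)) hy hx
  apply le_antisymm
  · refine beta_le ((isDesc_moveSubtrees hp hy).2 (Or.inl ⟨isDesc_beta p x, ?_⟩))
    intro s hs hxs hsx
    by_contra hne
    have hax : IsDesc p a x := (mem_children.1 (hS hs)).1 ▸ hsx.father hne
    exact ((beta_le hxs).trans (beta_le_beta hax)).not_gt (haS s hs)
  · rcases (isDesc_moveSubtrees hp hy).1 (isDesc_beta (moveSubtrees p S y) x) with
      h | ⟨⟨s, hs, hzs⟩, hyx⟩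
    · exact beta_le h.1
    · exact (beta_le_beta hyx).trans ((hyS s hs).le.trans (beta_le hzs))

lemma isImproperEdge_iff_exists_le :
    IsImproperEdge p y ↔ p y ≠ y ∧ ∃ z, IsDesc p z y ∧ z ≤ p y :=
  and_congr_right fun _ => by
    rw [not_lt]
    exact ⟨fun h => ⟨_, isDesc_beta p y, h⟩, fun ⟨_, hz, h⟩ => (beta_le hz).trans h⟩

lemma isImproperEdge_congr (hf : p z = q z) (hb : beta p z = beta q z) :
    IsImproperEdge p z ↔ IsImproperEdge q z := by
  rw [IsImproperEdge, IsImproperEdge, hf, hb]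

lemma improperCount_eq_add_card (e : Equiv.Perm V)
    (h : ∀ z, IsImproperEdge q z ↔ z ∈ S ∨ IsImproperEdge p (e z))
    (hS : ∀ z ∈ S, ¬ IsImproperEdge p (e z)) :
    improperCount q = improperCount p + S.card := by
  classical
  have hq : Finset.univ.filter (IsImproperEdge q) =
      (Finset.univ.filter (IsImproperEdge p)).map e.symm.toEmbedding ∪ S := by
    ext z
    simp [h, or_comm]
  have hdisj : Disjoint ((Finset.univ.filter (IsImproperEdge p)).map e.symm.toEmbedding) S := by
    rw [Finset.disjoint_right]
    intro z hz
    simpa [Equiv.symm_apply_eq] using hS z hz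
  rw [improperCount, improperCount, hq, Finset.card_union_of_disjoint hdisj, Finset.card_map]

lemma mem_children_moveSubtrees_of_mem (hz : z ∈ S) :
    z ∈ children (moveSubtrees p S y) x ↔ y = x ∧ z ≠ x := by
  rw [mem_children, moveSubtrees_of_mem hz]

lemma mem_children_moveSubtrees_of_notMem (hz : z ∉ S) :
    z ∈ children (moveSubtrees p S y) x ↔ z ∈ children p x := by
  rw [mem_children, mem_children, moveSubtrees_of_notMem hz]

end Beta

section TopImproper

variable {V : Type*} [Fintype V] [LinearOrder V] [BoundedOrder V] {p : V → V} {S : Finset V}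
  {a b x y z : V}

/-- A rooted tree without proper edge on the path from the largest node to the root: the trees
of the sets `R^{(0)}`. -/
structure IsTopImproper (p : V → V) : Prop where
  isRootedTree : IsRootedTree p
  isImproperEdge : ∀ y, IsDesc p ⊤ y → p y ≠ y → IsImproperEdge p y

lemma isTopImproper_iff : IsTopImproper p ↔ IsRootedTree p ∧ properOnTopPath p = 0 := by
  classical
  have hzero : properOnTopPath p = 0 ↔ ∀ y, IsDesc p ⊤ y → p y ≠ y → IsImproperEdge p y := by
    rw [properOnTopPath, Finset.card_eq_zero, Finset.filter_eq_empty_iff]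
    exact ⟨fun h y hy hne => ⟨hne, fun hlt => h (Finset.mem_univ y) ⟨hy, hne, hlt⟩⟩,
      fun h y _ hy => (h y hy.1 hy.2.1).2 hy.2.2⟩
  rw [hzero]
  exact ⟨fun h => ⟨h.1, h.2⟩, fun h => ⟨h.1, h.2⟩⟩

lemma beta_bot : beta p ⊥ = ⊥ := le_bot_iff.1 (beta_le (IsDesc.refl p ⊥))

lemma bot_lt_beta (h : ¬ IsDesc p ⊥ x) : ⊥ < beta p x :=
  bot_lt_iff_ne_bot.2 fun he => h (he ▸ isDesc_beta p x)

lemma IsRootedTree.bot_lt_beta_of_mem_children (hp : IsRootedTree p) (h : y ∈ children p ⊥) :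
    ⊥ < beta p y :=
  bot_lt_beta (hp.not_isDesc_of_mem_children h)

lemma isImproperEdge_of_father_eq_top (h : p y = ⊤) (hy : y ≠ ⊤) : IsImproperEdge p y :=
  ⟨h ▸ hy.symm, h ▸ not_top_lt⟩

lemma IsRootedTree.not_isImproperEdge_of_mem_children_bot (hp : IsRootedTree p)
    (h : y ∈ children p ⊥) : ¬ IsImproperEdge p y :=
  fun hy => hy.2 ((mem_children.1 h).1 ▸ hp.bot_lt_beta_of_mem_children h)

lemma isImproperEdge_of_isDesc_bot (h : IsDesc p ⊥ y) (hy : p y ≠ y) : IsImproperEdge p y :=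
  isImproperEdge_iff_exists_le.2 ⟨hy, ⊥, h, bot_le⟩

lemma bot_ne_top_of_mem_children (h : y ∈ children p ⊥) : (⊥ : V) ≠ ⊤ :=
  fun he => (mem_children.1 h).2 (le_bot_iff.1 (he ▸ le_top))

lemma exists_beta_eq_alpha (h : (children p ⊤).Nonempty) :
    ∃ b ∈ children p ⊤, beta p b = alpha p := by
  obtain ⟨b, hb, h⟩ := Finset.exists_mem_eq_sup _ h (beta p)
  exact ⟨b, hb, h.symm⟩

lemma exists_beta_eq_betaStar (h : (children p ⊥).Nonempty) :
    ∃ a ∈ children p ⊥, beta p a = betaStar p := by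
  obtain ⟨a, ha, h⟩ := Finset.exists_mem_eq_inf _ h (beta p)
  exact ⟨a, ha, h.symm⟩

lemma beta_le_alpha (h : b ∈ children p ⊤) : beta p b ≤ alpha p := Finset.le_sup h

lemma betaStar_le_beta (h : a ∈ children p ⊥) : betaStar p ≤ beta p a := Finset.inf_le h

lemma alpha_lt_betaStar_of_forall_beta_lt (htop : (children p ⊤).Nonempty)
    (hbot : (children p ⊥).Nonempty)
    (h : ∀ b ∈ children p ⊤, ∀ a ∈ children p ⊥, beta p b < beta p a) :
    alpha p < betaStar p := by
  obtain ⟨b, hb, hbα⟩ := exists_beta_eq_alpha htop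
  obtain ⟨a, ha, haβ⟩ := exists_beta_eq_betaStar hbot
  exact hbα ▸ haβ ▸ h b hb a ha

namespace IsTopImproper

lemma not_isDesc_top_bot (hp : IsTopImproper p) (hne : (⊥ : V) ≠ ⊤) : ¬ IsDesc p ⊤ ⊥ := by
  intro h
  obtain ⟨c, hc, hd⟩ := h.exists_mem_children hne.symm
  exact hp.isRootedTree.not_isImproperEdge_of_mem_children_bot hc
    (hp.isImproperEdge c hd (father_ne_of_mem_children hc))

lemma not_isBelow_children_bot_top (hp : IsTopImproper p) (hne : (⊥ : V) ≠ ⊤) :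
    ¬ IsBelow p (children p ⊥) ⊤ :=
  fun ⟨_, hs, h⟩ => hp.not_isDesc_top_bot hne (h.trans (isDesc_of_mem_children hs))

lemma children_top_nonempty (hp : IsTopImproper p) (hne : (⊥ : V) ≠ ⊤) :
    (children p ⊤).Nonempty := by
  by_contra h
  have hleaf : ∀ z, IsDesc p z ⊤ → z = ⊤ := fun z hz => by
    by_contra hz'
    obtain ⟨c, hc, -⟩ := hz.exists_mem_children hz'
    exact h ⟨c, hc⟩
  by_cases hr : p ⊤ = ⊤
  · exact hne (hleaf ⊥ (hp.isRootedTree.isDesc_of_fixed hr ⊥))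
  · refine (hp.isImproperEdge ⊤ (IsDesc.refl p _) hr).2 ?_
    rw [hleaf _ (isDesc_beta p ⊤)]
    exact lt_top_iff_ne_top.2 hr

lemma moveSubtrees (hp : IsTopImproper p) (hy : ¬ IsBelow p S y) (htop : ¬ IsBelow p S ⊤)
    (hβ : ∀ x, beta (moveSubtrees p S y) x = beta p x) :
    IsTopImproper (moveSubtrees p S y) := by
  refine ⟨hp.isRootedTree.moveSubtrees hy, fun x hx hne => ?_⟩
  rw [isDesc_moveSubtrees_of_not_isBelow hp.isRootedTree htop] at hx
  have hxS : x ∉ S := fun h => htop ⟨x, h, hx⟩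
  rw [isImproperEdge_congr (moveSubtrees_of_notMem hxS) (hβ x)]
  rw [moveSubtrees_of_notMem hxS] at hne
  exact hp.isImproperEdge x hx hne

end IsTopImproper

end TopImproper

section TopPart

variable {ι α : Type*} {f : ι → α} {C U U' : Finset ι}

/-- `U` consists of the elements of `C` with the largest values of `f`. -/
def IsTopPart [LT α] (f : ι → α) (C U : Finset ι) : Prop :=
  U ⊆ C ∧ ∀ b ∈ C, b ∉ U → ∀ u ∈ U, f b < f u

lemma IsTopPart.eq_of_card_eq [Preorder α] (hU : IsTopPart f C U) (hU' : IsTopPart f C U')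
    (hcard : U.card = U'.card) : U = U' := by
  by_contra hne
  obtain ⟨x, hx, hx'⟩ :=
    Finset.not_subset.1 fun hs : U ⊆ U' => hne (Finset.eq_of_subset_of_card_le hs hcard.ge)
  obtain ⟨y, hy, hy'⟩ :=
    Finset.not_subset.1 fun hs : U' ⊆ U => hne (Finset.eq_of_subset_of_card_le hs hcard.le).symm
  exact lt_asymm (hU'.2 x (hU.1 hx) hx' y hy) (hU.2 y (hU'.1 hy) hy' x hx)

lemma exists_isTopPart_card_eq [LinearOrder α] (hf : Set.InjOn f C) {m : ℕ} (hm : m ≤ C.card) :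
    ∃ U, IsTopPart f C U ∧ U.card = m := by
  classical
  induction m with
  | zero => exact ⟨∅, ⟨by simp, by simp⟩, rfl⟩
  | succ m ih =>
    obtain ⟨U, ⟨hUC, hlt⟩, hU⟩ := ih (by omega)
    have hne : (C \ U).Nonempty := by
      rw [← Finset.card_pos, Finset.card_sdiff_of_subset hUC]
      omega
    obtain ⟨c, hc, hmax⟩ := Finset.exists_max_image _ f hne
    rw [Finset.mem_sdiff] at hc
    refine ⟨insert c U, ⟨Finset.insert_subset hc.1 hUC, fun b hb hbU u hu => ?_⟩, ?_⟩
    · rw [Finset.mem_insert, not_or] at hbU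
      rcases Finset.mem_insert.1 hu with rfl | hu
      · exact lt_of_le_of_ne (hmax b (Finset.mem_sdiff.2 ⟨hb, hbU.2⟩))
          fun h => hbU.1 (hf hb hc.1 h)
      · exact hlt b hb hbU.2 u hu
    · rw [Finset.card_insert_of_notMem hc.2, hU]

end TopPart

section Swing

variable {V : Type*} [Fintype V] [LinearOrder V] [BoundedOrder V] {p q : V → V}
  {U : Finset V} {b x y z : V}

/-- The trees without proper edge on the path from `⊤` to the root in which `⊥` has children and
`α < β*`: the subtrees of `⊥` may be moved to `⊤` without changing any `β`. -/
structure Swingable (p : V → V) : Prop extends IsTopImproper p where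
  children_bot_nonempty : (children p ⊥).Nonempty
  alpha_lt_betaStar : alpha p < betaStar p

namespace Swingable

variable (hp : Swingable p)
include hp

lemma bot_ne_top : (⊥ : V) ≠ ⊤ := bot_ne_top_of_mem_children hp.children_bot_nonempty.choose_spec

lemma children_top_nonempty : (children p ⊤).Nonempty :=
  hp.toIsTopImproper.children_top_nonempty hp.bot_ne_top

lemma beta_lt_beta {a : V} (hb : b ∈ children p ⊤) (ha : a ∈ children p ⊥) :
    beta p b < beta p a :=
  (beta_le_alpha hb).trans_lt (hp.alpha_lt_betaStar.trans_le (betaStar_le_beta ha))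

lemma not_isBelow_top : ¬ IsBelow p (children p ⊥) ⊤ :=
  hp.not_isBelow_children_bot_top hp.bot_ne_top

lemma beta_mapA (x : V) : beta (mapA p) x = beta p x := by
  refine beta_moveSubtrees hp.isRootedTree (Finset.Subset.refl _) hp.not_isBelow_top
    (fun s hs => ?_) (fun s hs => ?_) x
  · rw [beta_bot]
    exact hp.isRootedTree.bot_lt_beta_of_mem_children hs
  · obtain ⟨b, hb⟩ := hp.children_top_nonempty
    exact (beta_le_beta (isDesc_of_mem_children hb)).trans_lt (hp.beta_lt_beta hb hs)

lemma isTopImproper_mapA : IsTopImproper (mapA p) :=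
  hp.moveSubtrees hp.not_isBelow_top hp.not_isBelow_top hp.beta_mapA

lemma isDesc_mapA_of_not_isBelow (hz : ¬ IsBelow p (children p ⊥) z) :
    IsDesc (mapA p) z x ↔ IsDesc p z x :=
  isDesc_moveSubtrees_of_not_isBelow hp.isRootedTree hz

lemma isDesc_bot_mapA : IsDesc (mapA p) ⊥ x ↔ IsDesc p ⊥ x :=
  hp.isDesc_mapA_of_not_isBelow hp.isRootedTree.not_isBelow_children

lemma ne_top_of_mem_children_bot (hz : z ∈ children p ⊥) : z ≠ ⊤ :=
  fun h => hp.not_isBelow_top (h ▸ .of_mem hz)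

lemma isImproperEdge_mapA_iff :
    IsImproperEdge (mapA p) z ↔ z ∈ children p ⊥ ∨ IsImproperEdge p z := by
  by_cases hz : z ∈ children p ⊥
  · exact iff_of_true (isImproperEdge_of_father_eq_top (moveSubtrees_of_mem hz)
      (hp.ne_top_of_mem_children_bot hz)) (Or.inl hz)
  · rw [or_iff_right hz]
    exact isImproperEdge_congr (moveSubtrees_of_notMem hz) (hp.beta_mapA z)

lemma improperCount_mapA : improperCount (mapA p) = improperCount p + deg p ⊥ :=
  improperCount_eq_add_card (Equiv.refl V) (fun _ => hp.isImproperEdge_mapA_iff)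
    (fun _ hz => hp.isRootedTree.not_isImproperEdge_of_mem_children_bot hz)

lemma mem_children_top_mapA :
    y ∈ children (mapA p) ⊤ ↔ y ∈ children p ⊤ ∨ y ∈ children p ⊥ := by
  by_cases hy : y ∈ children p ⊥
  · rw [mapA, mem_children_moveSubtrees_of_mem hy]
    exact iff_of_true ⟨rfl, hp.ne_top_of_mem_children_bot hy⟩ (Or.inr hy)
  · rw [mapA, mem_children_moveSubtrees_of_notMem hy, or_iff_left hy]

lemma disjoint_children : Disjoint (children p ⊤) (children p ⊥) :=
  Finset.disjoint_left.2 fun _ hy hy' =>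
    hp.bot_ne_top ((mem_children.1 hy').1.symm.trans (mem_children.1 hy).1)

lemma deg_top_mapA : deg (mapA p) ⊤ = deg p ⊤ + deg p ⊥ := by
  classical
  rw [deg, deg, deg, ← Finset.card_union_of_disjoint hp.disjoint_children]
  congr 1
  ext y
  rw [hp.mem_children_top_mapA, Finset.mem_union]

lemma deg_bot_mapA : deg (mapA p) ⊥ = 0 := by
  rw [deg, Finset.card_eq_zero, Finset.eq_empty_iff_forall_notMem]
  intro y hy
  by_cases hyS : y ∈ children p ⊥
  · exact hp.bot_ne_top ((mem_children_moveSubtrees_of_mem hyS).1 hy).1.symm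
  · exact hyS ((mem_children_moveSubtrees_of_notMem hyS).1 hy)

lemma isTopPart_children_bot :
    IsTopPart (beta (mapA p)) (children (mapA p) ⊤) (children p ⊥) := by
  refine ⟨fun y hy => hp.mem_children_top_mapA.2 (Or.inr hy), fun b hb hbS u hu => ?_⟩
  rw [hp.beta_mapA, hp.beta_mapA]
  exact hp.beta_lt_beta ((hp.mem_children_top_mapA.1 hb).resolve_right hbS) hu

lemma eq_of_mapA_eq (hq : Swingable q) (hdeg : deg p ⊥ = deg q ⊥) (h : mapA p = mapA q) :
    p = q := by
  have hbot : children p ⊥ = children q ⊥ :=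
    hp.isTopPart_children_bot.eq_of_card_eq (h ▸ hq.isTopPart_children_bot) hdeg
  have hback (p : V → V) : moveSubtrees (mapA p) (children p ⊥) ⊥ = p :=
    moveSubtrees_moveSubtrees fun _ hs => (mem_children.1 hs).1
  rw [← hback p, ← hback q, h, hbot]

end Swingable

namespace IsTopPart

variable (hU : IsTopPart (beta q) (children q ⊤) U) (hb : b ∈ children q ⊤) (hbU : b ∉ U)
include hU hb hbU

lemma not_isBelow_bot : ¬ IsBelow q U ⊥ := by
  rintro ⟨s, hs, hd⟩
  exact not_lt_bot ((hU.2 b hb hbU s hs).trans_le (beta_le hd))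

lemma beta_moveSubtrees_bot (hq : IsRootedTree q) (x : V) :
    beta (moveSubtrees q U ⊥) x = beta q x := by
  refine beta_moveSubtrees hq hU.1 (hU.not_isBelow_bot hb hbU) (fun s hs => ?_) (fun s hs => ?_) x
  · exact (beta_le_beta (isDesc_of_mem_children hb)).trans_lt (hU.2 b hb hbU s hs)
  · rw [beta_bot]
    exact bot_le.trans_lt (hU.2 b hb hbU s hs)

lemma children_bot_moveSubtrees (h0 : children q ⊥ = ∅) :
    children (moveSubtrees q U ⊥) ⊥ = U := by
  ext y
  by_cases hy : y ∈ U
  · rw [mem_children_moveSubtrees_of_mem hy]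
    exact iff_of_true ⟨rfl, fun h => hU.not_isBelow_bot hb hbU (h ▸ .of_mem hy)⟩ hy
  · rw [mem_children_moveSubtrees_of_notMem hy, h0]
    exact iff_of_false (Finset.notMem_empty y) hy

lemma swingable_moveSubtrees_bot (hq : IsTopImproper q) (hne : (⊥ : V) ≠ ⊤)
    (h0 : children q ⊥ = ∅) (hU0 : U.Nonempty) : Swingable (moveSubtrees q U ⊥) := by
  have hbot := hU.children_bot_moveSubtrees hb hbU h0
  have hβ := hU.beta_moveSubtrees_bot hb hbU hq.isRootedTree
  have htop : ¬ IsBelow q U ⊤ := fun ⟨s, hs, h⟩ =>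
    hq.isRootedTree.not_isDesc_of_mem_children (hU.1 hs) h
  have himp := hq.moveSubtrees (hU.not_isBelow_bot hb hbU) htop hβ
  refine ⟨himp, hbot.symm ▸ hU0, alpha_lt_betaStar_of_forall_beta_lt
    (himp.children_top_nonempty hne) (hbot.symm ▸ hU0) fun c hc u hu => ?_⟩
  rw [hbot] at hu
  have hcU : c ∉ U := fun h => hne ((mem_children_moveSubtrees_of_mem h).1 hc).1
  rw [hβ, hβ]
  exact hU.2 c ((mem_children_moveSubtrees_of_notMem hcU).1 hc) hcU u hu

end IsTopPart

lemma exists_swingable_mapA_eq (hq : IsTopImproper q) (hne : (⊥ : V) ≠ ⊤) (h0 : deg q ⊥ = 0)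
    {m : ℕ} (hm : 1 ≤ m) (hd : m + 1 ≤ deg q ⊤) :
    ∃ p, Swingable p ∧ deg p ⊥ = m ∧ mapA p = q := by
  rw [deg] at hd
  obtain ⟨U, hU, hUm⟩ :=
    exists_isTopPart_card_eq (hq.isRootedTree.injOn_beta_children ⊤) (m.le_succ.trans hd)
  obtain ⟨b, hb, hbU⟩ : ∃ b ∈ children q ⊤, b ∉ U :=
    Finset.exists_mem_notMem_of_card_lt_card (by omega)
  rw [deg, Finset.card_eq_zero] at h0
  have hbot := hU.children_bot_moveSubtrees hb hbU h0
  refine ⟨moveSubtrees q U ⊥, hU.swingable_moveSubtrees_bot hb hbU hq hne h0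
    (Finset.card_pos.1 (hUm.symm ▸ hm)), by rw [deg, hbot, hUm], ?_⟩
  rw [mapA, hbot]
  exact moveSubtrees_moveSubtrees fun s hs => (mem_children.1 (hU.1 hs)).1

end Swing

section Attach

variable {V : Type*} [Fintype V] [LinearOrder V] [BoundedOrder V] {p p' q q' : V → V}
  {w r r' c c' u x y z : V}

/-- The subtree `T_r`, where `r` is a child of the node `w` of `T_⊤`, contains `⊥`. In the map (c)
this is the subtree `T_{b₁}`, with `w = ⊤`; in the map (d) it is one of the cut pieces. -/
structure Attachable (p : V → V) (w r : V) : Prop extends IsTopImproper p where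
  mem_children : r ∈ children p w
  isDesc_bot : IsDesc p ⊥ r
  isDesc_top : IsDesc p w ⊤

/-- The node `c ≠ w` of `T_w - T_r` is smaller than every node of `T_⊤ - T_r - T_c`: the nodes
to which `T_r` may be moved without changing the type of any edge. -/
structure IsAttachNode (p : V → V) (w r c : V) : Prop where
  isDesc : IsDesc p c w
  ne : c ≠ w
  not_isDesc : ¬ IsDesc p c r
  lt : ∀ z, IsDesc p z ⊤ → ¬ IsDesc p z c → ¬ IsDesc p z r → c < z

/-- `u ∉ {w, ⊥}` lies on the path from `w` to `⊥` and is smaller than every node of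
`T_⊤ - T_u`. When `T_⊤` contains `⊥`, the first critical node for `w = ⊤` is `λ` if `λ ≠ ⊥`. -/
structure IsCritical (p : V → V) (w u : V) : Prop where
  isDesc_bot : IsDesc p ⊥ u
  isDesc : IsDesc p u w
  ne : u ≠ w
  ne_bot : u ≠ ⊥
  lt : ∀ z, IsDesc p z ⊤ → ¬ IsDesc p z u → u < z

namespace Attachable

variable (h : Attachable p w r)
include h

lemma not_isDesc : ¬ IsDesc p w r := h.isRootedTree.not_isDesc_of_mem_children h.mem_children

lemma isDesc : IsDesc p r w := isDesc_of_mem_children h.mem_children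

lemma not_isDesc_top : ¬ IsDesc p ⊤ r := fun h' => h.not_isDesc (h.isDesc_top.trans h')

lemma ne_bot : w ≠ ⊥ := by
  rintro rfl
  exact h.not_isDesc h.isDesc_bot

lemma bot_ne_top : (⊥ : V) ≠ ⊤ := fun he => h.not_isDesc_top (he ▸ h.isDesc_bot)

lemma eq (h' : Attachable p w r') : r = r' :=
  h.isRootedTree.eq_of_mem_children h.mem_children h'.mem_children h.isDesc_bot h'.isDesc_bot

lemma moveSubtrees_moveSubtrees : moveSubtrees (moveSubtrees p {r} c) {r} w = p :=
  _root_.moveSubtrees_moveSubtrees fun s hs => by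
    rw [Finset.mem_singleton.1 hs]
    exact (_root_.mem_children.1 h.mem_children).1

end Attachable

namespace IsAttachNode

lemma total (h : Attachable p w r) (hc : IsAttachNode p w r c) (hc' : IsAttachNode p w r c') :
    IsDesc p c c' ∨ IsDesc p c' c := by
  by_contra! hcon
  exact lt_asymm (hc.lt c' (hc'.isDesc.trans h.isDesc_top) hcon.2 hc'.not_isDesc)
    (hc'.lt c (hc.isDesc.trans h.isDesc_top) hcon.1 hc.not_isDesc)

variable (h : Attachable p w r) (hc : IsAttachNode p w r c)
include h hc

lemma ne_bot : c ≠ ⊥ := by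
  rintro rfl
  exact hc.not_isDesc h.isDesc_bot

lemma ne_top : c ≠ ⊤ := by
  rintro rfl
  exact hc.ne (hc.isDesc.antisymm h.isRootedTree h.isDesc_top)

lemma isRootedTree_move : IsRootedTree (moveSubtrees p {r} c) :=
  h.isRootedTree.moveSubtrees (isBelow_singleton.not.2 hc.not_isDesc)

lemma isDesc_move_iff : IsDesc (moveSubtrees p {r} c) z x ↔
    (IsDesc p z x ∧ (IsDesc p z r → IsDesc p r x → r = x)) ∨ (IsDesc p z r ∧ IsDesc p c x) :=
  isDesc_moveSubtrees_singleton h.isRootedTree hc.not_isDesc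

lemma isDesc_move_iff_of_above (hx : IsDesc p w x) :
    IsDesc (moveSubtrees p {r} c) z x ↔ IsDesc p z x := by
  rw [hc.isDesc_move_iff h]
  have hcx := hc.isDesc.trans hx
  have hrx : IsDesc p z r → IsDesc p z x := fun hz => hz.trans (h.isDesc.trans hx)
  tauto

lemma isDesc_move_iff_of_inside (hx : IsDesc p x r) :
    IsDesc (moveSubtrees p {r} c) z x ↔ IsDesc p z x := by
  rw [hc.isDesc_move_iff h]
  have hcx : ¬ IsDesc p c x := fun hcx => hc.not_isDesc (hcx.trans hx)
  have hrx : IsDesc p r x → r = x := fun hr => hr.antisymm h.isRootedTree hx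
  tauto

lemma isDesc_move_iff_of_outside (hz : ¬ IsDesc p z r) :
    IsDesc (moveSubtrees p {r} c) z x ↔ IsDesc p z x := by
  rw [hc.isDesc_move_iff h]
  tauto

lemma isDesc_move_iff_of_inside_outside (hz : IsDesc p z r) (hx : ¬ IsDesc p x r) :
    IsDesc (moveSubtrees p {r} c) z x ↔ IsDesc p c x := by
  rw [hc.isDesc_move_iff h]
  have hrx : r ≠ x := fun he => hx (he ▸ IsDesc.refl p r)
  have hzx : IsDesc p z x → IsDesc p r x := fun hzx => (hzx.total hz).resolve_left hx
  tauto

/-- The only new minimum that can reach an edge is that of `T_r`, on the path from `c` to `w`,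
and there the fathers are already larger than `c`. -/
lemma exists_le_of_exists_le_move (hne : p z ≠ z)
    (hle : ∃ x, IsDesc (moveSubtrees p {r} c) x z ∧ x ≤ p z) : ∃ x, IsDesc p x z ∧ x ≤ p z := by
  obtain ⟨x, hx, hle⟩ := hle
  by_cases hxz : IsDesc p x z
  · exact ⟨x, hxz, hle⟩
  obtain ⟨hxr, hcz⟩ : IsDesc p x r ∧ IsDesc p c z := by
    rw [hc.isDesc_move_iff h] at hx
    tauto
  rcases hcz.total hc.isDesc with hzw | hwz
  · have hzw' : z ≠ w := fun he => hxz (hxr.trans (he ▸ h.isDesc))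
    exact ⟨c, hcz, (hc.lt (p z) ((hzw.father hzw').trans h.isDesc_top)
      (fun hd => h.isRootedTree.not_isDesc_father hne (hd.trans hcz))
      (fun hd => hc.not_isDesc (hcz.trans ((isDesc_father p z).trans hd)))).le⟩
  · exact absurd (hxr.trans (h.isDesc.trans hwz)) hxz

lemma isDesc_move_of_isDesc (hzr : z ≠ r) (hx : IsDesc p x z) :
    IsDesc (moveSubtrees p {r} c) x z := by
  refine (hc.isDesc_move_iff h).2 ?_
  by_cases hrz : IsDesc p r z
  · have hwz : IsDesc p w z := (_root_.mem_children.1 h.mem_children).1 ▸ hrz.father hzr.symm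
    have := hc.isDesc.trans hwz
    tauto
  · tauto

lemma isImproperEdge_move_iff :
    IsImproperEdge (moveSubtrees p {r} c) z ↔ IsImproperEdge p z := by
  by_cases hzr : z = r
  · subst hzr
    refine iff_of_true (isImproperEdge_of_isDesc_bot
      ((hc.isDesc_move_iff_of_inside h (IsDesc.refl p z)).2 h.isDesc_bot) ?_)
      (isImproperEdge_of_isDesc_bot h.isDesc_bot (father_ne_of_mem_children h.mem_children))
    rw [moveSubtrees_of_mem (Finset.mem_singleton_self z)]
    rintro rfl
    exact hc.not_isDesc (IsDesc.refl p c)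
  · rw [isImproperEdge_iff_exists_le, isImproperEdge_iff_exists_le,
      moveSubtrees_of_notMem (by simpa using hzr)]
    exact and_congr_right fun hne => ⟨hc.exists_le_of_exists_le_move h hne,
      fun ⟨x, hx, hle⟩ => ⟨x, hc.isDesc_move_of_isDesc h hzr hx, hle⟩⟩

lemma isTopImproper_move : IsTopImproper (moveSubtrees p {r} c) := by
  refine ⟨hc.isRootedTree_move h, fun y hy hne => ?_⟩
  rw [hc.isDesc_move_iff_of_outside h h.not_isDesc_top] at hy
  rw [hc.isImproperEdge_move_iff h]
  refine h.isImproperEdge y hy ?_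
  rwa [moveSubtrees_of_notMem] at hne
  rw [Finset.mem_singleton]
  rintro rfl
  exact h.not_isDesc_top hy

lemma improperCount_move : improperCount (moveSubtrees p {r} c) = improperCount p := by
  rw [improperCount, improperCount]
  congr 1
  ext z
  simp only [Finset.mem_filter, hc.isImproperEdge_move_iff h]

lemma attachable_move : Attachable (moveSubtrees p {r} c) c r where
  toIsTopImproper := hc.isTopImproper_move h
  mem_children := (mem_children_moveSubtrees_of_mem (Finset.mem_singleton_self r)).2
    ⟨rfl, fun he => hc.not_isDesc (he ▸ IsDesc.refl p r)⟩
  isDesc_bot := (hc.isDesc_move_iff_of_inside h (IsDesc.refl p r)).2 h.isDesc_bot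
  isDesc_top := (hc.isDesc_move_iff_of_above h h.isDesc_top).2 (hc.isDesc.trans h.isDesc_top)

lemma isCritical_move_of_isDesc (hc' : IsAttachNode p w r c') (hd : IsDesc p c c') :
    IsCritical (moveSubtrees p {r} c) w c' where
  isDesc_bot := (hc.isDesc_move_iff_of_inside_outside h h.isDesc_bot hc'.not_isDesc).2 hd
  isDesc := (hc.isDesc_move_iff_of_above h (IsDesc.refl p w)).2 hc'.isDesc
  ne := hc'.ne
  ne_bot := hc'.ne_bot h
  lt z hz hn := by
    rw [hc.isDesc_move_iff_of_above h h.isDesc_top] at hz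
    rw [hc.isDesc_move_iff h] at hn
    have hcr : IsDesc p r c' → IsDesc p c r → False := fun _ => hc.not_isDesc
    refine hc'.lt z hz ?_ ?_ <;> tauto

lemma isCritical_move : IsCritical (moveSubtrees p {r} c) w c :=
  hc.isCritical_move_of_isDesc h hc (IsDesc.refl p c)

omit hc in
lemma _root_.IsCritical.isDesc_child (hu : IsCritical p w u) : IsDesc p u r :=
  (h.isDesc_bot.isDesc_child_or_isDesc_father h.mem_children hu.isDesc_bot).resolve_right
    fun hwu => hu.ne (hu.isDesc.antisymm h.isRootedTree hwu)

lemma isCritical_move_iff_of_inside (hur : IsDesc p u r) :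
    IsCritical (moveSubtrees p {r} c) w u ↔ IsCritical p w u := by
  constructor <;> rintro ⟨hbot, hd, hne, hne_bot, hlt⟩
  · simp only [hc.isDesc_move_iff_of_inside h hur,
      hc.isDesc_move_iff_of_above h h.isDesc_top] at hbot hlt
    exact ⟨hbot, hur.trans h.isDesc, hne, hne_bot, hlt⟩
  · refine ⟨?_, (hc.isDesc_move_iff_of_above h (IsDesc.refl p w)).2 hd, hne, hne_bot, ?_⟩
    · exact (hc.isDesc_move_iff_of_inside h hur).2 hbot
    · simpa only [hc.isDesc_move_iff_of_inside h hur,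
        hc.isDesc_move_iff_of_above h h.isDesc_top] using hlt

lemma isCritical_top_move_iff : IsCritical (moveSubtrees p {r} c) ⊤ w ↔ IsCritical p ⊤ w := by
  have hw {z : V} := hc.isDesc_move_iff_of_above h (z := z) (IsDesc.refl p w)
  have htop {z : V} := hc.isDesc_move_iff_of_above h (z := z) h.isDesc_top
  constructor <;> rintro ⟨hbot, hd, hne, hne_bot, hlt⟩
  · exact ⟨hw.1 hbot, htop.1 hd, hne, hne_bot, fun z hz hn => hlt z (htop.2 hz) (hw.not.2 hn)⟩
  · exact ⟨hw.2 hbot, htop.2 hd, hne, hne_bot, fun z hz hn => hlt z (htop.1 hz) (hw.not.1 hn)⟩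

lemma children_move (hx : x ≠ w) (hxc : x ≠ c) :
    children (moveSubtrees p {r} c) x = children p x := by
  ext y
  by_cases hy : y = r
  · subst hy
    rw [mem_children_moveSubtrees_of_mem (Finset.mem_singleton_self y), _root_.mem_children,
      (_root_.mem_children.1 h.mem_children).1]
    tauto
  · exact mem_children_moveSubtrees_of_notMem (by simpa using hy)

lemma deg_bot_move : deg (moveSubtrees p {r} c) ⊥ = deg p ⊥ := by
  rw [deg, deg, hc.children_move h h.ne_bot.symm (hc.ne_bot h).symm]

lemma deg_father_move : deg (moveSubtrees p {r} c) w + 1 = deg p w := by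
  classical
  rw [deg, deg, ← Finset.card_erase_add_one h.mem_children]
  congr 2
  ext y
  rw [Finset.mem_erase]
  by_cases hy : y = r
  · subst hy
    rw [mem_children_moveSubtrees_of_mem (Finset.mem_singleton_self y)]
    have := hc.ne
    tauto
  · rw [mem_children_moveSubtrees_of_notMem (by simpa using hy), and_iff_right hy]

end IsAttachNode

/-- `q` arises from `p` by moving the child of `w` above `⊥`, with its subtree, to the highest
possible node. The inverse move is determined by the first critical node below `w`. -/
def IsMerge (w : V) (p q : V → V) : Prop :=
  ∃ r c, Attachable p w r ∧ IsAttachNode p w r c ∧ (∀ c', IsAttachNode p w r c' → IsDesc p c' c) ∧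
    q = moveSubtrees p {r} c

section Highest

variable (h : Attachable p w r) (hc : IsAttachNode p w r c)
  (hmax : ∀ c', IsAttachNode p w r c' → IsDesc p c' c)
include h hc hmax

lemma isCritical_moveSubtrees_iff :
    IsCritical (moveSubtrees p {r} c) w u ↔ u = c ∨ IsCritical p w u := by
  constructor
  · intro hu
    by_cases huc : u = c
    · exact Or.inl huc
    refine Or.inr ?_
    rcases hu.isDesc_bot.total (hc.isCritical_move h).isDesc_bot with hd | hd
    · have hm := hc.attachable_move h
      have hur := (hm.isDesc_bot.isDesc_child_or_isDesc_father hm.mem_children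
        hu.isDesc_bot).resolve_right fun hcu => huc (hd.antisymm (hc.isRootedTree_move h) hcu)
      rw [hc.isDesc_move_iff_of_inside h (IsDesc.refl p r)] at hur
      exact (hc.isCritical_move_iff_of_inside h hur).1 hu
    · rw [hc.isDesc_move_iff_of_outside h hc.not_isDesc] at hd
      have hur : ¬ IsDesc p u r := fun hur => hc.not_isDesc (hd.trans hur)
      have huw : IsDesc p u w := (hc.isDesc_move_iff_of_above h (IsDesc.refl p w)).1 hu.isDesc
      have hu' : IsAttachNode p w r u := ⟨huw, hu.ne, hur, fun z hz hn hzr =>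
        hu.lt z ((hc.isDesc_move_iff_of_above h h.isDesc_top).2 hz)
          ((hc.isDesc_move_iff_of_outside h hzr).not.2 hn)⟩
      exact absurd ((hmax u hu').antisymm h.isRootedTree hd) huc
  · rintro (rfl | hu)
    · exact hc.isCritical_move h
    · exact (hc.isCritical_move_iff_of_inside h (hu.isDesc_child h)).2 hu

lemma isDesc_of_isCritical_moveSubtrees (hu : IsCritical (moveSubtrees p {r} c) w u) :
    IsDesc (moveSubtrees p {r} c) u c := by
  rcases (isCritical_moveSubtrees_iff h hc hmax).1 hu with rfl | hu
  · exact IsDesc.refl _ _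
  · exact ((hc.isDesc_move_iff_of_inside h (IsDesc.refl p r)).2 (hu.isDesc_child h)).trans
      (hc.attachable_move h).isDesc

end Highest

lemma exists_highest_isAttachNode (h : Attachable p w r) (he : ∃ c, IsAttachNode p w r c) :
    ∃ c, IsAttachNode p w r c ∧ ∀ c', IsAttachNode p w r c' → IsDesc p c' c :=
  exists_isDesc_top_of_chain (fun _ _ hu hu' => IsAttachNode.total h hu hu') he

lemma exists_isMerge (h : Attachable p w r) (he : ∃ c, IsAttachNode p w r c) :
    ∃ q, IsMerge w p q := by
  obtain ⟨c, hc, hmax⟩ := exists_highest_isAttachNode h he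
  exact ⟨_, r, c, h, hc, hmax, rfl⟩

lemma exists_isAttachNode (h : Attachable p w r)
    (hw : ∀ z, IsDesc p z ⊤ → ¬ IsDesc p z w → w < z)
    (hx : IsDesc p x w) (hxr : ¬ IsDesc p x r) (hlt : x < w) : ∃ c, IsAttachNode p w r c := by
  classical
  obtain ⟨c, hc, hmin⟩ := Finset.exists_min_image
    (Finset.univ.filter fun z => IsDesc p z ⊤ ∧ ¬ IsDesc p z r) id
    ⟨x, by simpa using ⟨hx.trans h.isDesc_top, hxr⟩⟩
  simp only [Finset.mem_filter, Finset.mem_univ, true_and, id_eq] at hc hmin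
  have hcw : c < w := (hmin x ⟨hx.trans h.isDesc_top, hxr⟩).trans_lt hlt
  refine ⟨c, ?_, hcw.ne, hc.2, fun z hz hzc hzr => lt_of_le_of_ne (hmin z ⟨hz, hzr⟩) ?_⟩
  · by_contra hn
    exact lt_asymm hcw (hw c hc.1 hn)
  · rintro rfl
    exact hzc (IsDesc.refl p _)

section Detach

variable (hq : IsTopImproper q) (hw : IsDesc q w ⊤) (hc : IsCritical q w c)
  (hr : r ∈ children q c)

include hq hc hr

lemma IsCritical.not_isDesc_of_mem_children : ¬ IsDesc q w r :=
  fun h => hq.isRootedTree.not_isDesc_of_mem_children hr (hc.isDesc.trans h)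

lemma IsCritical.isDesc_detach_iff : IsDesc (moveSubtrees q {r} w) z x ↔
    (IsDesc q z x ∧ (IsDesc q z r → IsDesc q r x → r = x)) ∨ (IsDesc q z r ∧ IsDesc q w x) :=
  isDesc_moveSubtrees_singleton hq.isRootedTree (hc.not_isDesc_of_mem_children hq hr)

lemma IsCritical.isDesc_detach_iff_of_outside (hz : ¬ IsDesc q z r) :
    IsDesc (moveSubtrees q {r} w) z x ↔ IsDesc q z x := by
  rw [hc.isDesc_detach_iff hq hr]
  tauto

include hw

lemma IsCritical.isTopImproper_detach : IsTopImproper (moveSubtrees q {r} w) := by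
  have hwr := hc.not_isDesc_of_mem_children hq hr
  have htr : ¬ IsDesc q ⊤ r := fun h => hwr (hw.trans h)
  refine ⟨hq.isRootedTree.moveSubtrees (isBelow_singleton.not.2 hwr), fun y hy hne => ?_⟩
  rw [hc.isDesc_detach_iff_of_outside hq hr htr] at hy
  have hyr : y ∉ ({r} : Finset V) := fun h => htr (Finset.mem_singleton.1 h ▸ hy)
  rw [moveSubtrees_of_notMem hyr] at hne
  rw [isImproperEdge_iff_exists_le, moveSubtrees_of_notMem hyr]
  obtain ⟨-, x, hx, hle⟩ := isImproperEdge_iff_exists_le.1 (hq.isImproperEdge y hy hne)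
  refine ⟨hne, x, (hc.isDesc_detach_iff hq hr).2 ?_, hle⟩
  have := hw.trans hy
  tauto

lemma IsCritical.attachable_detach (hbr : IsDesc q ⊥ r) :
    Attachable (moveSubtrees q {r} w) w r where
  toIsTopImproper := hc.isTopImproper_detach hq hw hr
  mem_children := (mem_children_moveSubtrees_of_mem (Finset.mem_singleton_self r)).2
    ⟨rfl, fun he => hc.not_isDesc_of_mem_children hq hr (he ▸ IsDesc.refl q r)⟩
  isDesc_bot := (hc.isDesc_detach_iff hq hr).2 (Or.inl ⟨hbr, fun _ _ => rfl⟩)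
  isDesc_top := (hc.isDesc_detach_iff_of_outside hq hr
    (hc.not_isDesc_of_mem_children hq hr)).2 hw

omit hw in
lemma IsCritical.isAttachNode_detach : IsAttachNode (moveSubtrees q {r} w) w r c := by
  have hcr : ¬ IsDesc q c r := hq.isRootedTree.not_isDesc_of_mem_children hr
  have houtside {z x : V} (hz : ¬ IsDesc q z r) :=
    hc.isDesc_detach_iff_of_outside (x := x) hq hr hz
  refine ⟨(houtside hcr).2 hc.isDesc, hc.ne, (houtside hcr).not.2 hcr, fun z hz hzc hzr => ?_⟩
  have hzr' : ¬ IsDesc q z r :=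
    fun h => hzr ((hc.isDesc_detach_iff hq hr).2 (Or.inl ⟨h, fun _ _ => rfl⟩))
  rw [houtside hzr'] at hz hzc
  exact hc.lt z hz hzc

end Detach

lemma exists_isMerge_of_isCritical (hq : IsTopImproper q) (hw : IsDesc q w ⊤)
    (he : ∃ c, IsCritical q w c) : ∃ p, IsMerge w p q := by
  obtain ⟨c, hc, hmax⟩ :=
    exists_isDesc_top_of_chain (fun _ _ hu hu' => hu.isDesc_bot.total hu'.isDesc_bot) he
  obtain ⟨r, hr, hbr⟩ := hc.isDesc_bot.exists_mem_children hc.ne_bot.symm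
  have hp := hc.attachable_detach hq hw hr hbr
  have hpc := hc.isAttachNode_detach hq hr
  have hback : moveSubtrees (moveSubtrees q {r} w) {r} c = q :=
    moveSubtrees_moveSubtrees fun s hs => (mem_children.1 (Finset.mem_singleton.1 hs ▸ hr)).1
  refine ⟨_, r, c, hp, hpc, fun c' hc' => ?_, hback.symm⟩
  rcases IsAttachNode.total hp hpc hc' with hd | hd
  · have hc'c := hmax c' (hback ▸ hpc.isCritical_move_of_isDesc hp hc' hd)
    rw [← hback] at hc'c
    exact (hpc.isDesc_move_iff_of_outside hp hc'.not_isDesc).1 hc'c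
  · exact hd

lemma IsMerge.right_unique (h : IsMerge w p q) (h' : IsMerge w p q') : q = q' := by
  obtain ⟨r, c, hr, hc, hmax, rfl⟩ := h
  obtain ⟨r', c', hr', hc', hmax', rfl⟩ := h'
  obtain rfl := hr.eq hr'
  rw [(hmax' c hc).antisymm hr.isRootedTree (hmax c' hc')]

lemma IsMerge.left_unique (h : IsMerge w p q) (h' : IsMerge w p' q) : p = p' := by
  obtain ⟨r, c, hr, hc, hmax, rfl⟩ := h
  obtain ⟨r', c', hr', hc', hmax', hq⟩ := h'
  have hcc : c = c' := by
    have hd := isDesc_of_isCritical_moveSubtrees hr' hc' hmax' (u := c) (hq ▸ hc.isCritical_move hr)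
    rw [← hq] at hd
    exact hd.antisymm (hc.isRootedTree_move hr) (isDesc_of_isCritical_moveSubtrees hr hc hmax
      (hq ▸ hc'.isCritical_move hr'))
  subst hcc
  obtain rfl : r = r' := (hc.attachable_move hr).eq (hq ▸ hc'.attachable_move hr')
  rw [← hr.moveSubtrees_moveSubtrees (c := c), hq, hr'.moveSubtrees_moveSubtrees]

end Attach

section LowerCritical

variable {V : Type*} {p : V → V} {x y : V}

lemma exists_isFirstOnPath [Finite V] {P : V → Prop} (h : ∃ u, OnPath p x y u ∧ P u) :
    ∃ u, IsFirstOnPath p x y P u := by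
  obtain ⟨u, hu, hmax⟩ := exists_isDesc_top_of_chain (fun _ _ hu hu' => hu.1.2.total hu'.1.2) h
  exact ⟨u, hu.1, hu.2, fun u' hpath hP => hmax u' ⟨hpath, hP⟩⟩

variable [Fintype V] [LinearOrder V]

lemma belowRest_iff {u : V} : BelowRest p x u ↔ ∀ z, IsDesc p z x → ¬ IsDesc p z u → u < z := by
  simp only [BelowRest, mem_subtree]

lemma belowRest_beta : BelowRest p x (beta p x) :=
  belowRest_iff.2 fun _ hz hz' => lt_of_le_of_ne (beta_le hz) fun he => hz' (he ▸ IsDesc.refl p _)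

variable [BoundedOrder V]

lemma isFirstOnPath_lowerCritical (h : (children p ⊤).Nonempty) :
    IsFirstOnPath p ⊤ (beta p ⊤) (fun u => u ≠ ⊤ ∧ BelowRest p ⊤ u) (lowerCritical p) := by
  refine Classical.epsilon_spec (exists_isFirstOnPath ?_)
  obtain ⟨b, hb⟩ := h
  exact ⟨beta p ⊤, ⟨isDesc_beta p ⊤, IsDesc.refl p _⟩,
    ((beta_le (isDesc_of_mem_children hb)).trans_lt
      (lt_top_iff_ne_top.2 (mem_children.1 hb).2)).ne, belowRest_beta⟩

lemma bot_lt_lowerCritical_iff (hp : IsRootedTree p) (h : (children p ⊤).Nonempty)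
    (hb : IsDesc p ⊥ ⊤) : ⊥ < lowerCritical p ↔ ∃ c, IsCritical p ⊤ c := by
  have hβ : beta p ⊤ = ⊥ := le_bot_iff.1 (beta_le hb)
  obtain ⟨hpath, ⟨hne, hrest⟩, hfirst⟩ := isFirstOnPath_lowerCritical h
  rw [hβ] at hpath hfirst
  constructor
  · exact fun hlt => ⟨_, hpath.2, hpath.1, hne, hlt.ne', belowRest_iff.1 hrest⟩
  · rintro ⟨c, hc⟩
    have hcl := hfirst c ⟨hc.isDesc, hc.isDesc_bot⟩ ⟨hc.ne, belowRest_iff.2 hc.lt⟩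
    exact bot_lt_iff_ne_bot.2 fun he => hc.ne_bot (IsDesc.antisymm hp (he ▸ hcl) hc.isDesc_bot)

lemma bot_lt_lowerCritical_of_not_isDesc (h : (children p ⊤).Nonempty) (hb : ¬ IsDesc p ⊥ ⊤) :
    ⊥ < lowerCritical p :=
  bot_lt_iff_ne_bot.2 fun he => hb (he ▸ (isFirstOnPath_lowerCritical h).1.1)

end LowerCritical

lemma children_nonempty_of_deg_eq {V : Type*} [Fintype V] [LinearOrder V] {p : V → V}
    {x : V} {m : ℕ} (hm : 1 ≤ m) (h : deg p x = m) : (children p x).Nonempty := by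
  rw [← Finset.card_pos, ← deg, h]
  exact hm

section JoinNode

variable {V : Type*} [Fintype V] [LinearOrder V] [BoundedOrder V] {p q : V → V} {r c x z b : V}

lemma argminBeta_spec {C : Finset V} (h : C.Nonempty) :
    argminBeta p C ∈ C ∧ ∀ b ∈ C, beta p (argminBeta p C) ≤ beta p b :=
  Classical.epsilon_spec (p := fun b => b ∈ C ∧ ∀ b' ∈ C, beta p b ≤ beta p b')
    (C.exists_min_image (beta p) h)

lemma mem_childrenAboveBot : b ∈ childrenAboveBot p ↔ b ∈ children p ⊤ ∧ IsDesc p ⊥ b := by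
  simp [childrenAboveBot]

lemma mem_childrenOffBot : b ∈ childrenOffBot p ↔ b ∈ children p ⊤ ∧ ¬ IsDesc p ⊥ b := by
  simp [childrenOffBot]

/-- An attach node `c` for `⊤` cannot miss the path to the smallest minimum `β(b)`: otherwise
`c < β(b)`, although `c` lies in some `T_{b'}` with `β(b) ≤ β(b')`. -/
lemma IsAttachNode.onPath_beta (hq : Attachable q ⊤ r) (hc : IsAttachNode q ⊤ r c)
    (hb : b ∈ children q ⊤) (hbr : b ≠ r)
    (hmin : ∀ b' ∈ children q ⊤, b' ≠ r → beta q b ≤ beta q b') : OnPath q b (beta q b) c := by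
  have hβb := isDesc_beta q b
  obtain ⟨b', hb', hcb'⟩ := hc.isDesc.exists_mem_children hc.ne
  have hb'r : b' ≠ r := fun he => hc.not_isDesc (he ▸ hcb')
  have hβc : IsDesc q (beta q b) c := by
    by_contra hn
    exact (hc.lt _ (hβb.trans (isDesc_of_mem_children hb)) hn fun hr => hbr
      (hq.isRootedTree.eq_of_mem_children hb hq.mem_children hβb hr)).not_ge
      ((hmin b' hb' hb'r).trans (beta_le hcb'))
  obtain rfl := hq.isRootedTree.eq_of_mem_children hb hb' hβb (hβc.trans hcb')
  exact ⟨hcb', hβc⟩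

lemma isAttachNode_top_iff (hq : Attachable q ⊤ r) (hb : b ∈ children q ⊤) (hbr : b ≠ r)
    (hmin : ∀ b' ∈ children q ⊤, b' ≠ r → beta q b ≤ beta q b') :
    IsAttachNode q ⊤ r c ↔ OnPath q b (beta q b) c ∧ BelowRest q b c ∧
      ∀ b' ∈ children q ⊤, b' ≠ r → b' ≠ b → c < beta q b' := by
  have heq {z b' : V} (hb' : b' ∈ children q ⊤) (hz : IsDesc q z b') {b'' : V}
      (hb'' : b'' ∈ children q ⊤) (hz' : IsDesc q z b'') : b' = b'' :=
    hq.isRootedTree.eq_of_mem_children hb' hb'' hz hz'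
  rw [belowRest_iff]
  constructor
  · intro hc
    have hpath := hc.onPath_beta hq hb hbr hmin
    refine ⟨hpath, fun z hz hzc => hc.lt z (hz.trans (isDesc_of_mem_children hb)) hzc
      fun hzr => hbr (heq hb hz hq.mem_children hzr), fun b' hb' hb'r hb'b => ?_⟩
    have hβ := isDesc_beta q b'
    exact hc.lt _ (hβ.trans (isDesc_of_mem_children hb'))
      (fun hd => hb'b (heq hb' hβ hb (hd.trans hpath.1)))
      fun hd => hb'r (heq hb' hβ hq.mem_children hd)
  · rintro ⟨⟨hcb, -⟩, hrest, hother⟩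
    have hct : c ≠ ⊤ := by
      rintro rfl
      exact hq.isRootedTree.not_isDesc_of_mem_children hb hcb
    refine ⟨hcb.trans (isDesc_of_mem_children hb), hct,
      fun hcr => hbr (heq hb hcb hq.mem_children hcr), fun z hz hzc hzr => ?_⟩
    by_cases hzt : z = ⊤
    · exact hzt ▸ lt_top_iff_ne_top.2 hct
    obtain ⟨b', hb', hzb'⟩ := hz.exists_mem_children hzt
    by_cases hbb : b' = b
    · exact hrest z (hbb ▸ hzb') hzc
    · exact (hother b' hb' (fun he => hzr (he ▸ hzb')) hbb).trans_le (beta_le hzb')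

/-- The condition on the node `c` of the map (c), for `b = b₂`: `joinNode` is the first such node
on the path from `b₂` to `β(b₂)`. -/
def IsJoinNode (p : V → V) (b c : V) : Prop :=
  BelowRest p b c ∧ c < betaStar p ∧ ∀ b' ∈ childrenOffBot p, b' ≠ b → c < beta p b'

namespace Swingable

variable (hp : Swingable p)
include hp

lemma not_isBelow_of_mem_childrenOffBot (hb : b ∈ childrenOffBot p) (hz : IsDesc p z b) :
    ¬ IsBelow p (children p ⊥) z := by
  rintro ⟨s, hs, hzs⟩
  rw [mem_childrenOffBot] at hb
  rcases hz.isDesc_child_or_isDesc_father hb.1 hzs with hd | hd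
  · refine hb.2 ((mem_children.1 hs).1 ▸ hd.father ?_)
    rintro rfl
    exact Finset.disjoint_left.1 hp.disjoint_children hb.1 hs
  · exact hp.not_isBelow_top ⟨s, hs, hd⟩

lemma isDesc_mapA_iff_of_mem_childrenOffBot (hb : b ∈ childrenOffBot p) (hx : IsDesc p x b) :
    IsDesc (mapA p) z x ↔ IsDesc p z x := by
  refine ⟨fun hzx => ?_, fun hzx => (hp.isDesc_mapA_of_not_isBelow
    (hp.not_isBelow_of_mem_childrenOffBot hb (hzx.trans hx))).2 hzx⟩
  rcases (isDesc_moveSubtrees hp.isRootedTree hp.not_isBelow_top).1 hzx with hd | hd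
  · exact hd.1
  · exact absurd (hd.2.trans hx)
      (hp.isRootedTree.not_isDesc_of_mem_children (mem_childrenOffBot.1 hb).1)

lemma attachable_mapA (hr : r ∈ children p ⊤) (hbr : IsDesc p ⊥ r) : Attachable (mapA p) ⊤ r :=
  ⟨hp.isTopImproper_mapA, hp.mem_children_top_mapA.2 (Or.inl hr), hp.isDesc_bot_mapA.2 hbr,
    IsDesc.refl _ _⟩

lemma mem_children_top_mapA_and_ne_iff (hr : r ∈ children p ⊤) (hbr : IsDesc p ⊥ r) :
    x ∈ children (mapA p) ⊤ ∧ x ≠ r ↔ x ∈ childrenOffBot p ∨ x ∈ children p ⊥ := by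
  rw [hp.mem_children_top_mapA, mem_childrenOffBot]
  have hdisj := Finset.disjoint_left.1 hp.disjoint_children
  constructor
  · rintro ⟨hx | hx, hxr⟩
    · exact Or.inl ⟨hx, fun hbx => hxr (hp.isRootedTree.eq_of_mem_children hx hr hbx hbr)⟩
    · exact Or.inr hx
  · rintro (⟨hx, hbx⟩ | hx)
    · exact ⟨Or.inl hx, fun he => hbx (he ▸ hbr)⟩
    · exact ⟨Or.inr hx, fun he => hdisj hr (he ▸ hx)⟩

lemma onPath_and_isJoinNode_iff (hr : r ∈ children p ⊤) (hbr : IsDesc p ⊥ r)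
    (hb : b ∈ childrenOffBot p) (hmin : ∀ b' ∈ childrenOffBot p, beta p b ≤ beta p b') :
    OnPath p b (beta p b) c ∧ IsJoinNode p b c ↔ IsAttachNode (mapA p) ⊤ r c := by
  have hmem {x : V} := hp.mem_children_top_mapA_and_ne_iff (x := x) hr hbr
  have hbt := (mem_childrenOffBot.1 hb).1
  have hmin' : ∀ b' ∈ children (mapA p) ⊤, b' ≠ r → beta (mapA p) b ≤ beta (mapA p) b' := by
    intro b' hb' hne
    rw [hp.beta_mapA, hp.beta_mapA]
    rcases hmem.1 ⟨hb', hne⟩ with h | h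
    · exact hmin b' h
    · exact (hp.beta_lt_beta hbt h).le
  rw [isAttachNode_top_iff (hp.attachable_mapA hr hbr) (hmem.2 (Or.inl hb)).1
    (hmem.2 (Or.inl hb)).2 hmin', IsJoinNode, OnPath, OnPath, hp.beta_mapA,
    hp.isDesc_mapA_iff_of_mem_childrenOffBot hb (IsDesc.refl p b), and_assoc, and_assoc]
  refine and_congr_right fun hcb => ?_
  rw [belowRest_iff, belowRest_iff]
  simp only [hp.isDesc_mapA_iff_of_mem_childrenOffBot hb hcb,
    hp.isDesc_mapA_iff_of_mem_childrenOffBot hb (IsDesc.refl p b), hp.beta_mapA]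
  refine and_congr_right fun _ => and_congr_right fun _ => ?_
  constructor
  · rintro ⟨hstar, hoff⟩ b' hb' hne hbb
    rcases hmem.1 ⟨hb', hne⟩ with h | h
    · exact hoff b' h hbb
    · exact hstar.trans_le (betaStar_le_beta h)
  · intro h
    refine ⟨?_, fun b' hb' => h b' (hmem.2 (Or.inl hb')).1 (hmem.2 (Or.inl hb')).2⟩
    obtain ⟨s, hs, hβ⟩ := exists_beta_eq_betaStar hp.children_bot_nonempty
    exact hβ ▸ h s (hmem.2 (Or.inr hs)).1 (hmem.2 (Or.inr hs)).2 fun he =>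
      Finset.disjoint_left.1 hp.disjoint_children hbt (he ▸ hs)

lemma exists_childrenAboveBot_eq_singleton (hbt : IsDesc p ⊥ ⊤) :
    ∃ r ∈ children p ⊤, IsDesc p ⊥ r ∧ childrenAboveBot p = {r} := by
  obtain ⟨r, hr, hbr⟩ := hbt.exists_mem_children hp.bot_ne_top
  refine ⟨r, hr, hbr, ?_⟩
  ext b
  rw [mem_childrenAboveBot, Finset.mem_singleton]
  constructor
  · exact fun h => hp.isRootedTree.eq_of_mem_children h.1 hr h.2 hbr
  · rintro rfl
    exact ⟨hr, hbr⟩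

lemma secondChild_spec (hbt : IsDesc p ⊥ ⊤) (hd : 2 ≤ deg p ⊤) :
    secondChild p ∈ childrenOffBot p ∧
      ∀ b ∈ childrenOffBot p, beta p (secondChild p) ≤ beta p b := by
  obtain ⟨r, hr, hbr⟩ := hbt.exists_mem_children hp.bot_ne_top
  obtain ⟨b, hb, hne⟩ := Finset.exists_mem_ne hd r
  exact argminBeta_spec ⟨b, mem_childrenOffBot.2 ⟨hb, fun hbb =>
    hne (hp.isRootedTree.eq_of_mem_children hb hr hbb hbr)⟩⟩

lemma isFirstOnPath_joinNode (hbt : IsDesc p ⊥ ⊤) (hd : 2 ≤ deg p ⊤) :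
    IsFirstOnPath p (secondChild p) (beta p (secondChild p)) (IsJoinNode p (secondChild p))
      (joinNode p) := by
  obtain ⟨r, hr, hbr⟩ := hbt.exists_mem_children hp.bot_ne_top
  obtain ⟨hb, hmin⟩ := hp.secondChild_spec hbt hd
  have hbA := (hp.mem_children_top_mapA_and_ne_iff hr hbr).2 (Or.inl hb)
  have hA := hp.attachable_mapA hr hbr
  obtain ⟨c, hc⟩ := exists_isAttachNode hA (fun z hz hz' => absurd hz hz')
    (isDesc_of_mem_children hbA.1) (fun hd => hbA.2 (hA.isRootedTree.eq_of_mem_children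
      hbA.1 hA.mem_children (IsDesc.refl _ _) hd))
    (lt_top_iff_ne_top.2 (mem_children.1 hbA.1).2)
  exact Classical.epsilon_spec (exists_isFirstOnPath
    ⟨c, (hp.onPath_and_isJoinNode_iff hr hbr hb hmin).2 hc⟩)

lemma mapC_eq (hr : r ∈ children p ⊤) (habove : childrenAboveBot p = {r}) :
    mapC p = moveSubtrees (mapA p) {r} (joinNode p) := by
  funext z
  rw [mapC, habove, mapA]
  by_cases hz : z = r
  · subst hz
    rw [moveSubtrees_of_notMem (Finset.disjoint_left.1 hp.disjoint_children hr),
      moveSubtrees_of_mem (Finset.mem_singleton_self z),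
      moveSubtrees_of_mem (Finset.mem_singleton_self z)]
  · rw [moveSubtrees_of_notMem (S := {r}) (by simpa using hz)]
    by_cases hzS : z ∈ children p ⊥
    · rw [moveSubtrees_of_mem hzS, moveSubtrees_of_mem hzS]
    · rw [moveSubtrees_of_notMem hzS, moveSubtrees_of_notMem hzS,
        moveSubtrees_of_notMem (by simpa using hz)]

lemma isMerge_mapC (hbt : IsDesc p ⊥ ⊤) (hd : 2 ≤ deg p ⊤) : IsMerge ⊤ (mapA p) (mapC p) := by
  obtain ⟨r, hr, hbr, habove⟩ := hp.exists_childrenAboveBot_eq_singleton hbt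
  obtain ⟨hb, hmin⟩ := hp.secondChild_spec hbt hd
  have hiff {c : V} := hp.onPath_and_isJoinNode_iff (c := c) hr hbr hb hmin
  obtain ⟨hpath, hjoin, hfirst⟩ := hp.isFirstOnPath_joinNode hbt hd
  refine ⟨r, joinNode p, hp.attachable_mapA hr hbr, hiff.1 ⟨hpath, hjoin⟩, fun c hc => ?_,
    hp.mapC_eq hr habove⟩
  obtain ⟨hcpath, hcjoin⟩ := hiff.2 hc
  exact (hp.isDesc_mapA_iff_of_mem_childrenOffBot hb hpath.1).2 (hfirst c hcpath hcjoin)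

end Swingable

end JoinNode

section BijAC

variable {n k m : ℕ} [NeZero n] {p : Fin n → Fin n}

lemma mem_RTrees_zero_iff : p ∈ RTrees n k 0 ↔ IsTopImproper p ∧ improperCount p = k := by
  rw [RTrees, Set.mem_ofPred_eq, isTopImproper_iff]
  tauto

lemma swingable_of_mem_RTrees (hm : 1 ≤ m) (hp : p ∈ RTrees n k 0) (hdeg : deg p ⊥ = m)
    (hlt : alpha p < betaStar p) : Swingable p :=
  ⟨(mem_RTrees_zero_iff.1 hp).1, children_nonempty_of_deg_eq hm hdeg, hlt⟩

theorem bijOn_mapA (hm : 1 ≤ m) : Set.BijOn mapA (sourceA n k m) (targetA n k m) := by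
  have hswing (p) (hp : p ∈ sourceA n k m) : Swingable p :=
    swingable_of_mem_RTrees hm hp.1 hp.2.1 hp.2.2.2
  refine ⟨fun p hp => ?_, fun p hp p' hp' h => ?_, fun q hq => ?_⟩
  · have hs := hswing p hp
    refine ⟨mem_RTrees_zero_iff.2 ⟨hs.isTopImproper_mapA, ?_⟩, hs.deg_bot_mapA, ?_, ?_⟩
    · rw [hs.improperCount_mapA, (mem_RTrees_zero_iff.1 hp.1).2, hp.2.1]
    · have : 0 < deg p ⊤ := Finset.card_pos.2 hs.children_top_nonempty
      rw [hs.deg_top_mapA, hp.2.1]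
      omega
    · rw [hs.isDesc_bot_mapA]
      exact hp.2.2.1
  · exact (hswing p hp).eq_of_mapA_eq (hswing p' hp') (hp.2.1.trans hp'.2.1.symm) h
  · obtain ⟨hq, hbot, htop, hbt⟩ := hq
    rw [mem_RTrees_zero_iff] at hq
    obtain ⟨p, hp, hpm, rfl⟩ := exists_swingable_mapA_eq hq.1
      (fun he => hbt (he ▸ IsDesc.refl _ _)) hbot hm htop
    have hcount := hq.2
    rw [hp.improperCount_mapA, hpm] at hcount
    refine ⟨p, ⟨mem_RTrees_zero_iff.2 ⟨hp.toIsTopImproper, by omega⟩, hpm, ?_,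
      hp.alpha_lt_betaStar⟩, rfl⟩
    rwa [hp.isDesc_bot_mapA] at hbt

lemma swingable_of_mem_sourceC (hm : 1 ≤ m) (hp : p ∈ sourceC n k m) : Swingable p :=
  swingable_of_mem_RTrees hm hp.1 hp.2.1 hp.2.2.2.2

lemma mapsTo_mapC (hm : 1 ≤ m) : Set.MapsTo mapC (sourceC n k m) (targetC n k m) := by
  intro p hp
  have hs := swingable_of_mem_sourceC hm hp
  obtain ⟨hmem, hbot, hbt, hd, -⟩ := hp
  obtain ⟨r, c, hr, hc, -, heq⟩ := hs.isMerge_mapC hbt hd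
  rw [heq]
  have hcrit := hc.isCritical_move hr
  have hbt' := hcrit.isDesc_bot.trans hcrit.isDesc
  have htree := hc.isTopImproper_move hr
  refine ⟨mem_RTrees_zero_iff.2 ⟨htree, ?_⟩, ?_, ?_, hbt', ?_⟩
  · rw [hc.improperCount_move hr, hs.improperCount_mapA, (mem_RTrees_zero_iff.1 hmem).2, hbot]
  · rw [hc.deg_bot_move hr, hs.deg_bot_mapA]
  · have hdeg := hc.deg_father_move hr
    rw [hs.deg_top_mapA, hbot] at hdeg
    omega
  · rw [bot_lt_lowerCritical_iff htree.isRootedTree (htree.children_top_nonempty hs.bot_ne_top)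
      hbt']
    exact ⟨c, hcrit⟩

lemma surjOn_mapC (hm : 1 ≤ m) : Set.SurjOn mapC (sourceC n k m) (targetC n k m) := by
  rintro q ⟨hq, hbot, htop, hbt, hcrit⟩
  rw [mem_RTrees_zero_iff] at hq
  rw [bot_lt_lowerCritical_iff hq.1.isRootedTree
    (Finset.card_pos.1 (by rw [← deg]; omega)) hbt] at hcrit
  obtain ⟨t, ht⟩ := exists_isMerge_of_isCritical hq.1 (IsDesc.refl q ⊤) hcrit
  obtain ⟨r, c, hr, hc, -, rfl⟩ := id ht
  have hdeg := hc.deg_father_move hr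
  rw [hc.deg_bot_move hr] at hbot
  obtain ⟨p, hp, hpm, rfl⟩ :=
    exists_swingable_mapA_eq hr.toIsTopImproper hr.bot_ne_top hbot hm (by omega)
  rw [hp.deg_top_mapA, hpm] at hdeg
  have hbt' : IsDesc p ⊥ ⊤ := hp.isDesc_bot_mapA.1 (hr.isDesc_bot.trans hr.isDesc)
  have hd : 2 ≤ deg p ⊤ := by omega
  have hcount := hq.2
  rw [hc.improperCount_move hr, hp.improperCount_mapA, hpm] at hcount
  exact ⟨p, ⟨mem_RTrees_zero_iff.2 ⟨hp.toIsTopImproper, by omega⟩, hpm, hbt', hd,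
    hp.alpha_lt_betaStar⟩, (hp.isMerge_mapC hbt' hd).right_unique ht⟩

theorem bijOn_mapC (hm : 1 ≤ m) : Set.BijOn mapC (sourceC n k m) (targetC n k m) := by
  refine ⟨mapsTo_mapC hm, fun p hp p' hp' h => ?_, surjOn_mapC hm⟩
  have hs := swingable_of_mem_sourceC hm hp
  have hs' := swingable_of_mem_sourceC hm hp'
  have hmerge := hs.isMerge_mapC hp.2.2.1 hp.2.2.2.1
  exact hs.eq_of_mapA_eq hs' (hp.2.1.trans hp'.2.1.symm)
    (hmerge.left_unique (h ▸ hs'.isMerge_mapC hp'.2.2.1 hp'.2.2.2.1))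

end BijAC

section Critical

variable {V : Type*} [LinearOrder V] [BoundedOrder V] {q : V → V} {w w' u : V}

lemma IsCritical.of_isDesc (h : IsCritical q ⊤ w) (hd : IsDesc q w w') (hne : w ≠ w') :
    IsCritical q w' w := ⟨h.isDesc_bot, hd, hne, h.ne_bot, h.lt⟩

lemma IsCritical.top_of_isDesc_top (hq : IsRootedTree q) (h : IsCritical q w u)
    (hw : IsDesc q w ⊤) : IsCritical q ⊤ u :=
  ⟨h.isDesc_bot, h.isDesc.trans hw, fun he => h.ne (h.isDesc.antisymm hq (he ▸ hw)), h.ne_bot,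
    h.lt⟩

lemma exists_lowest_isCritical [Finite V] (hq : IsRootedTree q) (h : ∃ w, IsCritical q ⊤ w) :
    ∃ w, IsCritical q ⊤ w ∧ ∀ u, ¬ IsCritical q w u := by
  obtain ⟨w, hw, hmin⟩ := Set.exists_min_image {w | IsCritical q ⊤ w} id (Set.toFinite _) h
  refine ⟨w, hw, fun u hu => (hmin u (hu.top_of_isDesc_top hq hw.isDesc)).not_gt ?_⟩
  exact hu.lt w hw.isDesc fun h => hu.ne (hu.isDesc.antisymm hq h)

end Critical

section Cut

variable {V : Type*} [Fintype V] [LinearOrder V] [BoundedOrder V] {p q t t' : V → V}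
  {w r c z : V} {k d : ℕ}

/-- The edge from `z` to its father lies on the path from `w` to `⊥` and its upper end is a
critical node: these are the edges cut by the map (d). -/
def IsCriticalEdge (p : V → V) (w z : V) : Prop := IsDesc p ⊥ z ∧ IsCritical p w (p z)

open Classical in
/-- Cut the path from `w` to `⊥` below each critical node, and join the pieces to `w`. -/
noncomputable def cutCritical (w : V) (p : V → V) : V → V :=
  moveSubtrees p (Finset.univ.filter (IsCriticalEdge p w)) w

lemma cutCritical_of_isCriticalEdge (h : IsCriticalEdge p w z) : cutCritical w p z = w :=
  moveSubtrees_of_mem (by simpa using h)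

lemma cutCritical_of_not_isCriticalEdge (h : ¬ IsCriticalEdge p w z) : cutCritical w p z = p z :=
  moveSubtrees_of_notMem (by simpa using h)

lemma cutCritical_of_father_eq (h : p z = w) : cutCritical w p z = w := by
  by_cases hz : IsCriticalEdge p w z
  · exact cutCritical_of_isCriticalEdge hz
  · exact (cutCritical_of_not_isCriticalEdge hz).trans h

lemma cutCritical_eq_self (h : ∀ u, ¬ IsCritical p w u) : cutCritical w p = p :=
  funext fun _ => cutCritical_of_not_isCriticalEdge fun hz => h _ hz.2

lemma isCriticalEdge_moveSubtrees_iff (h : Attachable p w r) (hc : IsAttachNode p w r c)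
    (hmax : ∀ c', IsAttachNode p w r c' → IsDesc p c' c) (hzr : z ≠ r) :
    IsCriticalEdge (moveSubtrees p {r} c) w z ↔ IsCriticalEdge p w z := by
  have hz : moveSubtrees p {r} c z = p z := moveSubtrees_of_notMem (by simpa using hzr)
  have hbot (hu : IsCritical p w (p z)) : IsDesc (moveSubtrees p {r} c) ⊥ z ↔ IsDesc p ⊥ z :=
    hc.isDesc_move_iff_of_inside h ((isDesc_father p z).trans (hu.isDesc_child h))
  rw [IsCriticalEdge, IsCriticalEdge, hz, isCritical_moveSubtrees_iff h hc hmax]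
  refine ⟨?_, fun hu => ⟨(hbot hu.2).2 hu.1, Or.inr hu.2⟩⟩
  rintro ⟨hbz, hzc | hu⟩
  · have hr := hc.attachable_move h
    have hzmem : z ∈ children (moveSubtrees p {r} c) c := by
      refine mem_children.2 ⟨hz.trans hzc, ?_⟩
      rintro rfl
      exact hc.ne (hc.isDesc.eq_of_fixed hzc)
    exact absurd (hr.isRootedTree.eq_of_mem_children hzmem hr.mem_children hbz hr.isDesc_bot) hzr
  · exact ⟨(hbot hu).1 hbz, hu⟩

lemma IsMerge.cutCritical_eq (h : IsMerge w p q) : cutCritical w q = cutCritical w p := by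
  obtain ⟨r, c, hr, hc, hmax, rfl⟩ := h
  funext z
  by_cases hzr : z = r
  · subst hzr
    rw [cutCritical_of_father_eq (mem_children.1 hr.mem_children).1]
    refine cutCritical_of_isCriticalEdge ⟨(hc.attachable_move hr).isDesc_bot, ?_⟩
    rw [moveSubtrees_of_mem (Finset.mem_singleton_self z)]
    exact hc.isCritical_move hr
  · have hiff := isCriticalEdge_moveSubtrees_iff hr hc hmax hzr
    by_cases hz : IsCriticalEdge p w z
    · rw [cutCritical_of_isCriticalEdge hz, cutCritical_of_isCriticalEdge (hiff.2 hz)]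
    · rw [cutCritical_of_not_isCriticalEdge hz, cutCritical_of_not_isCriticalEdge (hiff.not.2 hz),
        moveSubtrees_of_notMem (by simpa using hzr)]

open Classical in
/-- The number of critical nodes below `w`; it counts the merges that lead to the tree. -/
noncomputable def criticalCount (w : V) (p : V → V) : ℕ :=
  (Finset.univ.filter (IsCritical p w)).card

lemma criticalCount_eq_zero_iff : criticalCount w p = 0 ↔ ∀ u, ¬ IsCritical p w u := by
  simp [criticalCount, Finset.filter_eq_empty_iff]

lemma IsMerge.criticalCount_eq (h : IsMerge w p q) :
    criticalCount w q = criticalCount w p + 1 := by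
  classical
  obtain ⟨r, c, hr, hc, hmax, rfl⟩ := h
  have hnot : c ∉ Finset.univ.filter (IsCritical p w) := by
    simp only [Finset.mem_filter, Finset.mem_univ, true_and]
    exact fun h => hc.not_isDesc (h.isDesc_child hr)
  rw [criticalCount, criticalCount, ← Finset.card_insert_of_notMem hnot]
  congr 1
  ext u
  simp [isCritical_moveSubtrees_iff hr hc hmax]

/-- The properties of trees that are unchanged by merging below the critical node `w`. -/
structure CriticalState (w : V) (k d : ℕ) (p : V → V) : Prop extends IsTopImproper p where
  isCritical : IsCritical p ⊤ w
  improperCount_eq : improperCount p = k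
  deg_top : deg p ⊤ = d
  deg_bot : deg p ⊥ = 0

lemma IsMerge.criticalState_iff (h : IsMerge w p q) :
    CriticalState w k d p ↔ CriticalState w k d q := by
  obtain ⟨r, c, hr, hc, -, rfl⟩ := h
  have hcount := hc.improperCount_move hr
  have hcrit := hc.isCritical_top_move_iff hr
  have hbot := hc.deg_bot_move hr
  have htop (hw : IsCritical p ⊤ w) : deg (moveSubtrees p {r} c) ⊤ = deg p ⊤ := by
    rw [deg, deg, hc.children_move hr hw.ne.symm (hc.ne_top hr).symm]
  constructor
  · rintro ⟨-, hw, hk, hd, h0⟩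
    exact ⟨hc.isTopImproper_move hr, hcrit.2 hw, hcount.trans hk, (htop hw).trans hd,
      hbot.trans h0⟩
  · rintro ⟨-, hw, hk, hd, h0⟩
    rw [hcrit] at hw
    exact ⟨hr.toIsTopImproper, hw, hcount.symm.trans hk, (htop hw).symm.trans hd,
      hbot.symm.trans h0⟩

lemma criticalState_iff_of_chain (h : Relation.ReflTransGen (IsMerge w) q t) :
    CriticalState w k d q ↔ CriticalState w k d t := by
  induction h with
  | refl => exact Iff.rfl
  | tail _ h ih => exact ih.trans h.criticalState_iff

lemma cutCritical_eq_of_chain (h : Relation.ReflTransGen (IsMerge w) q t) :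
    cutCritical w t = cutCritical w q := by
  induction h with
  | refl => rfl
  | tail _ h ih => exact h.cutCritical_eq.trans ih

lemma CriticalState.chain_cutCritical (ht : CriticalState w k d t) :
    Relation.ReflTransGen (IsMerge w) (cutCritical w t) t ∧
      ∀ u, ¬ IsCritical (cutCritical w t) w u := by
  induction hn : criticalCount w t generalizing t with
  | zero =>
    rw [criticalCount_eq_zero_iff] at hn
    rw [cutCritical_eq_self hn]
    exact ⟨.refl, hn⟩
  | succ n ih =>
    have he : ∃ u, IsCritical t w u := by
      by_contra! hnone
      rw [criticalCount_eq_zero_iff.2 hnone] at hn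
      omega
    obtain ⟨s, hs⟩ := exists_isMerge_of_isCritical ht.toIsTopImproper ht.isCritical.isDesc he
    have hcount := hs.criticalCount_eq
    obtain ⟨hchain, hnone⟩ := ih (hs.criticalState_iff.2 ht) (by omega)
    rw [hs.cutCritical_eq]
    exact ⟨hchain.tail hs, hnone⟩

lemma exists_maximal_chain (w : V) (q : V → V) :
    ∃ t, Relation.ReflTransGen (IsMerge w) q t ∧ ∀ s, ¬ IsMerge w t s := by
  classical
  induction hn : Fintype.card V - criticalCount w q using Nat.strong_induction_on
    generalizing q with
  | _ n ih =>
    by_cases h : ∃ s, IsMerge w q s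
    · obtain ⟨s, hs⟩ := h
      have hcount := hs.criticalCount_eq
      have hle : criticalCount w s ≤ Fintype.card V := Finset.card_le_univ _
      obtain ⟨t, ht, hmax⟩ := ih _ (by omega) s rfl
      exact ⟨t, ht.head hs, hmax⟩
    · exact ⟨q, .refl, not_exists.1 h⟩

lemma maximal_chain_unique (h : Relation.ReflTransGen (IsMerge w) q t)
    (h' : Relation.ReflTransGen (IsMerge w) q t') (ht : ∀ s, ¬ IsMerge w t s)
    (ht' : ∀ s, ¬ IsMerge w t' s) : t = t' := by
  have hunique : Relator.RightUnique (IsMerge w) := fun _ _ _ h h' => h.right_unique h'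
  rcases h.total_of_right_unique hunique h' with h | h <;>
    rcases h.cases_head with h | ⟨s, hs, -⟩
  · exact h
  · exact absurd hs (ht s)
  · exact h.symm
  · exact absurd hs (ht' s)

end Cut

section Regraft

variable {V : Type*} [Fintype V] [LinearOrder V] [BoundedOrder V] {p : V → V} {r u x z : V}

namespace Swingable

variable (hp : Swingable p)
include hp

lemma isDesc_mapA_top_iff :
    IsDesc (mapA p) z ⊤ ↔ IsDesc p z ⊤ ∨ IsBelow p (children p ⊥) z := by
  by_cases hz : IsBelow p (children p ⊥) z
  · exact iff_of_true ((isDesc_moveSubtrees hp.isRootedTree hp.not_isBelow_top).2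
      (Or.inr ⟨hz, IsDesc.refl p ⊤⟩)) (Or.inr hz)
  · rw [hp.isDesc_mapA_of_not_isBelow hz, or_iff_left hz]

lemma isDesc_mapA_iff_of_isDesc_bot (hx : IsDesc p ⊥ x) (htop : ¬ IsDesc p ⊤ x) :
    IsDesc (mapA p) z x ↔ IsDesc p z x ∧ ¬ IsBelow p (children p ⊥) z := by
  by_cases hz : IsBelow p (children p ⊥) z
  · refine iff_of_false (fun hzx => ?_) fun h => h.2 hz
    rcases (isDesc_moveSubtrees hp.isRootedTree hp.not_isBelow_top).1 hzx with ⟨-, hs⟩ | h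
    · obtain ⟨s, hsS, hzs⟩ := hz
      have hsx : s = x := hs s hsS hzs ((isDesc_of_mem_children hsS).trans hx)
      exact hp.isRootedTree.not_isBelow_children ⟨s, hsS, hsx ▸ hx⟩
    · exact htop h.2
  · rw [hp.isDesc_mapA_of_not_isBelow hz, and_iff_left hz]

lemma isBelow_betaStar : IsBelow p (children p ⊥) (betaStar p) := by
  obtain ⟨s, hs, hβ⟩ := exists_beta_eq_betaStar hp.children_bot_nonempty
  exact ⟨s, hs, hβ ▸ isDesc_beta p s⟩

lemma betaStar_lt_top : betaStar p < ⊤ :=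
  lt_top_iff_ne_top.2 fun h => hp.not_isBelow_top (h ▸ hp.isBelow_betaStar)

omit hp in
lemma _root_.betaStar_le_of_isBelow (hz : IsBelow p (children p ⊥) z) : betaStar p ≤ z := by
  obtain ⟨s, hs, hzs⟩ := hz
  exact (betaStar_le_beta hs).trans (beta_le hzs)

lemma betaStar_le_of_isDesc_mapA (hz : IsDesc (mapA p) z (betaStar p)) : betaStar p ≤ z := by
  rcases (isDesc_moveSubtrees hp.isRootedTree hp.not_isBelow_top).1 hz with h | h
  · exact betaStar_le_of_isBelow (hp.isBelow_betaStar.mono h.1)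
  · exact absurd (hp.isBelow_betaStar.mono h.2) hp.not_isBelow_top

lemma firstChildOfBot_mem : firstChildOfBot p ∈ children p ⊥ :=
  (argminBeta_spec hp.children_bot_nonempty).1

lemma beta_firstChildOfBot : beta p (firstChildOfBot p) = betaStar p := by
  obtain ⟨ha, hmin⟩ := argminBeta_spec (p := p) hp.children_bot_nonempty
  obtain ⟨s, hs, hβ⟩ := exists_beta_eq_betaStar hp.children_bot_nonempty
  exact le_antisymm (hβ ▸ hmin s hs) (betaStar_le_beta ha)

omit hp in
lemma _root_.keepFirst_of_mem (hz : z ∈ children p ⊥) (hne : z ≠ firstChildOfBot p) :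
    keepFirst p z = ⊤ :=
  moveSubtrees_of_mem (Finset.mem_erase.2 ⟨hne, hz⟩)

omit hp in
lemma _root_.keepFirst_of_notMem (hz : z ∉ children p ⊥) : keepFirst p z = p z :=
  moveSubtrees_of_notMem fun h => hz (Finset.mem_of_mem_erase h)

lemma isDesc_keepFirst_of_not_isBelow (hz : ¬ IsBelow p (children p ⊥) z) :
    IsDesc (keepFirst p) z x ↔ IsDesc p z x :=
  isDesc_moveSubtrees_of_not_isBelow hp.isRootedTree
    fun ⟨s, hs, hzs⟩ => hz ⟨s, Finset.mem_of_mem_erase hs, hzs⟩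

lemma beta_keepFirst (x : V) : beta (keepFirst p) x = beta p x := by
  refine beta_moveSubtrees hp.isRootedTree (Finset.erase_subset _ _)
    (fun ⟨s, hs, h⟩ => hp.not_isBelow_top ⟨s, Finset.mem_of_mem_erase hs, h⟩)
    (fun s hs => ?_) (fun s hs => ?_) x
  · rw [beta_bot]
    exact hp.isRootedTree.bot_lt_beta_of_mem_children (Finset.mem_of_mem_erase hs)
  · obtain ⟨b, hb⟩ := hp.children_top_nonempty
    exact (beta_le_beta (isDesc_of_mem_children hb)).trans_lt
      (hp.beta_lt_beta hb (Finset.mem_of_mem_erase hs))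

lemma children_bot_keepFirst : children (keepFirst p) ⊥ = {firstChildOfBot p} := by
  have ha := hp.firstChildOfBot_mem
  ext y
  rw [Finset.mem_singleton]
  by_cases hy : y ∈ (children p ⊥).erase (firstChildOfBot p)
  · rw [keepFirst, mem_children_moveSubtrees_of_mem hy]
    exact iff_of_false (fun h => hp.bot_ne_top h.1.symm) (Finset.ne_of_mem_erase hy)
  · rw [keepFirst, mem_children_moveSubtrees_of_notMem hy]
    exact ⟨fun h => by_contra fun hne => hy (Finset.mem_erase.2 ⟨hne, h⟩), fun h => h ▸ ha⟩

lemma betaStar_keepFirst : betaStar (keepFirst p) = betaStar p := by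
  rw [betaStar, hp.children_bot_keepFirst, Finset.inf_singleton, hp.beta_keepFirst,
    hp.beta_firstChildOfBot]

end Swingable

/-- The trees of the source of the map (d): `r` is the only child of `⊤`, and its subtree
contains `⊥`. -/
structure SoleSwingable (p : V → V) (r : V) : Prop extends Swingable p where
  children_top : children p ⊤ = {r}
  isDesc_bot : IsDesc p ⊥ r

lemma exists_soleSwingable (hp : IsTopImproper p) (hbot : (children p ⊥).Nonempty)
    (hbt : IsDesc p ⊥ ⊤) (hdeg : deg p ⊤ = 1) : ∃ r, SoleSwingable p r := by
  obtain ⟨c, hc, hbc⟩ := hbt.exists_mem_children (bot_ne_top_of_mem_children hbot.choose_spec)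
  obtain ⟨r, hr⟩ := Finset.card_eq_one.1 hdeg
  obtain rfl : c = r := by rwa [hr, Finset.mem_singleton] at hc
  obtain ⟨a, ha, hβ⟩ := exists_beta_eq_betaStar hbot
  refine ⟨c, ⟨hp, hbot, ?_⟩, hr, hbc⟩
  rw [alpha, hr, Finset.sup_singleton, le_bot_iff.1 (beta_le hbc), ← hβ]
  exact hp.isRootedTree.bot_lt_beta_of_mem_children ha

/-- Move all subtrees of `⊥` to `⊤`, and then `T_r` to `β*`. The map (d) factors through this
tree: `mapD p` undoes the merges at `β*` that would lead to it. -/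
noncomputable def attachToBetaStar (p : V → V) (r : V) : V → V :=
  moveSubtrees (mapA p) {r} (betaStar p)

namespace SoleSwingable

variable (hp : SoleSwingable p r)
include hp

lemma mem_children_top : r ∈ children p ⊤ := hp.children_top ▸ Finset.mem_singleton_self r

lemma attachable : Attachable (mapA p) ⊤ r := hp.attachable_mapA hp.mem_children_top hp.isDesc_bot

lemma isDesc_of_isDesc_top (hz : IsDesc p z ⊤) (hne : z ≠ ⊤) : IsDesc p z r := by
  obtain ⟨c, hc, hzc⟩ := hz.exists_mem_children hne
  rw [hp.children_top, Finset.mem_singleton] at hc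
  exact hc ▸ hzc

lemma isDesc_mapA_iff (hx : OnPath p r ⊥ x) :
    IsDesc (mapA p) z x ↔ IsDesc p z x ∧ ¬ IsBelow p (children p ⊥) z :=
  hp.isDesc_mapA_iff_of_isDesc_bot hx.2 fun h =>
    hp.isRootedTree.not_isDesc_of_mem_children hp.mem_children_top (h.trans hx.1)

lemma onPath_self : OnPath p r ⊥ r := ⟨IsDesc.refl p r, hp.isDesc_bot⟩

lemma isAttachNode : IsAttachNode (mapA p) ⊤ r (betaStar p) where
  isDesc := hp.isDesc_mapA_top_iff.2 (Or.inr hp.isBelow_betaStar)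
  ne := hp.betaStar_lt_top.ne
  not_isDesc h := ((hp.isDesc_mapA_iff hp.onPath_self).1 h).2 hp.isBelow_betaStar
  lt z hz hn hzr := by
    by_cases hzS : IsBelow p (children p ⊥) z
    · exact (betaStar_le_of_isBelow hzS).lt_of_ne fun he => hn (he ▸ IsDesc.refl _ _)
    by_cases hzt : z = ⊤
    · exact hzt ▸ hp.betaStar_lt_top
    · rw [hp.isDesc_mapA_of_not_isBelow hzS] at hz hzr
      exact absurd (hp.isDesc_of_isDesc_top hz hzt) hzr

lemma attachable_attachToBetaStar : Attachable (attachToBetaStar p r) (betaStar p) r :=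
  hp.isAttachNode.attachable_move hp.attachable

lemma criticalState_attachToBetaStar :
    CriticalState (betaStar p) (improperCount p + deg p ⊥) (deg p ⊥) (attachToBetaStar p r) where
  toIsTopImproper := hp.isAttachNode.isTopImproper_move hp.attachable
  isCritical := hp.isAttachNode.isCritical_move hp.attachable
  improperCount_eq := by
    rw [attachToBetaStar, hp.isAttachNode.improperCount_move hp.attachable, hp.improperCount_mapA]
  deg_top := by
    have hdeg := hp.isAttachNode.deg_father_move hp.attachable
    have htop : deg p ⊤ = 1 := by rw [deg, hp.children_top, Finset.card_singleton]
    rw [hp.deg_top_mapA] at hdeg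
    rw [attachToBetaStar]
    omega
  deg_bot := by
    rw [attachToBetaStar, hp.isAttachNode.deg_bot_move hp.attachable, hp.deg_bot_mapA]

lemma not_isMerge_attachToBetaStar (q : V → V) :
    ¬ IsMerge (betaStar p) (attachToBetaStar p r) q := by
  have hr := hp.attachable_attachToBetaStar
  rintro ⟨r', c, hr', hc, -, -⟩
  obtain rfl := hr.eq hr'
  have hcr := hc.not_isDesc
  rw [attachToBetaStar, hp.isAttachNode.isDesc_move_iff_of_inside hp.attachable
    (IsDesc.refl _ r)] at hcr
  have hcw := hc.isDesc
  rw [attachToBetaStar, hp.isAttachNode.isDesc_move_iff_of_outside hp.attachable hcr] at hcw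
  refine (hp.betaStar_le_of_isDesc_mapA hcw).not_gt (hc.lt _ hr.isDesc_top ?_ hr.not_isDesc)
  exact fun h => hc.ne (hc.isDesc.antisymm hr.isRootedTree h)

lemma isDesc_attachToBetaStar_iff (hx : OnPath p r ⊥ x) :
    IsDesc (attachToBetaStar p r) z x ↔ IsDesc p z x ∧ ¬ IsBelow p (children p ⊥) z := by
  have hxr : IsDesc (mapA p) x r := (hp.isDesc_mapA_iff hp.onPath_self).2
    ⟨hx.1, fun h => hp.isRootedTree.not_isBelow_children (h.mono hx.2)⟩
  rw [attachToBetaStar, hp.isAttachNode.isDesc_move_iff_of_inside hp.attachable hxr,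
    hp.isDesc_mapA_iff hx]

lemma isDesc_attachToBetaStar_top_iff :
    IsDesc (attachToBetaStar p r) z ⊤ ↔ IsDesc p z ⊤ ∨ IsBelow p (children p ⊥) z := by
  rw [attachToBetaStar, hp.isAttachNode.isDesc_move_iff_of_above hp.attachable (IsDesc.refl _ ⊤),
    hp.isDesc_mapA_top_iff]

lemma onPath_keepFirst_iff : OnPath (keepFirst p) x ⊥ z ↔ OnPath p x ⊥ z := by
  have hbot : ¬ IsBelow p (children p ⊥) ⊥ := hp.isRootedTree.not_isBelow_children
  rw [OnPath, OnPath, hp.isDesc_keepFirst_of_not_isBelow hbot]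
  exact and_congr_left fun hz => hp.isDesc_keepFirst_of_not_isBelow fun h => hbot (h.mono hz)

lemma belowRest_and_lt_iff (hu : OnPath p r ⊥ u) :
    BelowRest (keepFirst p) r u ∧ u < betaStar p ↔
      ∀ z, IsDesc (attachToBetaStar p r) z ⊤ → ¬ IsDesc (attachToBetaStar p r) z u → u < z := by
  simp only [belowRest_iff, hp.isDesc_attachToBetaStar_iff hu, hp.isDesc_attachToBetaStar_top_iff]
  constructor
  · rintro ⟨hrest, hlt⟩ z hz hzu
    by_cases hzS : IsBelow p (children p ⊥) z
    · exact hlt.trans_le (betaStar_le_of_isBelow hzS)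
    by_cases hzt : z = ⊤
    · exact hzt ▸ hlt.trans hp.betaStar_lt_top
    have hzr := hp.isDesc_of_isDesc_top (hz.resolve_right hzS) hzt
    refine hrest z ((hp.isDesc_keepFirst_of_not_isBelow hzS).2 hzr) fun h => hzu ⟨?_, hzS⟩
    exact (hp.isDesc_keepFirst_of_not_isBelow hzS).1 h
  · intro h
    have hlt := h _ (Or.inr hp.isBelow_betaStar) fun hd => hd.2 hp.isBelow_betaStar
    refine ⟨fun z hz hzu => ?_, hlt⟩
    by_cases hzS : IsBelow p (children p ⊥) z
    · exact hlt.trans_le (betaStar_le_of_isBelow hzS)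
    rw [hp.isDesc_keepFirst_of_not_isBelow hzS] at hz hzu
    exact h z (Or.inl (hz.trans (isDesc_of_mem_children hp.mem_children_top))) fun hd => hzu hd.1

lemma onPath_attachToBetaStar_iff : OnPath (attachToBetaStar p r) r ⊥ z ↔ OnPath p r ⊥ z := by
  have hbot : ¬ IsBelow p (children p ⊥) ⊥ := hp.isRootedTree.not_isBelow_children
  constructor
  · rintro ⟨hzr, hbz⟩
    refine ⟨((hp.isDesc_attachToBetaStar_iff hp.onPath_self).1 hzr).1, ?_⟩
    rw [attachToBetaStar, hp.isAttachNode.isDesc_move_iff_of_inside hp.attachable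
      (IsDesc.refl _ r)] at hzr
    rwa [attachToBetaStar, hp.isAttachNode.isDesc_move_iff_of_inside hp.attachable hzr,
      hp.isDesc_bot_mapA] at hbz
  · intro hz
    exact ⟨(hp.isDesc_attachToBetaStar_iff hp.onPath_self).2 ⟨hz.1, fun h => hbot (h.mono hz.2)⟩,
      (hp.isDesc_attachToBetaStar_iff hz).2 ⟨hz.2, hbot⟩⟩

lemma isCutNode_keepFirst_iff :
    IsCutNode (keepFirst p) r (betaStar p) u ∧ u ≠ ⊥ ↔
      IsCritical (attachToBetaStar p r) (betaStar p) u := by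
  have hr := hp.attachable_attachToBetaStar
  constructor
  · rintro ⟨⟨hu, hrest⟩, hne⟩
    rw [hp.onPath_keepFirst_iff] at hu
    have hut := hp.onPath_attachToBetaStar_iff.2 hu
    exact ⟨hut.2, hut.1.trans hr.isDesc, hrest.2.ne, hne, (hp.belowRest_and_lt_iff hu).1 hrest⟩
  · intro hu
    have hpath := hp.onPath_attachToBetaStar_iff.1 ⟨hu.isDesc_child hr, hu.isDesc_bot⟩
    exact ⟨⟨hp.onPath_keepFirst_iff.2 hpath, (hp.belowRest_and_lt_iff hpath).2 hu.lt⟩, hu.ne_bot⟩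

lemma notMem_children_bot : r ∉ children p ⊥ :=
  Finset.disjoint_left.1 hp.disjoint_children hp.mem_children_top

omit hp in
lemma _root_.attachToBetaStar_of_ne (hzr : z ≠ r) : attachToBetaStar p r z = mapA p z :=
  moveSubtrees_of_notMem (by simpa using hzr)

lemma isCriticalEdge_attachToBetaStar_iff (hzr : z ≠ r) (hz : z ∉ children p ⊥) :
    IsCriticalEdge (attachToBetaStar p r) (betaStar p) z ↔
      OnPath (keepFirst p) r ⊥ z ∧ IsCutNode (keepFirst p) r (betaStar p) (p z) := by
  rw [IsCriticalEdge, attachToBetaStar_of_ne hzr, mapA, moveSubtrees_of_notMem hz,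
    ← hp.isCutNode_keepFirst_iff, hp.onPath_keepFirst_iff]
  constructor
  · rintro ⟨hbz, hcut, -⟩
    have hpz := hp.onPath_attachToBetaStar_iff.2 (hp.onPath_keepFirst_iff.1 hcut.1)
    have hfather : attachToBetaStar p r z = p z := by
      rw [attachToBetaStar_of_ne hzr, mapA, moveSubtrees_of_notMem hz]
    have hz' : IsDesc (attachToBetaStar p r) z (p z) := hfather ▸ isDesc_father _ z
    exact ⟨hp.onPath_attachToBetaStar_iff.1 ⟨hz'.trans hpz.1, hbz⟩, hcut⟩
  · rintro ⟨hz', hcut⟩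
    refine ⟨(hp.onPath_attachToBetaStar_iff.2 hz').2, hcut, fun h => hz ?_⟩
    refine mem_children.2 ⟨h, ?_⟩
    rintro rfl
    exact hp.not_isDesc_top_bot hp.bot_ne_top (hp.isRootedTree.isDesc_of_fixed h ⊤)

lemma onlyChildOfTop_eq : onlyChildOfTop p = r := by
  have h : onlyChildOfTop p ∈ children p ⊤ := Classical.epsilon_spec ⟨r, hp.mem_children_top⟩
  rwa [hp.children_top, Finset.mem_singleton] at h

lemma cutCritical_attachToBetaStar_of_mem (hz : z ∈ children p ⊥) :
    cutCritical (betaStar p) (attachToBetaStar p r) z = ⊤ := by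
  have hfather : attachToBetaStar p r z = ⊤ := by
    rw [attachToBetaStar_of_ne fun h : z = r => hp.notMem_children_bot (h ▸ hz), mapA,
      moveSubtrees_of_mem hz]
  have hr := hp.attachable_attachToBetaStar
  rw [cutCritical_of_not_isCriticalEdge, hfather]
  rintro ⟨-, hu⟩
  rw [hfather] at hu
  exact hu.ne (hu.isDesc.antisymm hr.isRootedTree hr.isDesc_top)

lemma not_onPath_keepFirst_of_mem (hz : z ∈ children p ⊥) :
    ¬ OnPath (keepFirst p) r ⊥ z := by
  rw [hp.onPath_keepFirst_iff]
  exact fun h => hp.isRootedTree.not_isBelow_children ⟨z, hz, h.2⟩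

lemma mapD_eq : mapD p = cutCritical (betaStar p) (attachToBetaStar p r) := by
  have hr : keepFirst p r = ⊤ := by
    rw [keepFirst_of_notMem hp.notMem_children_bot, (mem_children.1 hp.mem_children_top).1]
  funext z
  rw [mapD, hp.onlyChildOfTop_eq, hp.betaStar_keepFirst, regraft]
  by_cases hza : z = firstChildOfBot p
  · rw [if_pos hza, hr, if_neg (mem_children.1 hp.mem_children_top).2.symm,
      hp.cutCritical_attachToBetaStar_of_mem (hza ▸ hp.firstChildOfBot_mem)]
  rw [if_neg hza]
  by_cases hz : z ∈ children p ⊥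
  · rw [hp.cutCritical_attachToBetaStar_of_mem hz, keepFirst_of_mem hz hza,
      if_neg fun h => hp.not_onPath_keepFirst_of_mem hz h.1]
  by_cases hzr : z = r
  · subst hzr
    rw [if_pos ⟨hp.onPath_keepFirst_iff.2 hp.onPath_self, Or.inl rfl⟩]
    exact (cutCritical_of_father_eq (moveSubtrees_of_mem (Finset.mem_singleton_self z))).symm
  have hedge := hp.isCriticalEdge_attachToBetaStar_iff hzr hz
  rw [keepFirst_of_notMem hz]
  split_ifs with h
  · exact (cutCritical_of_isCriticalEdge (hedge.2 ⟨h.1, h.2.resolve_left hzr⟩)).symm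
  · rw [cutCritical_of_not_isCriticalEdge fun h' => h ((hedge.1 h').imp_right Or.inr),
      attachToBetaStar_of_ne hzr, mapA, moveSubtrees_of_notMem hz]

lemma chain_mapD :
    Relation.ReflTransGen (IsMerge (betaStar p)) (mapD p) (attachToBetaStar p r) ∧
      ∀ u, ¬ IsCritical (mapD p) (betaStar p) u :=
  hp.mapD_eq ▸ hp.criticalState_attachToBetaStar.chain_cutCritical

lemma criticalState_mapD :
    CriticalState (betaStar p) (improperCount p + deg p ⊥) (deg p ⊥) (mapD p) :=
  (criticalState_iff_of_chain hp.chain_mapD.1).2 hp.criticalState_attachToBetaStar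

end SoleSwingable

end Regraft

section BijD

namespace SoleSwingable

variable {V : Type*} [Fintype V] [LinearOrder V] [BoundedOrder V] {p q t : V → V}
  {r s w : V} {k m : ℕ}

lemma betaStar_eq_of_mapD_eq (hp : SoleSwingable p r) (hq : SoleSwingable q s)
    (h : mapD p = mapD q) : betaStar p = betaStar q := by
  by_contra hne
  have hcp := hp.criticalState_mapD.isCritical
  have hcq := hq.criticalState_mapD.isCritical
  rw [← h] at hcq
  rcases hcp.isDesc_bot.total hcq.isDesc_bot with hd | hd
  · exact hq.chain_mapD.2 _ (h ▸ hcp.of_isDesc hd hne)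
  · exact hp.chain_mapD.2 _ (hcq.of_isDesc hd (Ne.symm hne))

lemma eq_of_mapD_eq (hp : SoleSwingable p r) (hq : SoleSwingable q s)
    (hdeg : deg p ⊥ = deg q ⊥) (h : mapD p = mapD q) : p = q := by
  have hw := hp.betaStar_eq_of_mapD_eq hq h
  have ht : attachToBetaStar p r = attachToBetaStar q s :=
    maximal_chain_unique hp.chain_mapD.1 (h ▸ hw ▸ hq.chain_mapD.1)
      hp.not_isMerge_attachToBetaStar (hw ▸ hq.not_isMerge_attachToBetaStar)
  obtain rfl : r = s :=
    hp.attachable_attachToBetaStar.eq (ht ▸ hw ▸ hq.attachable_attachToBetaStar)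
  refine hp.eq_of_mapA_eq hq.toSwingable hdeg ?_
  rw [← hp.attachable.moveSubtrees_moveSubtrees (c := betaStar p),
    ← hq.attachable.moveSubtrees_moveSubtrees (c := betaStar q)]
  exact congrArg (moveSubtrees · {r} ⊤) ht

lemma betaStar_eq_of_not_isMerge (hp : SoleSwingable p r) (hw : IsAttachNode (mapA p) ⊤ r w)
    (hmax : ∀ t, ¬ IsMerge w (moveSubtrees (mapA p) {r} w) t) : betaStar p = w := by
  have hB := hp.isAttachNode
  apply le_antisymm
  · refine betaStar_le_of_isBelow ?_
    by_contra hnot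
    have hwr := hw.not_isDesc
    have hwt := hw.isDesc
    rw [hp.isDesc_mapA_of_not_isBelow hnot] at hwr hwt
    exact hwr (hp.isDesc_of_isDesc_top hwt hw.ne)
  · by_cases hd : IsDesc (mapA p) (betaStar p) w
    · by_contra! hlt
      rw [← hw.isDesc_move_iff_of_outside hp.attachable hB.not_isDesc] at hd
      have hBr := hB.not_isDesc
      rw [← hw.isDesc_move_iff_of_inside hp.attachable (IsDesc.refl _ r)] at hBr
      have hr := hw.attachable_move hp.attachable
      obtain ⟨t, ht⟩ := exists_isMerge hr
        (exists_isAttachNode hr (hw.isCritical_move hp.attachable).lt hd hBr hlt)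
      exact hmax t ht
    · exact (hw.lt _ hB.isDesc hd hB.not_isDesc).le

lemma exists_attachToBetaStar_eq (ht : CriticalState w k m t) (hm : 1 ≤ m)
    (hmax : ∀ s, ¬ IsMerge w t s) :
    ∃ p r, SoleSwingable p r ∧ deg p ⊥ = m ∧ betaStar p = w ∧ attachToBetaStar p r = t := by
  have hw := ht.isCritical
  obtain ⟨r, hr, hbr⟩ := hw.isDesc_bot.exists_mem_children hw.ne_bot.symm
  have hatt := hw.attachable_detach ht.toIsTopImproper (IsDesc.refl t ⊤) hr hbr
  have hnode := hw.isAttachNode_detach ht.toIsTopImproper hr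
  have hback : moveSubtrees (moveSubtrees t {r} ⊤) {r} w = t :=
    moveSubtrees_moveSubtrees fun s hs => (mem_children.1 (Finset.mem_singleton.1 hs ▸ hr)).1
  have hbot := hnode.deg_bot_move hatt
  have htop := hnode.deg_father_move hatt
  rw [hback, ht.deg_bot] at hbot
  rw [hback, ht.deg_top] at htop
  obtain ⟨p, hp, hpm, hpt⟩ :=
    exists_swingable_mapA_eq hatt.toIsTopImproper hatt.bot_ne_top hbot.symm hm htop.le
  rw [← hpt] at hatt hnode htop
  have hdeg : deg p ⊤ = 1 := by
    rw [hp.deg_top_mapA] at htop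
    omega
  have hbt : IsDesc p ⊥ ⊤ := hp.isDesc_bot_mapA.1 (hatt.isDesc_bot.trans hatt.isDesc)
  obtain ⟨s, hs⟩ := exists_soleSwingable hp.toIsTopImproper hp.children_bot_nonempty hbt hdeg
  obtain rfl : s = r := hs.attachable.eq hatt
  have hβ : betaStar p = w := hs.betaStar_eq_of_not_isMerge hnode (hpt ▸ hback.symm ▸ hmax)
  exact ⟨p, s, hs, hpm, hβ, by rw [attachToBetaStar, hβ, hpt, hback]⟩

end SoleSwingable

variable {n k m : ℕ} [NeZero n] {p : Fin n → Fin n}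

lemma exists_soleSwingable_of_mem_sourceD (hm : 1 ≤ m) (hp : p ∈ sourceD n k m) :
    ∃ r, SoleSwingable p r :=
  exists_soleSwingable (mem_RTrees_zero_iff.1 hp.1).1 (children_nonempty_of_deg_eq hm hp.2.1)
    hp.2.2.1 hp.2.2.2

lemma mapsTo_mapD (hm : 1 ≤ m) : Set.MapsTo mapD (sourceD n k m) (targetD n k m) := by
  intro p hp
  obtain ⟨r, hr⟩ := exists_soleSwingable_of_mem_sourceD hm hp
  obtain ⟨hq, hcrit, hcount, htop, hbot⟩ := hr.criticalState_mapD
  have hbt := hcrit.isDesc_bot.trans hcrit.isDesc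
  refine ⟨mem_RTrees_zero_iff.2 ⟨hq, ?_⟩, hbot, htop.trans hp.2.1, hbt, ?_⟩
  · rw [hcount, (mem_RTrees_zero_iff.1 hp.1).2, hp.2.1]
  · exact (bot_lt_lowerCritical_iff hq.isRootedTree (hq.children_top_nonempty hr.bot_ne_top)
      hbt).2 ⟨_, hcrit⟩

lemma surjOn_mapD (hm : 1 ≤ m) : Set.SurjOn mapD (sourceD n k m) (targetD n k m) := by
  rintro q ⟨hq, hbot, htop, hbt, hcrit⟩
  rw [mem_RTrees_zero_iff] at hq
  rw [bot_lt_lowerCritical_iff hq.1.isRootedTree (children_nonempty_of_deg_eq hm htop) hbt]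
    at hcrit
  obtain ⟨w, hw, hlowest⟩ := exists_lowest_isCritical hq.1.isRootedTree hcrit
  obtain ⟨t, hqt, hmax⟩ := exists_maximal_chain w q
  have ht : CriticalState w (k + m) m t :=
    (criticalState_iff_of_chain hqt).1 ⟨hq.1, hw, hq.2, htop, hbot⟩
  obtain ⟨p, r, hp, hpm, rfl, rfl⟩ := SoleSwingable.exists_attachToBetaStar_eq ht hm hmax
  have hcount := hp.criticalState_attachToBetaStar.improperCount_eq
  rw [ht.improperCount_eq, hpm] at hcount
  refine ⟨p, ⟨mem_RTrees_zero_iff.2 ⟨hp.toIsTopImproper, by omega⟩, hpm, ?_, ?_⟩, ?_⟩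
  · exact hp.isDesc_bot.trans (isDesc_of_mem_children hp.mem_children_top)
  · rw [deg, hp.children_top, Finset.card_singleton]
  · rw [hp.mapD_eq, cutCritical_eq_of_chain hqt, cutCritical_eq_self hlowest]

theorem bijOn_mapD (hm : 1 ≤ m) : Set.BijOn mapD (sourceD n k m) (targetD n k m) := by
  refine ⟨mapsTo_mapD hm, fun p hp p' hp' h => ?_, surjOn_mapD hm⟩
  obtain ⟨r, hr⟩ := exists_soleSwingable_of_mem_sourceD hm hp
  obtain ⟨r', hr'⟩ := exists_soleSwingable_of_mem_sourceD hm hp'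
  exact hr.eq_of_mapD_eq hr' (hp.2.1.trans hp'.2.1.symm) h

end BijD

section LabelSwap

variable {V : Type*} {p : V → V} {u v x y z : V}

open Classical in
/-- The permutation of the labels that exchanges `x` and `y`. -/
noncomputable def labelSwap (x y : V) : Equiv.Perm V := Equiv.swap x y

open Classical in
lemma labelSwap_left (x y : V) : labelSwap x y x = y := Equiv.swap_apply_left x y

open Classical in
lemma labelSwap_right (x y : V) : labelSwap x y y = x := Equiv.swap_apply_right x y

open Classical in
lemma labelSwap_of_ne (hx : z ≠ x) (hy : z ≠ y) : labelSwap x y z = z :=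
  Equiv.swap_apply_of_ne_of_ne hx hy

open Classical in
lemma labelSwap_labelSwap (x y z : V) : labelSwap x y (labelSwap x y z) = z :=
  Equiv.swap_apply_self x y z

lemma exchangeLabels_apply :
    exchangeLabels p x y z = labelSwap x y (p (labelSwap x y z)) := rfl

lemma exchangeLabels_labelSwap :
    exchangeLabels p x y (labelSwap x y z) = labelSwap x y (p z) := by
  rw [exchangeLabels_apply, labelSwap_labelSwap]

lemma exchangeLabels_exchangeLabels : exchangeLabels (exchangeLabels p x y) x y = p := by
  funext z
  simp only [exchangeLabels_apply, labelSwap_labelSwap]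

lemma isDesc_exchangeLabels_labelSwap :
    IsDesc (exchangeLabels p x y) (labelSwap x y u) (labelSwap x y v) ↔ IsDesc p u v := by
  have hsemiconj : Function.Semiconj (labelSwap x y) p (exchangeLabels p x y) :=
    fun _ => exchangeLabels_labelSwap.symm
  refine exists_congr fun j => ?_
  rw [← (hsemiconj.iterate_right j).eq, (labelSwap x y).injective.eq_iff]

lemma isDesc_exchangeLabels :
    IsDesc (exchangeLabels p x y) u v ↔ IsDesc p (labelSwap x y u) (labelSwap x y v) := by
  rw [← isDesc_exchangeLabels_labelSwap (p := p), labelSwap_labelSwap, labelSwap_labelSwap]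

lemma IsRootedTree.exchangeLabels (hp : IsRootedTree p) (x y : V) :
    IsRootedTree (exchangeLabels p x y) := by
  obtain ⟨r, hr, hd⟩ := hp
  refine ⟨labelSwap x y r, by rw [exchangeLabels_labelSwap, hr],
    fun z => isDesc_exchangeLabels.2 ?_⟩
  rw [labelSwap_labelSwap]
  exact hd _

lemma isDesc_labelSwap (hx : IsDesc p x v) (hy : IsDesc p y v) (hu : IsDesc p u v) :
    IsDesc p (labelSwap x y u) v := by
  by_cases hux : u = x
  · rwa [hux, labelSwap_left]
  by_cases huy : u = y
  · rwa [huy, labelSwap_right]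
  rwa [labelSwap_of_ne hux huy]

lemma labelSwap_top_of_lt {V : Type*} [PartialOrder V] [OrderTop V] {a x : V} (h : x < a) :
    labelSwap ⊤ a x = x :=
  labelSwap_of_ne h.ne_top h.ne

variable [Fintype V] [LinearOrder V]

lemma mem_children_exchangeLabels :
    u ∈ children (exchangeLabels p x y) v ↔ labelSwap x y u ∈ children p (labelSwap x y v) := by
  rw [mem_children, mem_children, exchangeLabels_apply, ← (labelSwap x y).injective.eq_iff,
    labelSwap_labelSwap, (labelSwap x y).injective.ne_iff]

lemma labelSwap_mem_children_exchangeLabels :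
    labelSwap x y u ∈ children (exchangeLabels p x y) (labelSwap x y v) ↔ u ∈ children p v := by
  rw [mem_children_exchangeLabels, labelSwap_labelSwap, labelSwap_labelSwap]

lemma isImproperEdge_exchangeLabels_labelSwap :
    IsImproperEdge (exchangeLabels p x y) (labelSwap x y z) ↔
      p z ≠ z ∧ ∃ u, IsDesc p u z ∧ labelSwap x y u ≤ labelSwap x y (p z) := by
  rw [isImproperEdge_iff_exists_le, exchangeLabels_labelSwap, (labelSwap x y).injective.ne_iff,
    (labelSwap x y).surjective.exists]
  simp only [isDesc_exchangeLabels_labelSwap]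

lemma isImproperEdge_exchangeLabels_labelSwap_of_isDesc (hp : IsRootedTree p)
    (hx : IsDesc p x z) (hy : IsDesc p y z) :
    IsImproperEdge (exchangeLabels p x y) (labelSwap x y z) ↔ IsImproperEdge p z := by
  rw [isImproperEdge_exchangeLabels_labelSwap, isImproperEdge_iff_exists_le]
  refine and_congr_right fun hz => ?_
  rw [labelSwap_of_ne (fun he => hp.not_isDesc_father hz (by rwa [he]))
    (fun he => hp.not_isDesc_father hz (by rwa [he]))]
  constructor <;> rintro ⟨u, hu, hle⟩
  · exact ⟨_, isDesc_labelSwap hx hy hu, hle⟩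
  · exact ⟨_, isDesc_labelSwap hx hy hu, by rwa [labelSwap_labelSwap]⟩

end LabelSwap

section HandOver

variable {V : Type*} [Fintype V] [LinearOrder V] [OrderTop V] {p : V → V} {a x z : V}

/-- The tree `p` after all subtrees of `⊤` have been moved to `a`. -/
noncomputable def handOver (p : V → V) (a : V) : V → V := moveSubtrees p (children p ⊤) a

lemma handOver_of_mem (hz : z ∈ children p ⊤) : handOver p a z = a := moveSubtrees_of_mem hz

lemma handOver_of_notMem (hz : z ∉ children p ⊤) : handOver p a z = p z :=
  moveSubtrees_of_notMem hz

lemma moveSubtrees_handOver : moveSubtrees (handOver p a) (children p ⊤) ⊤ = p :=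
  moveSubtrees_moveSubtrees fun _ hs => (mem_children.1 hs).1

lemma isDesc_top_of_isBelow (hz : IsBelow p (children p ⊤) z) : IsDesc p z ⊤ := by
  obtain ⟨s, hs, hzs⟩ := hz
  exact hzs.trans (isDesc_of_mem_children hs)

lemma isDesc_handOver_of_not_isDesc_top (hp : IsRootedTree p) (hz : ¬ IsDesc p z ⊤) :
    IsDesc (handOver p a) z x ↔ IsDesc p z x :=
  isDesc_moveSubtrees_of_not_isBelow hp fun hb => hz (isDesc_top_of_isBelow hb)

lemma top_isDesc_handOver_iff (hp : IsRootedTree p) :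
    IsDesc (handOver p a) ⊤ x ↔ IsDesc p ⊤ x :=
  isDesc_moveSubtrees_of_not_isBelow hp hp.not_isBelow_children

section

variable (hp : IsRootedTree p) (ha : ¬ IsDesc p a ⊤)
include hp ha

lemma IsRootedTree.handOver : IsRootedTree (handOver p a) :=
  hp.moveSubtrees fun hb => ha (isDesc_top_of_isBelow hb)

lemma isDesc_handOver_of_isBelow (hx : IsBelow p (children p ⊤) x) :
    IsDesc (handOver p a) z x ↔ IsDesc p z x :=
  isDesc_moveSubtrees_of_isBelow hp (fun _ hs => mem_children.1 hs)
    (fun hb => ha (isDesc_top_of_isBelow hb)) hx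

lemma isDesc_handOver_iff : IsDesc (handOver p a) z x ↔
    (IsDesc p z x ∧ ∀ s ∈ children p ⊤, IsDesc p z s → IsDesc p s x → s = x) ∨
      (IsBelow p (children p ⊤) z ∧ IsDesc p a x) :=
  isDesc_moveSubtrees hp fun hb => ha (isDesc_top_of_isBelow hb)

end

lemma children_top_handOver (ha : a ≠ ⊤) : children (handOver p a) ⊤ = ∅ := by
  refine Finset.eq_empty_of_forall_notMem fun z hz => ?_
  by_cases hzt : z ∈ children p ⊤
  · exact ha ((handOver_of_mem hzt).symm.trans (mem_children.1 hz).1)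
  · exact hzt ((mem_children_moveSubtrees_of_notMem hzt).1 hz)

end HandOver

section PivotTree

variable {V : Type*} [Fintype V] [LinearOrder V] [BoundedOrder V] {p q t : V → V}
  {a b a' b' s x y z : V}

/-- A rooted tree in which the edge from `b` to its father `a` is the topmost proper edge on the
path from `⊤` to the root, and some subtree of `⊥` has a node smaller than `a`. This is what
becomes of a tree with `α = a > β*` once the node `⊤` has been exchanged with `T_α`. -/
structure PivotTree (p : V → V) (a b : V) : Prop where
  isRootedTree : IsRootedTree p
  child_mem : b ∈ children p a
  top_isDesc : IsDesc p ⊤ b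
  lt_of_isDesc : ∀ z, IsDesc p z b → a < z
  isImproperEdge : ∀ y, IsDesc p a y → p y ≠ y → IsImproperEdge p y
  exists_beta_lt : ∃ s ∈ children p ⊥, beta p s < a

lemma exists_topmost_proper_edge (hp : IsRootedTree p) (hroot : p ⊤ ≠ ⊤)
    (hleaf : children p ⊤ = ∅) :
    ∃ a b, b ∈ children p a ∧ IsDesc p ⊤ b ∧ (∀ z, IsDesc p z b → a < z) ∧
      ∀ y, IsDesc p a y → p y ≠ y → IsImproperEdge p y := by
  have htop : ¬ IsImproperEdge p ⊤ := fun himp => by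
    obtain ⟨-, z, hz, hle⟩ := isImproperEdge_iff_exists_le.1 himp
    have hz' : z = ⊤ := by
      by_contra hne
      obtain ⟨c, hc, -⟩ := hz.exists_mem_children hne
      simp [hleaf] at hc
    exact hroot (top_le_iff.1 (hz' ▸ hle))
  obtain ⟨b, ⟨hb, hbr, hbi⟩, hbmax⟩ := exists_isDesc_top_of_chain (p := p)
    (P := fun y => IsDesc p ⊤ y ∧ p y ≠ y ∧ ¬ IsImproperEdge p y)
    (fun _ _ hu hu' => hu.1.total hu'.1) ⟨⊤, IsDesc.refl p ⊤, hroot, htop⟩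
  have hbc : b ∈ children p (p b) := mem_children.2 ⟨rfl, hbr.symm⟩
  refine ⟨p b, b, hbc, hb, fun z hz => ?_, fun y hy hyr => ?_⟩
  · by_contra hle
    exact hbi (isImproperEdge_iff_exists_le.2 ⟨hbr, z, hz, not_lt.1 hle⟩)
  · by_contra hyi
    have hyb := hbmax y ⟨(hb.trans (isDesc_father p b)).trans hy, hyr, hyi⟩
    exact hp.not_isDesc_of_mem_children hbc (hy.trans hyb)

namespace PivotTree

variable (h : PivotTree p a b)
include h

lemma lt_top : a < ⊤ := h.lt_of_isDesc _ h.top_isDesc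

lemma bot_lt : ⊥ < a := by
  obtain ⟨s, -, hs⟩ := h.exists_beta_lt
  exact bot_le.trans_lt hs

lemma bot_ne_top : (⊥ : V) ≠ ⊤ := (h.bot_lt.trans h.lt_top).ne

lemma top_isDesc_pivot : IsDesc p ⊤ a := h.top_isDesc.trans (isDesc_of_mem_children h.child_mem)

lemma not_pivot_isDesc : ¬ IsDesc p a b := h.isRootedTree.not_isDesc_of_mem_children h.child_mem

lemma not_pivot_isDesc_top : ¬ IsDesc p a ⊤ := fun hat =>
  h.not_pivot_isDesc (hat.trans h.top_isDesc)

lemma not_pivot_isDesc_bot : ¬ IsDesc p a ⊥ := fun hab => by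
  obtain ⟨c, hc, hac⟩ := hab.exists_mem_children h.bot_lt.ne'
  exact h.isRootedTree.not_isImproperEdge_of_mem_children_bot hc
    (h.isImproperEdge c hac (father_ne_of_mem_children hc))

lemma not_bot_isDesc : ¬ IsDesc p ⊥ b := fun hb => not_lt_bot (h.lt_of_isDesc _ hb)

lemma not_bot_isDesc_top : ¬ IsDesc p ⊥ ⊤ := fun hb => h.not_bot_isDesc (hb.trans h.top_isDesc)

lemma isDesc_or_pivot_isDesc (hz : IsDesc p ⊤ z) : IsDesc p z b ∨ IsDesc p a z :=
  h.top_isDesc.isDesc_child_or_isDesc_father h.child_mem hz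

lemma not_top_isDesc_bot : ¬ IsDesc p ⊤ ⊥ := fun ht =>
  (h.isDesc_or_pivot_isDesc ht).elim h.not_bot_isDesc h.not_pivot_isDesc_bot

lemma not_isDesc_top_of_lt (hz : z < a) : ¬ IsDesc p z ⊤ := fun hzt =>
  hz.not_gt (h.lt_of_isDesc z (hzt.trans h.top_isDesc))

lemma not_top_isDesc_of_mem_children_bot (hs : s ∈ children p ⊥) : ¬ IsDesc p ⊤ s := fun hts =>
  h.not_top_isDesc_bot (hts.trans (isDesc_of_mem_children hs))

lemma labelSwap_of_not_top_isDesc (hz : ¬ IsDesc p ⊤ z) : labelSwap ⊤ a z = z :=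
  labelSwap_of_ne (fun he => hz (he ▸ IsDesc.refl p z)) (fun he => hz (he ▸ h.top_isDesc_pivot))

omit h in
lemma eq_of_isDesc (h : PivotTree p a b) (h' : PivotTree p a' b') (haa' : IsDesc p a a') :
    a = a' := by
  rcases h'.isDesc_or_pivot_isDesc h.top_isDesc_pivot with hab' | ha'a
  · obtain ⟨-, z, hz, hle⟩ := isImproperEdge_iff_exists_le.1
      (h.isImproperEdge b' hab' (father_ne_of_mem_children h'.child_mem))
    rw [(mem_children.1 h'.child_mem).1] at hle
    exact absurd (h'.lt_of_isDesc z hz) (not_lt.2 hle)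
  · exact haa'.antisymm h.isRootedTree ha'a

lemma pivot_eq (h' : PivotTree p a' b') : a = a' :=
  (h.top_isDesc_pivot.total h'.top_isDesc_pivot).elim (eq_of_isDesc h h')
    fun ha'a => (eq_of_isDesc h' h ha'a).symm

lemma notMem_children_top_of_top_isDesc (hz : IsDesc p ⊤ z) : z ∉ children p ⊤ := fun hzt =>
  h.isRootedTree.not_isDesc_of_mem_children hzt hz

end PivotTree

end PivotTree

section PivotHandOver

variable {V : Type*} [Fintype V] [LinearOrder V] [BoundedOrder V] {p : V → V} {a b s x y z : V}

namespace PivotTree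

variable (h : PivotTree p a b)
include h

lemma isDesc_of_isDesc_handOver (hzx : IsDesc (handOver p a) z x) : IsDesc p z x := by
  rcases (isDesc_handOver_iff h.isRootedTree h.not_pivot_isDesc_top).1 hzx with hzx | ⟨hz, hax⟩
  · exact hzx.1
  · exact (isDesc_top_of_isBelow hz).trans (h.top_isDesc_pivot.trans hax)

lemma isDesc_handOver_of_pivot_isDesc (hx : IsDesc p a x) :
    IsDesc (handOver p a) z x ↔ IsDesc p z x := by
  refine ⟨h.isDesc_of_isDesc_handOver, fun hzx => ?_⟩
  rw [isDesc_handOver_iff h.isRootedTree h.not_pivot_isDesc_top]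
  by_cases hz : IsBelow p (children p ⊤) z
  · exact .inr ⟨hz, hx⟩
  · exact .inl ⟨hzx, fun s hs hzs => absurd ⟨s, hs, hzs⟩ hz⟩

lemma isDesc_handOver_of_not_top_isDesc (hx : ¬ IsDesc p ⊤ x) :
    IsDesc (handOver p a) z x ↔ IsDesc p z x := by
  by_cases hxt : IsDesc p x ⊤
  · exact isDesc_handOver_of_isBelow h.isRootedTree h.not_pivot_isDesc_top
      (hxt.exists_mem_children fun he => hx (he ▸ IsDesc.refl p x))
  · exact ⟨h.isDesc_of_isDesc_handOver, fun hzx =>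
      (isDesc_handOver_of_not_isDesc_top h.isRootedTree
        fun hzt => (hzx.total hzt).elim hxt hx).2 hzx⟩

lemma isImproperEdge_handOver_of_pivot_isDesc (hz : IsDesc p a z) :
    IsImproperEdge (handOver p a) z ↔ IsImproperEdge p z :=
  isImproperEdge_congr
    (handOver_of_notMem (h.notMem_children_top_of_top_isDesc (h.top_isDesc_pivot.trans hz)))
    (beta_congr fun _ => h.isDesc_handOver_of_pivot_isDesc hz)

lemma children_bot_handOver : children (handOver p a) ⊥ = children p ⊥ := by
  ext z
  by_cases hz : z ∈ children p ⊤
  · rw [mem_children, mem_children, handOver_of_mem hz, (mem_children.1 hz).1]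
    simp [h.bot_lt.ne', h.bot_ne_top.symm]
  · exact mem_children_moveSubtrees_of_notMem hz

lemma handOver : PivotTree (handOver p a) a b where
  isRootedTree := h.isRootedTree.handOver h.not_pivot_isDesc_top
  child_mem := (mem_children_moveSubtrees_of_notMem
    (h.notMem_children_top_of_top_isDesc h.top_isDesc)).2 h.child_mem
  top_isDesc := (top_isDesc_handOver_iff h.isRootedTree).2 h.top_isDesc
  lt_of_isDesc z hz := h.lt_of_isDesc z (h.isDesc_of_isDesc_handOver hz)
  isImproperEdge y hy hyr := by
    have hay := h.isDesc_of_isDesc_handOver hy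
    rw [handOver_of_notMem
      (h.notMem_children_top_of_top_isDesc (h.top_isDesc_pivot.trans hay))] at hyr
    exact (h.isImproperEdge_handOver_of_pivot_isDesc hay).2 (h.isImproperEdge y hay hyr)
  exists_beta_lt := by
    obtain ⟨s, hs, hlt⟩ := h.exists_beta_lt
    rw [h.children_bot_handOver]
    refine ⟨s, hs, (beta_le ?_).trans_lt hlt⟩
    rw [isDesc_handOver_of_not_isDesc_top h.isRootedTree (h.not_isDesc_top_of_lt hlt)]
    exact isDesc_beta p s

end PivotTree

end PivotHandOver

section PivotMapA

variable {V : Type*} [Fintype V] [LinearOrder V] [BoundedOrder V] {p q : V → V}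
  {a b s x y z : V}

lemma mapA_of_notMem (hz : z ∉ children p ⊥) : mapA p z = p z := moveSubtrees_of_notMem hz

namespace PivotTree

variable (h : PivotTree p a b)
include h

lemma not_isBelow_children_bot_of_top_isDesc (hz : IsDesc p ⊤ z) :
    ¬ IsBelow p (children p ⊥) z := fun ⟨_, hs, hzs⟩ =>
  h.not_top_isDesc_of_mem_children_bot hs (hz.trans hzs)

lemma not_isBelow_children_bot_top : ¬ IsBelow p (children p ⊥) ⊤ :=
  h.not_isBelow_children_bot_of_top_isDesc (IsDesc.refl p ⊤)

lemma isDesc_mapA_iff : IsDesc (mapA p) z x ↔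
    (IsDesc p z x ∧ ∀ s ∈ children p ⊥, IsDesc p z s → IsDesc p s x → s = x) ∨
      (IsBelow p (children p ⊥) z ∧ IsDesc p ⊤ x) :=
  isDesc_moveSubtrees h.isRootedTree h.not_isBelow_children_bot_top

lemma isDesc_mapA_of_not_isBelow (hz : ¬ IsBelow p (children p ⊥) z) :
    IsDesc (mapA p) z x ↔ IsDesc p z x :=
  isDesc_moveSubtrees_of_not_isBelow h.isRootedTree hz

lemma top_isDesc_mapA_iff : IsDesc (mapA p) ⊤ x ↔ IsDesc p ⊤ x :=
  h.isDesc_mapA_of_not_isBelow h.not_isBelow_children_bot_top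

lemma bot_isDesc_mapA_iff : IsDesc (mapA p) ⊥ x ↔ IsDesc p ⊥ x :=
  h.isDesc_mapA_of_not_isBelow h.isRootedTree.not_isBelow_children

lemma isDesc_mapA_or_bot_isDesc_mapA (hzx : IsDesc p z x) :
    IsDesc (mapA p) z x ∨ IsDesc (mapA p) ⊥ x := by
  rw [h.bot_isDesc_mapA_iff, h.isDesc_mapA_iff, or_iff_not_imp_right]
  refine fun hbot => .inl ⟨hzx, fun s hs _ hsx => ?_⟩
  by_contra hne
  exact hbot ((mem_children.1 hs).1 ▸ hsx.father hne)

lemma isImproperEdge_mapA_of_isImproperEdge (hz : z ∉ children p ⊥)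
    (hi : IsImproperEdge p z) : IsImproperEdge (mapA p) z := by
  obtain ⟨hzr, x, hx, hle⟩ := isImproperEdge_iff_exists_le.1 hi
  rw [isImproperEdge_iff_exists_le, mapA_of_notMem hz]
  rcases h.isDesc_mapA_or_bot_isDesc_mapA hx with hx | hbot
  · exact ⟨hzr, x, hx, hle⟩
  · exact ⟨hzr, ⊥, hbot, bot_le⟩

lemma father_ne_of_isDesc (hz : IsDesc p z b) : p z ≠ z := fun hzr =>
  father_ne_of_mem_children h.child_mem (hz.eq_of_fixed hzr ▸ hzr)

lemma pivot_le_father (hz : IsDesc p z b) : a ≤ p z := by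
  by_cases hzb : z = b
  · exact (hzb ▸ (mem_children.1 h.child_mem).1).ge
  · exact (h.lt_of_isDesc _ (hz.father hzb)).le

/-- Between `⊤` and `b`, the edges become improper because `⊤` receives a subtree of `⊥` with a
node smaller than `a`. -/
lemma isImproperEdge_mapA_of_isDesc (hz : IsDesc p ⊤ z) (hzb : IsDesc p z b) :
    IsImproperEdge (mapA p) z := by
  obtain ⟨s, hs, hlt⟩ := h.exists_beta_lt
  rw [isImproperEdge_iff_exists_le,
    mapA_of_notMem fun hs => h.not_top_isDesc_of_mem_children_bot hs hz]
  exact ⟨h.father_ne_of_isDesc hzb, beta p s,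
    h.isDesc_mapA_iff.2 (.inr ⟨⟨s, hs, isDesc_beta p s⟩, hz⟩),
    hlt.le.trans (h.pivot_le_father hzb)⟩

lemma isImproperEdge_mapA_iff : IsImproperEdge (mapA p) z ↔
    z ∈ children p ⊥ ∨ (IsDesc p ⊤ z ∧ IsDesc p z b) ∨ IsImproperEdge p z := by
  constructor
  · refine fun hi => or_iff_not_imp_left.2 fun hz => ?_
    obtain ⟨hzr, x, hx, hle⟩ := isImproperEdge_iff_exists_le.1 hi
    rw [mapA_of_notMem hz] at hzr hle
    by_cases htz : IsDesc p ⊤ z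
    · exact (h.isDesc_or_pivot_isDesc htz).imp (⟨htz, ·⟩) (h.isImproperEdge z · hzr)
    · refine .inr (isImproperEdge_iff_exists_le.2 ⟨hzr, x, ?_, hle⟩)
      exact (h.isDesc_mapA_iff.1 hx).elim And.left fun hx => absurd hx.2 htz
  · by_cases hz : z ∈ children p ⊥
    · refine fun _ => isImproperEdge_of_father_eq_top (moveSubtrees_of_mem hz) ?_
      rintro rfl
      exact h.not_top_isDesc_of_mem_children_bot hz (IsDesc.refl p ⊤)
    · rintro (hz' | ⟨htz, hzb⟩ | hi)
      · exact absurd hz' hz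
      · exact h.isImproperEdge_mapA_of_isDesc htz hzb
      · exact h.isImproperEdge_mapA_of_isImproperEdge hz hi

lemma isTopImproper_mapA : IsTopImproper (mapA p) := by
  refine ⟨h.isRootedTree.moveSubtrees h.not_isBelow_children_bot_top, fun y hy hyr => ?_⟩
  rw [h.top_isDesc_mapA_iff] at hy
  rw [mapA_of_notMem fun hs => h.not_top_isDesc_of_mem_children_bot hs hy] at hyr
  exact h.isImproperEdge_mapA_iff.2
    (.inr ((h.isDesc_or_pivot_isDesc hy).imp (⟨hy, ·⟩) (h.isImproperEdge y · hyr)))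

lemma children_top_mapA (hleaf : children p ⊤ = ∅) : children (mapA p) ⊤ = children p ⊥ := by
  ext z
  by_cases hz : z ∈ children p ⊥
  · simp only [hz, iff_true]
    refine (mem_children_moveSubtrees_of_mem hz).2 ⟨rfl, ?_⟩
    rintro rfl
    exact h.not_top_isDesc_of_mem_children_bot hz (IsDesc.refl p ⊤)
  · refine (mem_children_moveSubtrees_of_notMem hz).trans ?_
    simp [hleaf, hz]

lemma children_bot_mapA : children (mapA p) ⊥ = ∅ := by
  refine Finset.eq_empty_of_forall_notMem fun z hz => ?_
  by_cases hzS : z ∈ children p ⊥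
  · exact h.bot_ne_top.symm ((mem_children_moveSubtrees_of_mem hzS).1 hz).1
  · exact hzS ((mem_children_moveSubtrees_of_notMem hzS).1 hz)

lemma not_bot_isDesc_top_mapA : ¬ IsDesc (mapA p) ⊥ ⊤ := fun hb =>
  h.not_bot_isDesc_top (h.bot_isDesc_mapA_iff.1 hb)

omit h in
lemma eq_of_mapA_eq (h : PivotTree p a b) {a' b' : V} (h' : PivotTree q a' b')
    (hp : children p ⊤ = ∅) (hq : children q ⊤ = ∅) (he : mapA p = mapA q) : p = q := by
  have hback (r : V → V) : moveSubtrees (mapA r) (children r ⊥) ⊥ = r :=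
    moveSubtrees_moveSubtrees fun s hs => (mem_children.1 hs).1
  rw [← hback p, ← hback q, ← h.children_top_mapA hp, ← h'.children_top_mapA hq, he]

end PivotTree

lemma exists_pivotTree_mapA_eq (hq : IsTopImproper q) (hbot : children q ⊥ = ∅)
    (hbt : ¬ IsDesc q ⊥ ⊤) :
    ∃ t a b, PivotTree t a b ∧ children t ⊤ = ∅ ∧ mapA t = q := by
  have hq' := hq.isRootedTree
  have hne : (⊥ : V) ≠ ⊤ := fun he => hbt (he ▸ IsDesc.refl q _)
  have hleaf : children (handOver q ⊥) ⊤ = ∅ := children_top_handOver hne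
  have hchildren : children (handOver q ⊥) ⊥ = children q ⊤ := by
    ext z
    by_cases hz : z ∈ children q ⊤
    · simp only [hz, iff_true]
      refine (mem_children_moveSubtrees_of_mem hz).2 ⟨rfl, ?_⟩
      rintro rfl
      exact hbt (isDesc_of_mem_children hz)
    · refine (mem_children_moveSubtrees_of_notMem hz).trans ?_
      simp [hbot, hz]
  have hfather {z : V} (hz : IsDesc q ⊤ z) : handOver q ⊥ z = q z :=
    handOver_of_notMem fun hzt => hq'.not_isDesc_of_mem_children hzt hz
  have hroot : handOver q ⊥ ⊤ ≠ ⊤ := by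
    rw [hfather (IsDesc.refl q ⊤)]
    exact fun hr => hbt (hq'.isDesc_of_fixed hr ⊥)
  obtain ⟨a, b, hb, htb, hlt, himp⟩ :=
    exists_topmost_proper_edge (hq'.handOver hbt) hroot hleaf
  refine ⟨handOver q ⊥, a, b, ⟨hq'.handOver hbt, hb, htb, hlt, himp, ?_⟩, hleaf, ?_⟩
  · rw [top_isDesc_handOver_iff hq'] at htb
    have hbr := father_ne_of_mem_children hb
    rw [hfather htb] at hbr
    obtain ⟨-, x, hx, hle⟩ := isImproperEdge_iff_exists_le.1 (hq.isImproperEdge b htb hbr)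
    rw [← hfather htb, (mem_children.1 hb).1] at hle
    have hxt : IsBelow q (children q ⊤) x := by
      by_contra hn
      exact (hlt x ((isDesc_moveSubtrees_of_not_isBelow hq' hn).2 hx)).not_ge hle
    obtain ⟨d, hd, hxd⟩ := hxt
    refine ⟨d, hchildren ▸ hd, (beta_le ((isDesc_handOver_of_isBelow hq' hbt
      (.of_mem hd)).2 hxd)).trans_lt (lt_of_le_of_ne hle ?_)⟩
    rintro rfl
    exact hq'.not_isDesc_of_mem_children hd (((top_isDesc_handOver_iff hq').1
      (((top_isDesc_handOver_iff hq').2 htb).trans (isDesc_of_mem_children hb))).trans hxd)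
  · rw [mapA, hchildren]
    exact moveSubtrees_handOver

end PivotMapA

section ExchangedTree

variable {V : Type*} [Fintype V] [LinearOrder V] [BoundedOrder V] {p g : V → V}
  {a b c s x y z : V}

/-- The trees obtained by exchanging the labels `⊤` and `a = α` in a tree with `α > β*` and with
no proper edge on the path from `⊤` to the root. The former children of `⊤` hang from `a`, and
`b` is the one above the new place of `⊤`. -/
structure ExchangedTree (g : V → V) (a b : V) : Prop extends PivotTree g a b where
  beta_lt : ∀ c ∈ children g a, ¬ IsDesc g ⊤ c → beta g c < a

lemma beta_exchangeLabels_labelSwap_lt (hlt : beta p x < a) :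
    beta (exchangeLabels p ⊤ a) (labelSwap ⊤ a x) < a := by
  refine (beta_le ?_).trans_lt hlt
  rw [isDesc_exchangeLabels, labelSwap_labelSwap, labelSwap_top_of_lt hlt]
  exact isDesc_beta p x

lemma exchangedTree_exchangeLabels (hp : IsTopImproper p) (hb : b ∈ children p ⊤)
    (hmax : ∀ c ∈ children p ⊤, beta p c ≤ beta p b) (hs : s ∈ children p ⊥)
    (hlt : beta p s < beta p b) :
    ExchangedTree (exchangeLabels p ⊤ (beta p b)) (beta p b) (labelSwap ⊤ (beta p b) b) := by
  have hp' := hp.isRootedTree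
  have htb : ¬ IsDesc p ⊤ b := hp'.not_isDesc_of_mem_children hb
  have hat : IsDesc p (beta p b) ⊤ := (isDesc_beta p b).trans (isDesc_of_mem_children hb)
  have hatop : beta p b < ⊤ := lt_top_iff_ne_top.2 fun h => htb (h ▸ isDesc_beta p b)
  have htop := labelSwap_left ⊤ (beta p b)
  have hright := labelSwap_right ⊤ (beta p b)
  refine ⟨⟨hp'.exchangeLabels _ _, ?_, ?_, fun z hz => ?_, fun y hy hyr => ?_, ?_⟩,
    fun c hc htc => ?_⟩
  · nth_rw 2 [← htop]
    exact labelSwap_mem_children_exchangeLabels.2 hb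
  · nth_rw 2 [← hright]
    exact isDesc_exchangeLabels_labelSwap.2 (isDesc_beta p b)
  · obtain ⟨z, rfl⟩ := (labelSwap ⊤ (beta p b)).surjective z
    rw [isDesc_exchangeLabels_labelSwap] at hz
    rcases (beta_le hz).eq_or_lt with rfl | hbz
    · rwa [hright]
    · rwa [labelSwap_of_ne (fun he => htb (by rwa [← he])) hbz.ne']
  · obtain ⟨y, rfl⟩ := (labelSwap ⊤ (beta p b)).surjective y
    nth_rw 2 [← htop] at hy
    rw [isDesc_exchangeLabels_labelSwap] at hy
    rw [exchangeLabels_labelSwap, (labelSwap _ _).injective.ne_iff] at hyr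
    exact (isImproperEdge_exchangeLabels_labelSwap_of_isDesc hp' hy (hat.trans hy)).2
      (hp.isImproperEdge y hy hyr)
  · refine ⟨labelSwap ⊤ (beta p b) s, ?_, beta_exchangeLabels_labelSwap_lt hlt⟩
    rw [mem_children_exchangeLabels, labelSwap_labelSwap, labelSwap_top_of_lt (bot_le.trans_lt hlt)]
    exact hs
  · obtain ⟨c, rfl⟩ := (labelSwap ⊤ (beta p b)).surjective c
    rw [mem_children_exchangeLabels, labelSwap_labelSwap, hright] at hc
    rw [isDesc_exchangeLabels, labelSwap_labelSwap, htop] at htc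
    refine beta_exchangeLabels_labelSwap_lt (lt_of_le_of_ne (hmax c hc) fun he => htc ?_)
    exact he ▸ isDesc_beta p c

lemma exists_exchangedTree_of_betaStar_lt_alpha (hp : IsTopImproper p)
    (hne : (children p ⊥).Nonempty) (hlt : betaStar p < alpha p) :
    ∃ b, ExchangedTree (exchangeLabels p ⊤ (alpha p)) (alpha p) b := by
  obtain ⟨s, hs, hsβ⟩ := exists_beta_eq_betaStar hne
  obtain ⟨b, hb, hbα⟩ :=
    exists_beta_eq_alpha (hp.children_top_nonempty (bot_ne_top_of_mem_children hs))
  rw [← hsβ, ← hbα] at hlt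
  rw [← hbα]
  exact ⟨_, exchangedTree_exchangeLabels hp hb (fun c hc => hbα ▸ beta_le_alpha hc) hs hlt⟩

namespace PivotTree

variable (h : PivotTree g a b)
include h

lemma children_bot_exchangeLabels : children (exchangeLabels g ⊤ a) ⊥ = children g ⊥ := by
  have hmem {z : V} (hz : z ∈ children g ⊥) : labelSwap ⊤ a z = z :=
    h.labelSwap_of_not_top_isDesc (h.not_top_isDesc_of_mem_children_bot hz)
  ext z
  rw [mem_children_exchangeLabels, labelSwap_top_of_lt h.bot_lt]
  refine ⟨fun hz => ?_, fun hz => by rwa [hmem hz]⟩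
  rwa [← (labelSwap ⊤ a).injective (hmem hz)]

lemma isTopImproper_exchangeLabels : IsTopImproper (exchangeLabels g ⊤ a) := by
  refine ⟨h.isRootedTree.exchangeLabels _ _, fun y hy hyr => ?_⟩
  obtain ⟨y, rfl⟩ := (labelSwap ⊤ a).surjective y
  rw [isDesc_exchangeLabels, labelSwap_labelSwap, labelSwap_left] at hy
  rw [exchangeLabels_labelSwap, (labelSwap _ _).injective.ne_iff] at hyr
  exact (isImproperEdge_exchangeLabels_labelSwap_of_isDesc h.isRootedTree
    (h.top_isDesc_pivot.trans hy) hy).2 (h.isImproperEdge y hy hyr)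

lemma isDesc_exchangeLabels_of_not_top_isDesc (htz : ¬ IsDesc g ⊤ z) :
    IsDesc (exchangeLabels g ⊤ a) x z ↔ IsDesc g x z := by
  have haz : ¬ IsDesc g a z := fun haz => htz (h.top_isDesc_pivot.trans haz)
  rw [isDesc_exchangeLabels, h.labelSwap_of_not_top_isDesc htz]
  by_cases hxt : x = ⊤
  · rw [hxt, labelSwap_left]
    exact iff_of_false haz htz
  by_cases hxa : x = a
  · rw [hxa, labelSwap_right]
    exact iff_of_false htz haz
  rw [labelSwap_of_ne hxt hxa]

lemma beta_exchangeLabels_labelSwap_child :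
    beta (exchangeLabels g ⊤ a) (labelSwap ⊤ a b) = a := by
  apply le_antisymm
  · refine beta_le (isDesc_exchangeLabels.2 ?_)
    rw [labelSwap_right, labelSwap_labelSwap]
    exact h.top_isDesc
  · refine le_beta_iff.2 fun z hz => ?_
    obtain ⟨z, rfl⟩ := (labelSwap ⊤ a).surjective z
    rw [isDesc_exchangeLabels_labelSwap] at hz
    by_cases hzt : z = ⊤
    · rw [hzt, labelSwap_left]
    · have hlt := h.lt_of_isDesc z hz
      rw [labelSwap_of_ne hzt hlt.ne']
      exact hlt.le

lemma betaStar_exchangeLabels_lt : betaStar (exchangeLabels g ⊤ a) < a := by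
  obtain ⟨s, hs, hlt⟩ := h.exists_beta_lt
  refine (betaStar_le_beta ?_).trans_lt (beta_exchangeLabels_labelSwap_lt hlt)
  rw [mem_children_exchangeLabels, labelSwap_labelSwap, labelSwap_top_of_lt h.bot_lt]
  exact hs

end PivotTree

namespace ExchangedTree

variable (h : ExchangedTree g a b)
include h

lemma alpha_exchangeLabels : alpha (exchangeLabels g ⊤ a) = a := by
  apply le_antisymm
  · refine Finset.sup_le fun c hc => ?_
    obtain ⟨c, rfl⟩ := (labelSwap ⊤ a).surjective c
    rw [mem_children_exchangeLabels, labelSwap_labelSwap, labelSwap_left] at hc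
    by_cases htc : IsDesc g ⊤ c
    · rw [← h.isRootedTree.eq_of_mem_children h.child_mem hc h.top_isDesc htc]
      exact h.beta_exchangeLabels_labelSwap_child.le
    · exact (beta_exchangeLabels_labelSwap_lt (h.beta_lt c hc htc)).le
  · refine h.beta_exchangeLabels_labelSwap_child.ge.trans (beta_le_alpha ?_)
    rw [mem_children_exchangeLabels, labelSwap_labelSwap, labelSwap_left]
    exact h.child_mem

lemma isImproperEdge_exchangeLabels_of_isDesc (htz : IsDesc g ⊤ z) (hzb : IsDesc g z b) :
    IsImproperEdge (exchangeLabels g ⊤ a) (labelSwap ⊤ a z) := by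
  refine isImproperEdge_exchangeLabels_labelSwap.2 ⟨h.father_ne_of_isDesc hzb, ⊤, htz, ?_⟩
  rw [labelSwap_left]
  rcases (h.pivot_le_father hzb).eq_or_lt with he | hlt
  · rw [← he, labelSwap_right]
    exact le_top
  · rw [labelSwap_of_ne (fun he => h.isRootedTree.not_isDesc_father
      (h.father_ne_of_isDesc hzb) (by rwa [he])) hlt.ne']
    exact hlt.le

lemma isImproperEdge_exchangeLabels_iff_of_not_top_isDesc (htz : ¬ IsDesc g ⊤ z) :
    IsImproperEdge (exchangeLabels g ⊤ a) (labelSwap ⊤ a z) ↔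
      IsImproperEdge (handOver g a) z := by
  have hfather : exchangeLabels g ⊤ a (labelSwap ⊤ a z) = labelSwap ⊤ a (g z) :=
    exchangeLabels_labelSwap
  have hbeta : beta (exchangeLabels g ⊤ a) z = beta (handOver g a) z := beta_congr fun u => by
    rw [h.isDesc_exchangeLabels_of_not_top_isDesc htz, h.isDesc_handOver_of_not_top_isDesc htz]
  have hzt : z ≠ ⊤ := fun he => htz (he ▸ IsDesc.refl g z)
  rw [h.labelSwap_of_not_top_isDesc htz] at hfather ⊢
  by_cases hz : z ∈ children g ⊤
  · rw [(mem_children.1 hz).1, labelSwap_left] at hfather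
    exact isImproperEdge_congr (hfather.trans (handOver_of_mem hz).symm) hbeta
  by_cases hza : g z = a
  · rw [hza, labelSwap_right] at hfather
    have hc : z ∈ children g a :=
      mem_children.2 ⟨hza, fun he => htz (he ▸ h.top_isDesc_pivot)⟩
    refine iff_of_true (isImproperEdge_of_father_eq_top hfather hzt) ?_
    rw [isImproperEdge_iff_exists_le, handOver_of_notMem hz]
    exact ⟨father_ne_of_mem_children hc, beta g z,
      (h.isDesc_handOver_of_not_top_isDesc htz).2 (isDesc_beta g z),
      (h.beta_lt z hc htz).le.trans hza.ge⟩
  · rw [labelSwap_of_ne (fun he => hz (mem_children.2 ⟨he, hzt⟩)) hza,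
      ← handOver_of_notMem (a := a) hz] at hfather
    exact isImproperEdge_congr hfather hbeta

lemma isImproperEdge_exchangeLabels_iff :
    IsImproperEdge (exchangeLabels g ⊤ a) (labelSwap ⊤ a z) ↔
      (IsDesc g ⊤ z ∧ IsDesc g z b) ∨ IsImproperEdge (handOver g a) z := by
  by_cases htz : IsDesc g ⊤ z
  · rcases h.isDesc_or_pivot_isDesc htz with hzb | haz
    · exact iff_of_true (h.isImproperEdge_exchangeLabels_of_isDesc htz hzb) (.inl ⟨htz, hzb⟩)
    · rw [isImproperEdge_exchangeLabels_labelSwap_of_isDesc h.isRootedTree htz haz,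
        h.isImproperEdge_handOver_of_pivot_isDesc haz]
      exact (or_iff_right fun hzb => h.not_pivot_isDesc (haz.trans hzb.2)).symm
  · rw [h.isImproperEdge_exchangeLabels_iff_of_not_top_isDesc htz]
    exact (or_iff_right fun hzb => htz hzb.1).symm

lemma improperCount_mapA_handOver :
    improperCount (mapA (handOver g a)) = improperCount (exchangeLabels g ⊤ a) + deg g ⊥ := by
  refine improperCount_eq_add_card (labelSwap ⊤ a) (fun z => ?_) fun z hz => ?_
  · have hzb (htz : IsDesc g ⊤ z) : IsDesc (handOver g a) z b ↔ IsDesc g z b :=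
      isDesc_moveSubtrees_of_not_isBelow h.isRootedTree fun ⟨_, hs, hzs⟩ =>
        h.isRootedTree.not_isDesc_of_mem_children hs (htz.trans hzs)
    rw [h.handOver.isImproperEdge_mapA_iff, h.children_bot_handOver,
      h.isImproperEdge_exchangeLabels_iff, top_isDesc_handOver_iff h.isRootedTree,
      and_congr_right hzb]
  · have htz := h.not_top_isDesc_of_mem_children_bot hz
    rw [h.isImproperEdge_exchangeLabels_iff_of_not_top_isDesc htz]
    rw [← h.children_bot_handOver] at hz
    exact h.handOver.isRootedTree.not_isImproperEdge_of_mem_children_bot hz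

end ExchangedTree

end ExchangedTree

section TakeBack

variable {V : Type*} [Fintype V] [LinearOrder V] [BoundedOrder V] {p g t : V → V}
  {a a' b b' c s x y z : V}

open Classical in
/-- The children of `a`, apart from the one above `⊤`, all of whose descendants are greater than
`a`. When the subtrees of `⊤` have been handed over to `a = α`, these are their roots. -/
noncomputable def largeSideChildren (t : V → V) (a : V) : Finset V :=
  (children t a).filter (fun c => ¬ IsDesc t ⊤ c ∧ a < beta t c)

/-- The inverse of `handOver`: the subtrees of `a` at `largeSideChildren` are moved to `⊤`. -/
noncomputable def takeBack (t : V → V) (a : V) : V → V :=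
  moveSubtrees t (largeSideChildren t a) ⊤

lemma mem_largeSideChildren : c ∈ largeSideChildren t a ↔
    c ∈ children t a ∧ ¬ IsDesc t ⊤ c ∧ a < beta t c := by
  simp only [largeSideChildren, Finset.mem_filter]

lemma takeBack_of_notMem (hz : z ∉ largeSideChildren t a) : takeBack t a z = t z :=
  moveSubtrees_of_notMem hz

lemma not_isBelow_largeSideChildren_top : ¬ IsBelow t (largeSideChildren t a) ⊤ :=
  fun ⟨_, hc, htc⟩ => (mem_largeSideChildren.1 hc).2.1 htc

lemma lt_of_isBelow_largeSideChildren (hz : IsBelow t (largeSideChildren t a) z) : a < z := by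
  obtain ⟨c, hc, hzc⟩ := hz
  exact (mem_largeSideChildren.1 hc).2.2.trans_le (beta_le hzc)

lemma notMem_largeSideChildren_of_pivot_isDesc (hz : IsDesc t a z) :
    z ∉ largeSideChildren t a := fun hzC => (lt_of_isBelow_largeSideChildren ⟨z, hzC, hz⟩).false

lemma isDesc_takeBack_of_le (ht : IsRootedTree t) (hz : z ≤ a) :
    IsDesc (takeBack t a) z x ↔ IsDesc t z x :=
  isDesc_moveSubtrees_of_not_isBelow ht fun hb => hz.not_gt (lt_of_isBelow_largeSideChildren hb)

lemma top_isDesc_takeBack_iff (ht : IsRootedTree t) :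
    IsDesc (takeBack t a) ⊤ x ↔ IsDesc t ⊤ x :=
  isDesc_moveSubtrees_of_not_isBelow ht not_isBelow_largeSideChildren_top

lemma handOver_takeBack (hleaf : children t ⊤ = ∅) : handOver (takeBack t a) a = t := by
  have hchildren : children (takeBack t a) ⊤ = largeSideChildren t a := by
    ext z
    by_cases hz : z ∈ largeSideChildren t a
    · simp only [hz, iff_true]
      refine (mem_children_moveSubtrees_of_mem hz).2 ⟨rfl, fun he => ?_⟩
      exact (mem_largeSideChildren.1 hz).2.1 (he ▸ IsDesc.refl t z)
    · refine (mem_children_moveSubtrees_of_notMem hz).trans ?_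
      simp [hleaf, hz]
  rw [handOver, hchildren]
  exact moveSubtrees_moveSubtrees fun s hs =>
    (mem_children.1 (mem_largeSideChildren.1 hs).1).1

namespace ExchangedTree

lemma largeSideChildren_handOver (h : ExchangedTree g a b) :
    largeSideChildren (handOver g a) a = children g ⊤ := by
  ext z
  rw [mem_largeSideChildren, top_isDesc_handOver_iff h.isRootedTree]
  constructor
  · rintro ⟨hz, htz, hlt⟩
    by_contra hzt
    have hlt' := h.beta_lt z ((mem_children_moveSubtrees_of_notMem hzt).1 hz) htz
    rw [beta_congr fun u => h.isDesc_handOver_of_not_top_isDesc htz] at hlt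
    exact lt_asymm hlt hlt'
  · intro hz
    refine ⟨(mem_children_moveSubtrees_of_mem hz).2 ⟨rfl, fun he => ?_⟩,
      h.isRootedTree.not_isDesc_of_mem_children hz, ?_⟩
    · exact h.not_pivot_isDesc_top (he ▸ isDesc_of_mem_children hz)
    · exact h.lt_of_isDesc _ (((h.isDesc_of_isDesc_handOver (isDesc_beta _ z)).trans
        (isDesc_of_mem_children hz)).trans h.top_isDesc)

lemma takeBack_handOver (h : ExchangedTree g a b) : takeBack (handOver g a) a = g := by
  rw [takeBack, h.largeSideChildren_handOver]
  exact moveSubtrees_handOver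

end ExchangedTree

namespace PivotTree

variable (h : PivotTree t a b)
include h

lemma isDesc_takeBack_iff : IsDesc (takeBack t a) z x ↔
    (IsDesc t z x ∧ ∀ s ∈ largeSideChildren t a, IsDesc t z s → IsDesc t s x → s = x) ∨
      (IsBelow t (largeSideChildren t a) z ∧ IsDesc t ⊤ x) :=
  isDesc_moveSubtrees h.isRootedTree not_isBelow_largeSideChildren_top

lemma isImproperEdge_takeBack (hy : IsDesc t a y) (hyr : t y ≠ y) :
    IsImproperEdge (takeBack t a) y := by
  obtain ⟨-, x, hx, hle⟩ := isImproperEdge_iff_exists_le.1 (h.isImproperEdge y hy hyr)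
  rw [isImproperEdge_iff_exists_le,
    takeBack_of_notMem (notMem_largeSideChildren_of_pivot_isDesc hy)]
  refine ⟨hyr, x, h.isDesc_takeBack_iff.2 ?_, hle⟩
  by_cases hb : IsBelow t (largeSideChildren t a) x
  · exact .inr ⟨hb, h.top_isDesc_pivot.trans hy⟩
  · exact .inl ⟨hx, fun s hs hxs => absurd ⟨s, hs, hxs⟩ hb⟩

lemma exchangedTree_takeBack : ExchangedTree (takeBack t a) a b where
  isRootedTree := h.isRootedTree.moveSubtrees not_isBelow_largeSideChildren_top
  child_mem := (mem_children_moveSubtrees_of_notMem fun hb =>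
    (mem_largeSideChildren.1 hb).2.1 h.top_isDesc).2 h.child_mem
  top_isDesc := (top_isDesc_takeBack_iff h.isRootedTree).2 h.top_isDesc
  lt_of_isDesc z hz := (h.isDesc_takeBack_iff.1 hz).elim (fun hz => h.lt_of_isDesc z hz.1)
    fun hz => lt_of_isBelow_largeSideChildren hz.1
  isImproperEdge y hy hyr := by
    rw [isDesc_takeBack_of_le h.isRootedTree le_rfl] at hy
    rw [takeBack_of_notMem (notMem_largeSideChildren_of_pivot_isDesc hy)] at hyr
    exact h.isImproperEdge_takeBack hy hyr
  exists_beta_lt := by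
    obtain ⟨s, hs, hlt⟩ := h.exists_beta_lt
    refine ⟨s, (mem_children_moveSubtrees_of_notMem fun hsC => ?_).2 hs,
      (beta_le ((isDesc_takeBack_of_le h.isRootedTree hlt.le).2 (isDesc_beta t s))).trans_lt hlt⟩
    exact lt_asymm hlt (mem_largeSideChildren.1 hsC).2.2
  beta_lt c hc htc := by
    rw [top_isDesc_takeBack_iff h.isRootedTree] at htc
    have hcC : c ∉ largeSideChildren t a := fun hcC =>
      h.lt_top.ne' ((mem_children_moveSubtrees_of_mem hcC).1 hc).1
    have hct := (mem_children_moveSubtrees_of_notMem hcC).1 hc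
    have hlt : beta t c < a := by
      refine lt_of_le_of_ne (not_lt.1 fun hac => hcC (mem_largeSideChildren.2 ⟨hct, htc, hac⟩))
        fun he => h.isRootedTree.not_isDesc_of_mem_children hct (he ▸ isDesc_beta t c)
    exact (beta_le ((isDesc_takeBack_of_le h.isRootedTree hlt.le).2 (isDesc_beta t c))).trans_lt hlt

end PivotTree

lemma ExchangedTree.eq_of_mapA_handOver_eq {g' : V → V} (h : ExchangedTree g a b)
    (h' : ExchangedTree g' a' b') (he : mapA (handOver g a) = mapA (handOver g' a')) :
    a = a' ∧ g = g' := by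
  have ht : handOver g a = handOver g' a' := PivotTree.eq_of_mapA_eq h.handOver h'.handOver
    (children_top_handOver h.lt_top.ne) (children_top_handOver h'.lt_top.ne) he
  obtain rfl : a = a' := h.handOver.pivot_eq (ht ▸ h'.handOver)
  exact ⟨rfl, by rw [← h.takeBack_handOver, ht, h'.takeBack_handOver]⟩

lemma exists_exchangedTree_mapA_handOver_eq (hq : IsTopImproper p) (hbot : children p ⊥ = ∅)
    (hbt : ¬ IsDesc p ⊥ ⊤) :
    ∃ g a b, ExchangedTree g a b ∧ mapA (handOver g a) = p := by
  obtain ⟨t, a, b, h, hleaf, rfl⟩ := exists_pivotTree_mapA_eq hq hbot hbt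
  exact ⟨takeBack t a, a, b, h.exchangedTree_takeBack, by rw [handOver_takeBack hleaf]⟩

end TakeBack

section BijB

variable {n k m : ℕ} [NeZero n] {p : Fin n → Fin n}

lemma exists_exchangedTree_of_mem_sourceB (hm : 1 ≤ m) (hp : p ∈ sourceB n k m) :
    ∃ b, ExchangedTree (exchangeLabels p ⊤ (alpha p)) (alpha p) b :=
  exists_exchangedTree_of_betaStar_lt_alpha (mem_RTrees_zero_iff.1 hp.1).1
    (children_nonempty_of_deg_eq hm hp.2.1) hp.2.2

lemma mapsTo_mapB (hm : 1 ≤ m) : Set.MapsTo mapB (sourceB n k m) (targetB n k m) := by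
  intro p hp
  obtain ⟨b, h⟩ := exists_exchangedTree_of_mem_sourceB hm hp
  have hdeg : deg (exchangeLabels p ⊤ (alpha p)) ⊥ = m := by
    rw [← hp.2.1, deg, ← h.children_bot_exchangeLabels, exchangeLabels_exchangeLabels, deg]
  refine ⟨mem_RTrees_zero_iff.2 ⟨h.handOver.isTopImproper_mapA, ?_⟩, ?_, ?_,
    h.handOver.not_bot_isDesc_top_mapA⟩
  · refine h.improperCount_mapA_handOver.trans ?_
    rw [exchangeLabels_exchangeLabels, (mem_RTrees_zero_iff.1 hp.1).2, hdeg]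
  · exact Finset.card_eq_zero.2 h.handOver.children_bot_mapA
  · refine (congrArg Finset.card
      (h.handOver.children_top_mapA (children_top_handOver h.lt_top.ne))).trans ?_
    rw [h.children_bot_handOver, ← hdeg, deg]

lemma injOn_mapB (hm : 1 ≤ m) : Set.InjOn mapB (sourceB n k m) := by
  intro p hp p' hp' he
  obtain ⟨b, h⟩ := exists_exchangedTree_of_mem_sourceB hm hp
  obtain ⟨b', h'⟩ := exists_exchangedTree_of_mem_sourceB hm hp'
  obtain ⟨ha, hg⟩ := h.eq_of_mapA_handOver_eq h' he
  rw [← exchangeLabels_exchangeLabels (p := p) (x := ⊤) (y := alpha p), hg, ha,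
    exchangeLabels_exchangeLabels]

lemma surjOn_mapB : Set.SurjOn mapB (sourceB n k m) (targetB n k m) := by
  rintro q ⟨hq, hbot, htop, hbt⟩
  rw [mem_RTrees_zero_iff] at hq
  obtain ⟨g, a, b, h, rfl⟩ :=
    exists_exchangedTree_mapA_handOver_eq hq.1 (Finset.card_eq_zero.1 hbot) hbt
  have hdeg : deg g ⊥ = m := by
    rw [← htop, deg, deg, h.handOver.children_top_mapA (children_top_handOver h.lt_top.ne),
      h.children_bot_handOver]
  have hcount := hq.2
  rw [h.improperCount_mapA_handOver, hdeg, Nat.add_right_cancel_iff] at hcount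
  refine ⟨exchangeLabels g ⊤ a, ⟨mem_RTrees_zero_iff.2 ⟨h.isTopImproper_exchangeLabels, hcount⟩,
    ?_, ?_⟩, ?_⟩
  · rw [deg, h.children_bot_exchangeLabels, ← deg, hdeg]
  · rw [h.alpha_exchangeLabels]
    exact h.betaStar_exchangeLabels_lt
  · change mapA (handOver (exchangeLabels (exchangeLabels g ⊤ a) ⊤ _) _) = _
    rw [h.alpha_exchangeLabels, exchangeLabels_exchangeLabels]

theorem bijOn_mapB (hm : 1 ≤ m) : Set.BijOn mapB (sourceB n k m) (targetB n k m) :=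
  ⟨mapsTo_mapB hm, injOn_mapB hm, surjOn_mapB⟩

end BijB

section Partition

variable {n k m : ℕ} [NeZero n]

lemma alpha_ne_betaStar {V : Type*} [Fintype V] [LinearOrder V] [BoundedOrder V] {p : V → V}
    (hp : IsTopImproper p) (hne : (children p ⊥).Nonempty) : alpha p ≠ betaStar p := by
  obtain ⟨a, ha, haβ⟩ := exists_beta_eq_betaStar hne
  have hbt := bot_ne_top_of_mem_children ha
  obtain ⟨b, hb, hbα⟩ := exists_beta_eq_alpha (hp.children_top_nonempty hbt)
  intro he
  have hβ : beta p b = beta p a := by rw [hbα, he, haβ]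
  rcases (isDesc_beta p b).isDesc_child_or_isDesc_father hb (hβ ▸ isDesc_beta p a) with hab | hta
  · have hne' : a ≠ b := by
      rintro rfl
      exact hbt ((mem_children.1 ha).1.symm.trans (mem_children.1 hb).1)
    have hbotb : IsDesc p ⊥ b := (mem_children.1 ha).1 ▸ hab.father hne'
    exact ((hp.isRootedTree.bot_lt_beta_of_mem_children ha).trans_eq hβ.symm).not_ge
      (beta_le hbotb)
  · exact hp.not_isBelow_children_bot_top hbt ⟨a, ha, hta⟩

theorem sources_union (hm : 1 ≤ m) :
    sourceA n k m ∪ sourceB n k m ∪ sourceC n k m ∪ sourceD n k m =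
      {p | p ∈ RTrees n k 0 ∧ deg p ⊥ = m} := by
  ext p
  constructor
  · rintro (((h | h) | h) | h) <;> exact ⟨h.1, h.2.1⟩
  · rintro ⟨hp, hdeg⟩
    have htop := (mem_RTrees_zero_iff.1 hp).1
    have hne := children_nonempty_of_deg_eq hm hdeg
    have hpos : 0 < deg p ⊤ := Finset.card_pos.2
      (htop.children_top_nonempty (bot_ne_top_of_mem_children hne.choose_spec))
    rcases lt_or_gt_of_ne (alpha_ne_betaStar htop hne) with hlt | hgt
    · by_cases hbt : IsDesc p ⊥ ⊤
      · by_cases hone : deg p ⊤ = 1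
        · exact .inr ⟨hp, hdeg, hbt, hone⟩
        · exact .inl (.inr ⟨hp, hdeg, hbt, by omega, hlt⟩)
      · exact .inl (.inl (.inl ⟨hp, hdeg, hbt, hlt⟩))
    · exact .inl (.inl (.inr ⟨hp, hdeg, hgt⟩))

theorem sources_disjoint (hm : 1 ≤ m) :
    [sourceA n k m, sourceB n k m, sourceC n k m, sourceD n k m].Pairwise Disjoint := by
  have hltD {p} (hp : p ∈ sourceD n k m) : alpha p < betaStar p :=
    (exists_soleSwingable_of_mem_sourceD hm hp).choose_spec.alpha_lt_betaStar
  simp only [List.pairwise_cons, List.mem_cons, List.not_mem_nil, or_false, forall_eq_or_imp,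
    forall_eq, Set.disjoint_left, false_imp_iff, implies_true, List.Pairwise.nil, and_true]
  refine ⟨⟨fun p hA hB => lt_asymm hA.2.2.2 hB.2.2, fun p hA hC => hA.2.2.1 hC.2.2.1,
    fun p hA hD => hA.2.2.1 hD.2.2.1⟩, ⟨fun p hB hC => lt_asymm hB.2.2 hC.2.2.2.2,
    fun p hB hD => lt_asymm hB.2.2 (hltD hD)⟩, fun p hC hD => ?_⟩
  have hle := hC.2.2.2.1
  have hone := hD.2.2.2
  omega

theorem targets_union (hm : 1 ≤ m) :
    targetA n k m ∪ targetB n k m ∪ targetC n k m ∪ targetD n k m =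
      {p | p ∈ RTrees n (k + m) 0 ∧ deg p ⊥ = 0 ∧ m ≤ deg p ⊤ ∧ ⊥ < lowerCritical p} := by
  ext p
  constructor
  · rintro (((h | h) | h) | h)
    · exact ⟨h.1, h.2.1, Nat.le_of_lt h.2.2.1, bot_lt_lowerCritical_of_not_isDesc
        (Finset.card_pos.1 (Nat.zero_lt_of_lt h.2.2.1)) h.2.2.2⟩
    · exact ⟨h.1, h.2.1, h.2.2.1.ge, bot_lt_lowerCritical_of_not_isDesc
        (children_nonempty_of_deg_eq hm h.2.2.1) h.2.2.2⟩
    · exact ⟨h.1, h.2.1, Nat.le_of_lt h.2.2.1, h.2.2.2.2⟩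
    · exact ⟨h.1, h.2.1, h.2.2.1.ge, h.2.2.2.2⟩
  · rintro ⟨hp, hdeg, hle, hcrit⟩
    by_cases hbt : IsDesc p ⊥ ⊤ <;> rcases hle.eq_or_lt with heq | hlt
    · exact .inr ⟨hp, hdeg, heq.symm, hbt, hcrit⟩
    · exact .inl (.inr ⟨hp, hdeg, hlt, hbt, hcrit⟩)
    · exact .inl (.inl (.inr ⟨hp, hdeg, heq.symm, hbt⟩))
    · exact .inl (.inl (.inl ⟨hp, hdeg, hlt, hbt⟩))

theorem targets_disjoint :
    [targetA n k m, targetB n k m, targetC n k m, targetD n k m].Pairwise Disjoint := by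
  simp only [List.pairwise_cons, List.mem_cons, List.not_mem_nil, or_false, forall_eq_or_imp,
    forall_eq, Set.disjoint_left, false_imp_iff, implies_true, List.Pairwise.nil, and_true]
  refine ⟨⟨fun p hA hB => (Nat.lt_of_succ_le hA.2.2.1).ne' hB.2.2.1,
    fun p hA hC => hA.2.2.2 hC.2.2.2.1, fun p hA hD => hA.2.2.2 hD.2.2.2.1⟩,
    ⟨fun p hB hC => hB.2.2.2 hC.2.2.2.1, fun p hB hD => hB.2.2.2 hD.2.2.2.1⟩,
    fun p hC hD => (Nat.lt_of_succ_le hC.2.2.1).ne' hD.2.2.1⟩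

end Partition

theorem mainTheorem7 (n k m : ℕ) [NeZero n] (hm : 1 ≤ m) :
    Set.BijOn mapA (sourceA n k m) (targetA n k m) ∧
    Set.BijOn mapB (sourceB n k m) (targetB n k m) ∧
    Set.BijOn mapC (sourceC n k m) (targetC n k m) ∧
    Set.BijOn mapD (sourceD n k m) (targetD n k m) ∧
    -- the four sources partition the left side of the bijection that is being refined
    (sourceA n k m ∪ sourceB n k m ∪ sourceC n k m ∪ sourceD n k m =
        {p | p ∈ RTrees n k 0 ∧ deg p ⊥ = m} ∧
      [sourceA n k m, sourceB n k m, sourceC n k m, sourceD n k m].Pairwise Disjoint) ∧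
    -- the four targets partition its right side
    (targetA n k m ∪ targetB n k m ∪ targetC n k m ∪ targetD n k m =
        {p | p ∈ RTrees n (k + m) 0 ∧ deg p ⊥ = 0 ∧ m ≤ deg p ⊤ ∧ ⊥ < lowerCritical p} ∧
      [targetA n k m, targetB n k m, targetC n k m, targetD n k m].Pairwise Disjoint) :=
  ⟨bijOn_mapA hm, bijOn_mapB hm, bijOn_mapC hm, bijOn_mapD hm,
    ⟨sources_union hm, sources_disjoint hm⟩, targets_union hm, targets_disjoint⟩
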